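/- **Setting.** Let $N$ be a ground set of size $n$, $\mathcal M=(N,\mathcal I)$ a matroid of rank $r$ given by an independence oracle, and $f:2^N\to\mathbb R_{\ge 0}$ a submodular function, not necessarily monotone; let $O^*\in\arg\max_{S\in\mathcal I}f(S)$. The function $f$ is accessible only through the noisy oracle $\tilde f(S)=\xi_S f(S)$, where $(\xi_S)_{S\subseteq N}$ are independent non-negative random variables with a common (unknown) law $\mathcal D$ of mean $1$; the noise is persistent, i.e. each $\xi_S$ is drawn once. The law $\mathcal D$ is sub-exponential with known parameters $\nu>0$, $\alpha\ge 0$: $\mathbb E[e^{\lambda(\xi-1)}]\le e^{\nu^2\lambda^2/2}$ for all $|\lambda|\le 1/\alpha$ (all $\lambda$ if $\alpha=0$). **Algorithm.** Given $\varepsilon>0$, put $m=\lceil\max\{2,8\nu^2\}\frac{n^4}{\varepsilon^2}(n+\log(4n))\rceil$, $t=\lceil\log_2(4m)\rceil$, $h=t^2$. (1) Take a basis $B_0$ of $\mathcal M$ and a uniformly random $H\subseteq B_0$ with $|H|=h$ (all of $B_0$ if $r<h$). (2) Sample $H_1,\dots,H_m$ from the $t$-subsets of $H$ uniformly without replacement,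 and let $\hat F(S)=\frac1m\sum_{i=1}^m\tilde f(S\cup H_i)$. (3) Run measured continuous greedy on the ground set $N\setminus H$ with the value oracle $\hat F$ and the matroid $\mathcal I_H=\{S\subseteq N\setminus H: S\cup H\in\mathcal I\}$, obtaining $S_H\in\mathcal I_H$: with $n'=|N\setminus H|$ and $\delta=n'^{-4}$, start from $x=0$ and repeat $1/\delta$ times: for each $i$ let $\hat\omega_i$ be the average of $\lceil 10\delta^{-2}\log(2n')\rceil$ independent samples of $\hat F(R\cup\{i\})-\hat F(R)$, where $R$ contains each $j$ independently with probability $x_j$; find $\hat I\in\arg\max_{I\in\mathcal I_H}\sum_{i\in I}\hat\omega_i$; replace $x_i$ by $x_i+\delta(1-x_i)$ for $i\in\hat I$. The final $x$ is rounded to $S_H\in\mathcal I_H$ without further value queries, by randomized pipage rounding in exchange form (swap rounding): $x$ is written as a convex combination of independent sets, which are merged successively by random, expectation-preserving exchanges of elements. (4) Return $\mathrm{ALG}=S_H\cup H'$, where $H'$ is a uniformly random $t$-subset of $H$ (all of $H$ if $|H|<t$). **Theorem.** The algorithm always returns an independent set, and its running time (unit-cost arithmetic, biased coins and oracle calls,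 worst case over its random choices and the oracle's answers) is bounded by a polynomial in $n$, $1/\varepsilon$ and $\nu$. Moreover there are absolute constants $c,C>0$, and for every $\nu>0$ a constant $C_0>0$, such that the following holds. If $0<\varepsilon<2\nu^2/\alpha$ (for $\alpha=0$: any $\varepsilon>0$), $n>\varepsilon$, $n\ge 1/\varepsilon$ and $r\ge \frac{C_0}{\varepsilon}\log^2\frac n\varepsilon$, then $$\mathbb E[f(\mathrm{ALG})]\ \ge\ \Big(\frac1e-\frac{1}{c\,\log(n/\varepsilon)}-C\varepsilon\Big)f(O^*),$$ where the expectation is over the noise and the coins of the algorithm. -/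

import Mathlib

open MeasureTheory ProbabilityTheory
open scoped ENNReal

noncomputable section

namespace NoisySubmodular

/-! ### Submodular functions and the noise model -/

/-- Diminishing returns: `f (A + x) - f A ≥ f (B + x) - f B` whenever `A ⊆ B` and `x ∉ B`. -/
def IsSubmodular {n : ℕ} (f : Finset (Fin n) → ℝ) : Prop :=
  ∀ A B : Finset (Fin n), A ⊆ B → ∀ x, x ∉ B → f (insert x B) - f B ≤ f (insert x A) - f A

/-- `D` is sub-exponential with parameters `(ν, α)`. The condition `|l| ≤ 1 / α` is written
`α * |l| ≤ 1`, so that `α = 0` allows every `l`. -/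
def IsSubexponential (D : Measure ℝ) (ν α : ℝ) : Prop :=
  ∀ l : ℝ, α * |l| ≤ 1 →
    Integrable (fun x => Real.exp (l * (x - ∫ y, y ∂D))) D ∧
      ∫ x, Real.exp (l * (x - ∫ y, y ∂D)) ∂D ≤ Real.exp (ν ^ 2 * l ^ 2 / 2)

/-- Noise multipliers `ξ S`, one for each set `S`: independent, each with the law `D`, which is
supported on the non-negative reals, has mean one, and is `(ν, α)`-sub-exponential. -/
structure IsNoise {n : ℕ} {Ω : Type*} [MeasurableSpace Ω] (P : Measure Ω)
    (ξ : Finset (Fin n) → Ω → ℝ) (D : Measure ℝ) (ν α : ℝ) : Prop where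
  hasLaw : ∀ S, HasLaw (ξ S) D P
  indep : iIndepFun ξ P
  nonneg : ∀ᵐ x ∂D, 0 ≤ x
  mean_one : ∫ x, x ∂D = 1
  subexponential : IsSubexponential D ν α

/-- The noisy value oracle. It is persistent: at a fixed outcome `ω` it is one function of `S`. -/
def noisyOracle {n : ℕ} {Ω : Type*} (ξ : Finset (Fin n) → Ω → ℝ) (f : Finset (Fin n) → ℝ)
    (ω : Ω) (S : Finset (Fin n)) : ℝ :=
  ξ S ω * f S

/-! ### Randomised algorithms with oracles, and their running time

An algorithm on the ground set `Fin n` interacts with the outside world through three operations: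
it may toss a biased coin, query the value oracle at a set, and query the independence oracle of
the matroid at a set. Every other piece of work is charged through `tick`.

The time is that of the unit-cost arithmetic model: an arithmetic operation or a comparison on
numbers costs one step, a coin toss costs one step, handling a set (or a vector indexed by the
ground set) costs `n + 1` steps, and so does an oracle query, which has to write down the queried
set. -/

/-- Randomised oracle algorithms on the ground set `Fin n` with output in `α`. -/
inductive Alg (n : ℕ) (α : Type) : Type
  | done (a : α) : Alg n α
  | tick (k : ℕ) (next : Alg n α) : Alg n α
  | flip (p : ℝ) (next : Bool → Alg n α) : Alg n α
  | value (S : Finset (Fin n)) (next : ℝ → Alg n α) : Alg n α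
  | indep (S : Finset (Fin n)) (next : Bool → Alg n α) : Alg n α

namespace Alg

variable {n : ℕ} {α β σ : Type}

/-- Sequential composition. -/
def bind : Alg n α → (α → Alg n β) → Alg n β
  | done a, F => F a
  | tick k c, F => tick k (bind c F)
  | flip p c, F => flip p fun b => bind (c b) F
  | value S c, F => value S fun v => bind (c v) F
  | indep S c, F => indep S fun b => bind (c b) F

instance : Monad (Alg n) where
  pure := done
  bind := bind

/-- The coin that shows `true` with probability `p`, where `p` is clipped to `[0, 1]`. -/
def coin (p : ℝ) : PMF Bool :=
  PMF.ofFintype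
    (fun b => cond b (ENNReal.ofReal (max 0 (min 1 p))) (ENNReal.ofReal (1 - max 0 (min 1 p))))
    (by
      have h0 : (0 : ℝ) ≤ max 0 (min 1 p) := le_max_left _ _
      have h1 : max 0 (min 1 p) ≤ (1 : ℝ) := max_le zero_le_one (min_le_left _ _)
      rw [Fintype.sum_bool, cond_true, cond_false, ← ENNReal.ofReal_add h0 (by linarith)]
      simp)

open Classical in
/-- The law of the output when the value oracle is `g` and the independence oracle is that of `M`;
the coins are independent of the oracles and of each other. -/
def run (g : Finset (Fin n) → ℝ) (M : Matroid (Fin n)) : Alg n α → PMF α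
  | done a => PMF.pure a
  | tick _ c => run g M c
  | flip p c => (coin p).bind fun b => run g M (c b)
  | value S c => run g M (c (g S))
  | indep S c => run g M (c (decide (M.Indep (S : Set (Fin n)))))

open Classical in
/-- The number of steps, in the worst case over the outcomes of the coins. -/
def time (g : Finset (Fin n) → ℝ) (M : Matroid (Fin n)) : Alg n α → ℕ
  | done _ => 0
  | tick k c => k + time g M c
  | flip _ c => 1 + max (time g M (c true)) (time g M (c false))
  | value S c => (n + 1) + time g M (c (g S))
  | indep S c => (n + 1) + time g M (c (decide (M.Indep (S : Set (Fin n)))))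

/-- Spend `k` steps. -/
def charge (k : ℕ) : Alg n Unit := tick k (done ())

/-- Toss a coin of bias `p`. -/
def toss (p : ℝ) : Alg n Bool := flip p done

/-- Query the value oracle. -/
def queryValue (S : Finset (Fin n)) : Alg n ℝ := value S done

/-- Query the independence oracle. -/
def queryIndep (S : Finset (Fin n)) : Alg n Bool := indep S done

/-- Apply `step` to the state `k` times. -/
def loop (step : σ → Alg n σ) : ℕ → σ → Alg n σ
  | 0, s => pure s
  | k + 1, s => do
    charge 1
    let s' ← step s
    loop step k s'

/-- Run through a list, updating the state at each entry. -/
def forList {ι : Type} (step : σ → ι → Alg n σ) : List ι → σ → Alg n σ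
  | [], s => pure s
  | i :: L, s => do
    charge 1
    let s' ← step s i
    forList step L s'

/-- The first entry of a list that passes a test. -/
def findFirst {ι : Type} (test : ι → Alg n Bool) : List ι → Alg n (Option ι)
  | [] => pure none
  | i :: L => do
    charge 1
    let b ← test i
    if b then pure (some i) else findFirst test L

end Alg

open Alg

variable {n : ℕ}

/-- The elements of a set, in increasing order. -/
def elems (S : Finset (Fin n)) : List (Fin n) := (List.finRange n).filter (· ∈ S)

/-! ### Subroutines -/

/-- The greedy algorithm: go through the list and keep every element that preserves independence. -/
def greedyIndep (indep : Finset (Fin n) → Alg n Bool) (L : List (Fin n)) :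
    Alg n (Finset (Fin n)) :=
  forList (fun I i => do
    charge (n + 1)
    let b ← indep (insert i I)
    if b then pure (insert i I) else pure I) L ∅

/-- A uniformly random subset of size `k` of a list of distinct elements (all of them, if there
are fewer than `k`), by selection sampling. -/
def sampleSubset : List (Fin n) → ℕ → Alg n (Finset (Fin n))
  | [], _ => pure ∅
  | x :: L, k => do
    charge (n + L.length + 2)
    let b ← toss ((k : ℝ) / ((L.length : ℝ) + 1))
    if b then do
      let S ← sampleSubset L (k - 1)
      pure (insert x S)
    else sampleSubset L k

/-- A uniformly random set among the subsets of size `k` of a list of distinct elements that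
differ from all the (distinct) entries of `avoid` on that list. The next element `x` is taken with
probability `a / b`, where `b` counts the admissible sets and `a` those that contain `x`;
the charge pays for two binomial coefficients through Pascal's triangle and one pass
through `avoid`. -/
def sampleAvoiding : List (Fin n) → ℕ → List (Finset (Fin n)) → Alg n (Finset (Fin n))
  | [], _, _ => pure ∅
  | x :: L, k, avoid => do
    charge (2 * (L.length + 2) ^ 2 + (n + 1) * (avoid.length + 1))
    let b ← toss
      ((((L.length + 1).choose k : ℝ) - (L.length.choose k : ℝ)
          - ((avoid.filter (x ∈ ·)).length : ℝ))
        / (((L.length + 1).choose k : ℝ) - (avoid.length : ℝ)))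
    if b then do
      let S ← sampleAvoiding L (k - 1) (avoid.filter (x ∈ ·))
      pure (insert x S)
    else sampleAvoiding L k (avoid.filter (x ∉ ·))

/-- `m` random subsets of size `t` of `H`, sampled without replacement. -/
def sampleDistinct (H : Finset (Fin n)) (t m : ℕ) : Alg n (List (Finset (Fin n))) :=
  loop (fun Hs => do
    charge (n + 1)
    let H' ← sampleAvoiding (elems H) t Hs
    pure (H' :: Hs)) m []

/-- The sample average `(1 / m) ∑ i, f̃ (S ∪ H i)` of the noisy surrogate function, for the list
`Hs = [H 1, …, H m]`. -/
def sampledSurrogate (Hs : List (Finset (Fin n))) (S : Finset (Fin n)) : Alg n ℝ := do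
  let s ← forList (fun (s : ℝ) H' => do
    charge (n + 1)
    let v ← queryValue (S ∪ H')
    pure (s + v)) Hs 0
  charge 1
  pure (s / (Hs.length : ℝ))

/-! ### Measured continuous greedy -/

/-- The random set that contains each entry `i` of `E` independently with probability `x i`. -/
def sampleSet (E : List (Fin n)) (x : Fin n → ℝ) : Alg n (Finset (Fin n)) :=
  forList (fun R i => do
    let b ← toss (x i)
    charge 1
    if b then pure (insert i R) else pure R) E ∅

/-- The average of `K` independent samples of `f̂ (R + i) - f̂ R`, for `R` random with marginals
`x`. -/
def estimateMarginal (E : List (Fin n)) (fhat : Finset (Fin n) → Alg n ℝ) (K : ℕ)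
    (x : Fin n → ℝ) (i : Fin n) : Alg n ℝ := do
  let s ← loop (fun (s : ℝ) => do
    let R ← sampleSet E x
    charge (n + 1)
    let a ← fhat (insert i R)
    let b ← fhat R
    pure (s + (a - b))) K 0
  charge 1
  pure (s / (K : ℝ))

/-- A maximum-weight independent set: the greedy algorithm on the elements of positive weight,
in the order of decreasing weight. -/
def maxWeightIndep (E : List (Fin n)) (indep : Finset (Fin n) → Alg n Bool) (w : Fin n → ℝ) :
    Alg n (Finset (Fin n)) := do
  charge ((E.length + 1) ^ 2)
  greedyIndep indep ((E.filter fun i => 0 < w i).insertionSort fun i j => w j ≤ w i)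

/-- For a list on which `v` decreases, the coefficients and members of the chain of prefixes of the
list whose convex combination is `v`; `u` is the value before the list and `I` the prefix so far. -/
def prefixChain (v : Fin n → ℝ) : List (Fin n) → ℝ → Finset (Fin n) → List (ℝ × Finset (Fin n))
  | [], u, I => [(u, I)]
  | i :: L, u, I => (u - v i, I) :: prefixChain v L (v i) (insert i I)

/-- The state of measured continuous greedy: the fractional point `x`, and a list of pairs
`(c, I)` with `I` independent and `∑ c • 1_I = x`. -/
structure GreedyState (n : ℕ) where
  x : Fin n → ℝ
  parts : List (ℝ × Finset (Fin n))

/-- One step of measured continuous greedy with step size `δ`: estimate the marginals, find a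
maximum-weight independent set `I`, and move `x i` by `δ * (1 - x i)` for `i ∈ I`. The increment is
`δ` times a point below the indicator of `I`, which is recorded as a convex combination of
subsets of `I`. -/
def greedyStep (E : List (Fin n)) (fhat : Finset (Fin n) → Alg n ℝ)
    (indep : Finset (Fin n) → Alg n Bool) (δ : ℝ) (K : ℕ) (s : GreedyState n) :
    Alg n (GreedyState n) := do
  let w ← forList (fun (w : Fin n → ℝ) i => do
    let a ← estimateMarginal E fhat K s.x i
    charge (n + 1)
    pure (Function.update w i a)) E (fun _ => 0)
  let I ← maxWeightIndep E indep w
  charge (3 * (n + 1) ^ 2)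
  let v : Fin n → ℝ := fun i => 1 - s.x i
  let chain := prefixChain v ((elems I).insertionSort fun i j => v j ≤ v i) 1 ∅
  pure
    { x := fun i => if i ∈ I then s.x i + δ * (1 - s.x i) else s.x i
      parts := chain.map (fun q => (δ * q.1, q.2)) ++ s.parts }

/-- One random exchange between independent sets `I` and `J` of weights `a` and `b`. The sets
come closer, and the point `a • 1_I + b • 1_J` moves along a coordinate direction or along a
difference of two coordinate directions and keeps its expectation. -/
def exchangeStep (indep : Finset (Fin n) → Alg n Bool) (a b : ℝ)
    (IJ : Finset (Fin n) × Finset (Fin n)) : Alg n (Finset (Fin n) × Finset (Fin n)) := do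
  let I := IJ.1
  let J := IJ.2
  charge (5 * (n + 1))
  if I.card < J.card then do
    let r ← findFirst (fun e => do charge (n + 1); indep (insert e I)) (elems (J \ I))
    match r with
    | none => pure (I, J)
    | some e => do
      let c ← toss (b / (a + b))
      if c then pure (insert e I, J) else pure (I, J.erase e)
  else if J.card < I.card then do
    let r ← findFirst (fun e => do charge (n + 1); indep (insert e J)) (elems (I \ J))
    match r with
    | none => pure (I, J)
    | some e => do
      let c ← toss (a / (a + b))
      if c then pure (I, insert e J) else pure (I.erase e, J)
  else
    match elems (I \ J) with
    | [] => pure (I, J)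
    | e :: _ => do
      let r ← findFirst (fun e' => do
        charge (4 * (n + 1))
        let p ← indep (insert e' (I.erase e))
        let q ← indep (insert e (J.erase e'))
        pure (p && q)) (elems (J \ I))
      match r with
      | none => pure (I, J)
      | some e' => do
        let c ← toss (a / (a + b))
        if c then pure (I, insert e (J.erase e')) else pure (insert e' (I.erase e), J)

/-- Oblivious randomised rounding of the convex combination `∑ c • 1_I` over the entries `(c, I)`
of the list to one independent set: merge the sets one after the other, by random exchanges. No
access to the value oracle. -/
def roundParts (indep : Finset (Fin n) → Alg n Bool) (parts : List (ℝ × Finset (Fin n))) :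
    Alg n (Finset (Fin n)) := do
  let s ← forList (fun (s : ℝ × Finset (Fin n)) q => do
    let IJ ← loop (exchangeStep indep s.1 q.1) n (s.2, q.2)
    charge (n + 2)
    pure (s.1 + q.1, IJ.1)) parts (0, ∅)
  pure s.2

/-- Measured continuous greedy on the ground set listed in `E`, with a value oracle `fhat` and an
independence oracle `indep`: with `N = |E|`, it makes `N ^ 4` steps of size `δ = N ^ (-4)`, with
`(10 / δ ^ 2) * log (2 * N)` samples for each estimate, and rounds the final point. -/
def measuredContinuousGreedy (E : List (Fin n)) (fhat : Finset (Fin n) → Alg n ℝ)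
    (indep : Finset (Fin n) → Alg n Bool) : Alg n (Finset (Fin n)) := do
  let δ : ℝ := 1 / (E.length : ℝ) ^ 4
  let K : ℕ := ⌈10 / δ ^ 2 * Real.log (2 * (E.length : ℝ))⌉₊
  charge (n + 1)
  let s ← loop (greedyStep E fhat indep δ K) (E.length ^ 4) { x := fun _ => 0, parts := [] }
  roundParts indep s.parts

/-! ### The meta-algorithm -/

/-- The meta-algorithm with parameters `h, t, m`, which turns an algorithm `A` for submodular
maximisation over a matroid into one for a noisy value oracle. The algorithm `A` is run on the
ground set outside `H`, with the contracted matroid `{S | S ∪ H independent}` and with the sampled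
noisy surrogate function as its value oracle. -/
def metaAlgorithm
    (A : List (Fin n) → (Finset (Fin n) → Alg n ℝ) → (Finset (Fin n) → Alg n Bool) →
      Alg n (Finset (Fin n)))
    (h t m : ℕ) : Alg n (Finset (Fin n)) := do
  let B₀ ← greedyIndep queryIndep (List.finRange n)
  charge (2 * (n + 1))
  let H ← sampleSubset (elems B₀) h
  let Hs ← sampleDistinct H t m
  charge (2 * (n + 1))
  let S ← A (elems Hᶜ) (sampledSurrogate Hs) (fun S => do charge (n + 1); queryIndep (S ∪ H))
  let H' ← sampleSubset (elems H) t
  charge (n + 1)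
  pure (S ∪ H')

/-- The number of samples `m = ⌈max {2, 8 ν²} (n⁴ / ε²) (n + log (4 n))⌉`. -/
def sampleCount (n : ℕ) (ε ν : ℝ) : ℕ :=
  ⌈max 2 (8 * ν ^ 2) * ((n : ℝ) ^ 4 / ε ^ 2) * ((n : ℝ) + Real.log (4 * (n : ℝ)))⌉₊

/-- The size `t = ⌈log₂ (4 m)⌉` of the random sets added by the surrogate function. -/
def smoothingSize (n : ℕ) (ε ν : ℝ) : ℕ := Nat.clog 2 (4 * sampleCount n ε ν)

/-- The meta-algorithm with measured continuous greedy and with the parameters `m`, `t` and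
`h = t ^ 2`. -/
def noisyContinuousGreedy (n : ℕ) (ε ν : ℝ) : Alg n (Finset (Fin n)) :=
  metaAlgorithm measuredContinuousGreedy
    (smoothingSize n ε ν ^ 2) (smoothingSize n ε ν) (sampleCount n ε ν)

/-- The expected value `E[f(ALG)]` of the set returned by an algorithm that is given the noisy value
oracle of `f` and the independence oracle of `M`, over the noise and the coins of the algorithm. -/
def expectedValue {Ω : Type*} [MeasurableSpace Ω] (P : Measure Ω) (ξ : Finset (Fin n) → Ω → ℝ)
    (f : Finset (Fin n) → ℝ) (M : Matroid (Fin n)) (c : Alg n (Finset (Fin n))) : ℝ≥0∞ :=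
  ∫⁻ ω, ∑ S, c.run (noisyOracle ξ f ω) M S * ENNReal.ofReal (f S) ∂P

end NoisySubmodular

end

/-! Fix `H` and let F(S) be the average of f(S ∪ H') over the t-subsets H' of `H` (`surrogate`). F
is nonnegative and submodular. If S is the output of the greedy phase, then F(S) is exactly the mean
value of the returned set, because the final H' is a fresh uniform t-subset. The task is therefore
to maximise F over the contraction by `H`, and the proof bounds the separate losses.

Contraction. Let opt(H) be the best set that is independent in the contraction by H ⊆ B. The
elements b of B \ H are matched to distinct elements that they may replace
(`exists_exchange_matching`). By submodularity all these removals together cost at most f(opt(H)),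
so moving one random b into H costs on average a fraction 1/(|B| - |H|). The losses telescope to 1 -
h/r (`exists_contracted_optimum`). The same telescoping gives F ≥ (1 - t/h) f, which is (1 - 1/t) f
for h = t² (`le_surrogate`).

Estimation. For fixed S disjoint from `H` the queried sets S ∪ H_i are distinct, so their noise
multipliers are independent and exponential moments multiply. Drawing without replacement costs only
a factor e in exponential moments, because `H` has more than m² + m subsets of size t. The surrogate
is controlled simultaneously for all sets S of elements that individually extend `H`; hence neither
the adaptivity of the greedy phase nor the persistence of the noise matters. On these sets f is at
most n f(O), the scale of all deviations. Failure is measured by a sum of exponential potentials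
instead of an event: one minus this sum is an integrable minorant of the indicator of success
(`le_ev_bind_afterSampling`, `exists_expected_success`).

Greedy. A measured step replaces R(x) by its union with an independent δ-random subset of I. It
gains about δ (F(x ∨ O) - F(x)), and F(x ∨ O) ≥ (1 - δ)^k F(O) after k steps, so 1/δ steps reach
nearly F(O)/e (`le_ev_measuredContinuousGreedy`). Rounding loses nothing in expectation, because the
multilinear extension is affine in each coordinate and convex along differences of two coordinates
(`le_ev_roundParts`).

Assembly. With t ≥ log(n/ε) and t² ≤ ε r the losses add up to 1/t + 13ε
(`le_expectedValue_of_parameters`). For ε > 1/64 the constant 64 makes the claimed bound trivial. -/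

noncomputable section

namespace NoisySubmodular

/-! ### Expectation, reachable outputs, running time and output law of oracle algorithms -/

section

namespace Alg

variable {n : ℕ} {α β σ ι : Type} {g : Finset (Fin n) → ℝ} {M : Matroid (Fin n)}

/-- The truncation of a real number to the unit interval. -/
def clip (p : ℝ) : ℝ := max 0 (min 1 p)

lemma clip_nonneg (p : ℝ) : 0 ≤ clip p := le_max_left _ _

lemma clip_le_one (p : ℝ) : clip p ≤ 1 := max_le zero_le_one (min_le_left _ _)

lemma clip_of_mem {p : ℝ} (h0 : 0 ≤ p) (h1 : p ≤ 1) : clip p = p := by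
  rw [clip, min_eq_right h1, max_eq_right h0]

open Classical in
/-- The expectation of `φ` at the output, as a real number. -/
def ev (g : Finset (Fin n) → ℝ) (M : Matroid (Fin n)) (φ : α → ℝ) : Alg n α → ℝ
  | done a => φ a
  | tick _ c => ev g M φ c
  | flip p c => clip p * ev g M φ (c true) + (1 - clip p) * ev g M φ (c false)
  | value S c => ev g M φ (c (g S))
  | indep S c => ev g M φ (c (decide (M.Indep (S : Set (Fin n)))))

open Classical in
/-- Every output that is reachable, for whatever outcomes of the coins, has the property `Q`. -/
def Sat (g : Finset (Fin n) → ℝ) (M : Matroid (Fin n)) (Q : α → Prop) : Alg n α → Prop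
  | done a => Q a
  | tick _ c => Sat g M Q c
  | flip _ c => Sat g M Q (c true) ∧ Sat g M Q (c false)
  | value S c => Sat g M Q (c (g S))
  | indep S c => Sat g M Q (c (decide (M.Indep (S : Set (Fin n)))))

/-! #### Expectations -/

@[simp] lemma ev_pure (φ : α → ℝ) (a : α) : ev g M φ (pure a : Alg n α) = φ a := rfl

@[simp] lemma ev_bind (φ : β → ℝ) (c : Alg n α) (F : α → Alg n β) :
    ev g M φ (c >>= F) = ev g M (fun a => ev g M φ (F a)) c := by
  change ev g M φ (Alg.bind c F) = _
  induction c with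
  | done a => rfl
  | tick k c ih => exact ih
  | flip p c ih => simp only [Alg.bind, ev, ih]
  | value S c ih => exact ih _
  | indep S c ih => exact ih _

@[simp] lemma ev_charge (φ : Unit → ℝ) (k : ℕ) : ev g M φ (charge k : Alg n Unit) = φ () := rfl

@[simp] lemma ev_toss (φ : Bool → ℝ) (p : ℝ) :
    ev g M φ (toss p : Alg n Bool) = clip p * φ true + (1 - clip p) * φ false := rfl

@[simp] lemma ev_queryValue (φ : ℝ → ℝ) (S : Finset (Fin n)) :
    ev g M φ (queryValue S) = φ (g S) := rfl

open Classical in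
@[simp] lemma ev_queryIndep (φ : Bool → ℝ) (S : Finset (Fin n)) :
    ev g M φ (queryIndep S) = φ (decide (M.Indep (S : Set (Fin n)))) := rfl

lemma ev_loop_zero (φ : σ → ℝ) (step : σ → Alg n σ) (s : σ) :
    ev g M φ (loop step 0 s) = φ s := rfl

lemma ev_loop_succ (φ : σ → ℝ) (step : σ → Alg n σ) (k : ℕ) (s : σ) :
    ev g M φ (loop step (k + 1) s) = ev g M (fun s' => ev g M φ (loop step k s')) (step s) := by
  simp [loop]

lemma ev_forList_nil (φ : σ → ℝ) (step : σ → ι → Alg n σ) (s : σ) :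
    ev g M φ (forList step [] s) = φ s := rfl

lemma ev_forList_cons (φ : σ → ℝ) (step : σ → ι → Alg n σ) (i : ι) (L : List ι) (s : σ) :
    ev g M φ (forList step (i :: L) s)
      = ev g M (fun s' => ev g M φ (forList step L s')) (step s i) := by
  simp [forList]

lemma ev_add (φ ψ : α → ℝ) (c : Alg n α) :
    ev g M (fun a => φ a + ψ a) c = ev g M φ c + ev g M ψ c := by
  induction c with
  | done a => rfl
  | tick k c ih => exact ih
  | flip p c ih => simp only [ev, ih]; ring
  | value S c ih => exact ih _
  | indep S c ih => exact ih _

lemma ev_const_mul (r : ℝ) (φ : α → ℝ) (c : Alg n α) :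
    ev g M (fun a => r * φ a) c = r * ev g M φ c := by
  induction c with
  | done a => rfl
  | tick k c ih => exact ih
  | flip p c ih => simp only [ev, ih]; ring
  | value S c ih => exact ih _
  | indep S c ih => exact ih _

@[simp] lemma ev_const (r : ℝ) (c : Alg n α) : ev g M (fun _ => r) c = r := by
  induction c with
  | done a => rfl
  | tick k c ih => exact ih
  | flip p c ih => simp only [ev, ih]; ring
  | value S c ih => exact ih _
  | indep S c ih => exact ih _

lemma ev_sub (φ ψ : α → ℝ) (c : Alg n α) :
    ev g M (fun a => φ a - ψ a) c = ev g M φ c - ev g M ψ c := by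
  have h := ev_add (g := g) (M := M) (fun a => φ a - ψ a) ψ c
  simp only [sub_add_cancel] at h
  linarith

lemma ev_sum {κ : Type*} (s : Finset κ) (φ : κ → α → ℝ) (c : Alg n α) :
    ev g M (fun a => ∑ k ∈ s, φ k a) c = ∑ k ∈ s, ev g M (φ k) c := by
  classical
  induction s using Finset.induction_on with
  | empty => simp
  | insert k s hk ih => simp only [Finset.sum_insert hk, ev_add, ih]

lemma ev_le_ev {φ ψ : α → ℝ} {c : Alg n α} (h : Sat g M (fun a => φ a ≤ ψ a) c) :
    ev g M φ c ≤ ev g M ψ c := by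
  induction c with
  | done a => exact h
  | tick k c ih => exact ih h
  | flip p c ih =>
    simp only [ev]
    exact add_le_add (mul_le_mul_of_nonneg_left (ih true h.1) (clip_nonneg p))
      (mul_le_mul_of_nonneg_left (ih false h.2) (sub_nonneg.2 (clip_le_one p)))
  | value S c ih => exact ih _ h
  | indep S c ih => exact ih _ h

/-! #### Reachable outputs -/

@[simp] lemma sat_pure {Q : α → Prop} {a : α} : Sat g M Q (pure a : Alg n α) ↔ Q a := Iff.rfl

@[simp] lemma sat_bind {Q : β → Prop} {c : Alg n α} {F : α → Alg n β} :
    Sat g M Q (c >>= F) ↔ Sat g M (fun a => Sat g M Q (F a)) c := by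
  change Sat g M Q (Alg.bind c F) ↔ _
  induction c with
  | done a => rfl
  | tick k c ih => exact ih
  | flip p c ih => simp only [Alg.bind, Sat, ih]
  | value S c ih => exact ih _
  | indep S c ih => exact ih _

@[simp] lemma sat_charge {Q : Unit → Prop} {k : ℕ} :
    Sat g M Q (charge k : Alg n Unit) ↔ Q () := Iff.rfl

@[simp] lemma sat_toss {Q : Bool → Prop} {p : ℝ} :
    Sat g M Q (toss p : Alg n Bool) ↔ Q true ∧ Q false := Iff.rfl

open Classical in
@[simp] lemma sat_queryIndep {Q : Bool → Prop} {S : Finset (Fin n)} :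
    Sat g M Q (queryIndep S) ↔ Q (decide (M.Indep (S : Set (Fin n)))) := Iff.rfl

lemma Sat.mono {Q R : α → Prop} (hQR : ∀ a, Q a → R a) {c : Alg n α} (h : Sat g M Q c) :
    Sat g M R c := by
  induction c with
  | done a => exact hQR a h
  | tick k c ih => exact ih h
  | flip p c ih => exact ⟨ih true h.1, ih false h.2⟩
  | value S c ih => exact ih _ h
  | indep S c ih => exact ih _ h

lemma sat_of_forall {Q : α → Prop} (h : ∀ a, Q a) (c : Alg n α) : Sat g M Q c := by
  induction c with
  | done a => exact h a
  | tick k c ih => exact ih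
  | flip p c ih => exact ⟨ih true, ih false⟩
  | value S c ih => exact ih _
  | indep S c ih => exact ih _

lemma ev_mono {φ ψ : α → ℝ} (h : ∀ a, φ a ≤ ψ a) (c : Alg n α) :
    ev g M φ c ≤ ev g M ψ c := ev_le_ev (sat_of_forall h c)

lemma ev_congr {φ ψ : α → ℝ} {c : Alg n α} (h : Sat g M (fun a => φ a = ψ a) c) :
    ev g M φ c = ev g M ψ c :=
  le_antisymm (ev_le_ev (h.mono fun _ e => e.le)) (ev_le_ev (h.mono fun _ e => e.ge))

lemma ev_nonneg {φ : α → ℝ} (h : ∀ a, 0 ≤ φ a) (c : Alg n α) : 0 ≤ ev g M φ c := by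
  simpa using ev_mono (g := g) (M := M) h c

/-- If the output is almost surely `a`, then `a` is reachable. -/
lemma Sat.of_ev_eq {Q : α → Prop} {c : Alg n α} {a : α} (h : Sat g M Q c)
    (ha : ∀ φ, ev g M φ c = φ a) : Q a := by
  classical
  by_contra hQ
  have h1 : ev g M (fun b => if Q b then (1 : ℝ) else 0) c = ev g M (fun _ => (1 : ℝ)) c :=
    ev_congr (h.mono fun b hb => if_pos hb)
  rw [ha, ev_const, if_neg hQ] at h1
  exact zero_ne_one h1

/-- A loop preserves an invariant that is indexed by the number of rounds. -/
lemma sat_loop {step : σ → Alg n σ} (Inv : ℕ → σ → Prop)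
    (h : ∀ k s, Inv k s → Sat g M (Inv (k + 1)) (step s)) (j k : ℕ) (s : σ) (hs : Inv k s) :
    Sat g M (Inv (k + j)) (loop step j s) := by
  induction j generalizing k s with
  | zero => exact hs
  | succ j ih =>
    simp only [loop, sat_bind, sat_charge]
    refine (h k s hs).mono fun s' hs' => ?_
    have := ih (k + 1) s' hs'
    rwa [add_right_comm, add_assoc] at this

/-- A pass through a list preserves an invariant that is indexed by the rest of the list. -/
lemma sat_forList {step : σ → ι → Alg n σ} (Inv : List ι → σ → Prop)
    (h : ∀ i L s, Inv (i :: L) s → Sat g M (Inv L) (step s i)) (L : List ι) (s : σ)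
    (hs : Inv L s) : Sat g M (Inv []) (forList step L s) := by
  induction L generalizing s with
  | nil => exact hs
  | cons i L ih =>
    simp only [forList, sat_bind, sat_charge]
    exact (h i L s hs).mono fun s' hs' => ih s' hs'

/-- If the test computes the predicate `p`, then `findFirst` returns an entry satisfying `p`
whenever there is one. -/
lemma sat_findFirst {test : ι → Alg n Bool} (p : ι → Prop) (L : List ι)
    (h : ∀ i ∈ L, Sat g M (fun b => b = true ↔ p i) (test i)) :
    Sat g M (fun r => (∀ i, r = some i → i ∈ L ∧ p i) ∧ (r = none → ∀ i ∈ L, ¬ p i))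
      (findFirst test L) := by
  induction L with
  | nil => simp [findFirst]
  | cons i L ih =>
    simp only [findFirst, sat_bind, sat_charge]
    refine (h i (by simp)).mono fun b hb => ?_
    cases b with
    | true => simpa using hb
    | false =>
      have hp : ¬ p i := by simpa using hb
      refine Sat.mono ?_ (ih fun j hj => h j (by simp [hj]))
      rintro r ⟨h1, h2⟩
      exact ⟨fun j hj => ⟨List.mem_cons_of_mem _ (h1 j hj).1, (h1 j hj).2⟩,
        fun hr j hj => by
          rcases List.mem_cons.1 hj with rfl | hj
          · exact hp
          · exact h2 hr j hj⟩

/-! #### Running time -/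

@[simp] lemma time_pure (a : α) : time g M (pure a : Alg n α) = 0 := rfl

@[simp] lemma time_charge (k : ℕ) : time g M (charge k : Alg n Unit) = k := rfl

@[simp] lemma time_toss (p : ℝ) : time g M (toss p : Alg n Bool) = 1 := rfl

@[simp] lemma time_queryValue (S : Finset (Fin n)) : time g M (queryValue S) = n + 1 := rfl

@[simp] lemma time_queryIndep (S : Finset (Fin n)) : time g M (queryIndep S) = n + 1 := rfl

/-- The continuation is bounded only at reachable outputs, so invariants proved with `Sat` (lengths
of lists, for instance) can enter running time bounds. -/
lemma time_bind_le {c : Alg n α} {F : α → Alg n β} {T₁ T₂ : ℕ} (h₁ : time g M c ≤ T₁)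
    (h₂ : Sat g M (fun a => time g M (F a) ≤ T₂) c) : time g M (c >>= F) ≤ T₁ + T₂ := by
  change time g M (Alg.bind c F) ≤ _
  induction c generalizing T₁ with
  | done a => exact le_trans h₂ (Nat.le_add_left _ _)
  | tick k c ih =>
    simp only [time] at h₁
    have := ih (T₁ := T₁ - k) (by omega) h₂
    simp only [Alg.bind, time]
    omega
  | flip p c ih =>
    simp only [time] at h₁
    have h3 := ih true (T₁ := T₁ - 1) (by omega) h₂.1
    have h4 := ih false (T₁ := T₁ - 1) (by omega) h₂.2
    simp only [Alg.bind, time]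
    omega
  | value S c ih =>
    simp only [time] at h₁
    have := ih (g S) (T₁ := T₁ - (n + 1)) (by omega) h₂
    simp only [Alg.bind, time]
    omega
  | indep S c ih =>
    simp only [time] at h₁
    have := ih _ (T₁ := T₁ - (n + 1)) (by omega) h₂
    simp only [Alg.bind, time]
    omega

lemma time_bind_le_of_forall {c : Alg n α} {F : α → Alg n β} {T₁ T₂ : ℕ}
    (h₁ : time g M c ≤ T₁) (h₂ : ∀ a, time g M (F a) ≤ T₂) :
    time g M (c >>= F) ≤ T₁ + T₂ := time_bind_le h₁ (sat_of_forall h₂ c)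

@[simp] lemma time_charge_bind (k : ℕ) (F : Unit → Alg n β) :
    time g M (charge k >>= F) = k + time g M (F ()) := rfl

/-- The step bound `T` is needed only in rounds before `k₀`: when distinct subsets are sampled, the
list to be avoided grows with the round. -/
lemma time_loop_le {step : σ → Alg n σ} {T : ℕ} (Inv : ℕ → σ → Prop) (k₀ : ℕ)
    (h : ∀ k s, Inv k s → Sat g M (Inv (k + 1)) (step s))
    (hT : ∀ k s, k < k₀ → Inv k s → time g M (step s) ≤ T) (j k : ℕ) (s : σ) (hs : Inv k s)
    (hk : k + j ≤ k₀) :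
    time g M (loop step j s) ≤ j * (T + 1) := by
  induction j generalizing k s with
  | zero => simp [loop]
  | succ j ih =>
    simp only [loop, time_charge_bind]
    have := time_bind_le (hT k s (by omega) hs) (T₂ := j * (T + 1))
      (F := fun s' => loop step j s')
      ((h k s hs).mono fun s' hs' => ih (k + 1) s' hs' (by omega))
    rw [add_mul]
    omega

lemma time_loop_le_of_forall {step : σ → Alg n σ} {T : ℕ} (hT : ∀ s, time g M (step s) ≤ T)
    (j : ℕ) (s : σ) : time g M (loop step j s) ≤ j * (T + 1) :=
  time_loop_le (fun _ _ => True) j (fun _ _ _ => sat_of_forall (fun _ => trivial) _)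
    (fun _ s _ _ => hT s) j 0 s trivial (by omega)

lemma time_forList_le {step : σ → ι → Alg n σ} {T : ℕ} (L : List ι)
    (hT : ∀ s, ∀ i ∈ L, time g M (step s i) ≤ T) (s : σ) :
    time g M (forList step L s) ≤ L.length * (T + 1) := by
  induction L generalizing s with
  | nil => simp [forList]
  | cons i L ih =>
    simp only [forList, time_charge_bind, List.length_cons]
    have := time_bind_le_of_forall (hT s i (by simp)) (T₂ := L.length * (T + 1))
      (F := fun s' => forList step L s')
      fun s' => ih (fun s j hj => hT s j (List.mem_cons_of_mem _ hj)) s'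
    rw [add_mul]
    omega

lemma time_findFirst_le {test : ι → Alg n Bool} {T : ℕ} (L : List ι)
    (hT : ∀ i, time g M (test i) ≤ T) :
    time g M (findFirst test L) ≤ L.length * (T + 1) := by
  induction L with
  | nil => simp [findFirst]
  | cons i L ih =>
    simp only [findFirst, time_charge_bind, List.length_cons]
    have := time_bind_le_of_forall (hT i) (T₂ := L.length * (T + 1))
      (F := fun b => if b = true then (pure (some i) : Alg n (Option ι)) else findFirst test L)
      (fun b => by cases b <;> simp [ih])
    rw [add_mul]
    omega

/-! #### The law of the output -/

lemma toReal_coin (p : ℝ) (b : Bool) :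
    Alg.coin p b = ENNReal.ofReal (if b then clip p else 1 - clip p) := by
  cases b <;> simp [Alg.coin, clip]

lemma sat_of_mem_support {Q : α → Prop} {c : Alg n α} (h : Sat g M Q c) {a : α}
    (ha : a ∈ (c.run g M).support) : Q a := by
  induction c with
  | done b =>
    simp only [run, PMF.support_pure, Set.mem_singleton_iff] at ha
    exact ha ▸ h
  | tick k c ih => exact ih h ha
  | flip p c ih =>
    simp only [run, PMF.mem_support_bind_iff] at ha
    obtain ⟨b, -, hb⟩ := ha
    cases b
    · exact ih _ h.2 hb
    · exact ih _ h.1 hb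
  | value S c ih => exact ih _ h ha
  | indep S c ih => exact ih _ h ha

/-- The bridge from the `PMF` semantics to `ev`. Beyond it the analysis uses real expectations,
where subtraction is available. -/
lemma sum_run_mul_ofReal [Fintype α] {φ : α → ℝ} (hφ : ∀ a, 0 ≤ φ a) (c : Alg n α) :
    ∑ a, c.run g M a * ENNReal.ofReal (φ a) = ENNReal.ofReal (ev g M φ c) := by
  classical
  induction c with
  | done a => simp [run, ev, PMF.pure_apply]
  | tick k c ih => exact ih
  | flip p c ih =>
    simp only [run, ev, PMF.bind_apply, tsum_bool, toReal_coin, add_mul, Finset.sum_add_distrib,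
      mul_assoc, ← Finset.mul_sum, ih]
    rw [ENNReal.ofReal_add (mul_nonneg (clip_nonneg p) (ev_nonneg hφ _))
      (mul_nonneg (sub_nonneg.2 (clip_le_one p)) (ev_nonneg hφ _)),
      ENNReal.ofReal_mul (clip_nonneg p), ENNReal.ofReal_mul (sub_nonneg.2 (clip_le_one p)),
      add_comm]
    simp
  | value S c ih => exact ih _
  | indep S c ih => exact ih _

/-! #### Algorithms that do not use the value oracle -/

/-- The law of the output does not depend on the value oracle. -/
def Oblivious (M : Matroid (Fin n)) (c : Alg n α) : Prop :=
  ∀ g g' : Finset (Fin n) → ℝ, ∀ φ : α → ℝ, ev g M φ c = ev g' M φ c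

lemma oblivious_bind {c : Alg n α} {F : α → Alg n β} (hc : Oblivious M c)
    (hF : ∀ a, Oblivious M (F a)) : Oblivious M (c >>= F) := by
  intro g g' φ
  rw [ev_bind, ev_bind, hc g g']
  congr 1
  funext a
  exact hF a g g' φ

lemma oblivious_pure (a : α) : Oblivious M (pure a : Alg n α) := fun _ _ _ => rfl

lemma oblivious_charge (k : ℕ) : Oblivious M (charge k : Alg n Unit) := fun _ _ _ => rfl

lemma oblivious_toss (p : ℝ) : Oblivious M (toss p : Alg n Bool) := fun _ _ _ => rfl

lemma oblivious_loop {step : σ → Alg n σ} (h : ∀ s, Oblivious M (step s)) (k : ℕ) (s : σ) :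
    Oblivious M (loop step k s) := by
  induction k generalizing s with
  | zero => exact oblivious_pure s
  | succ k ih => exact oblivious_bind (oblivious_charge 1) fun _ => oblivious_bind (h s) ih

/-- Integration over a parameter commutes with the expectation over the coins. -/
lemma integral_ev {Ω : Type*} [MeasurableSpace Ω] {P : Measure Ω} {φ : Ω → α → ℝ}
    (hφ : ∀ a, Integrable (fun ω => φ ω a) P) (c : Alg n α) :
    Integrable (fun ω => ev g M (φ ω) c) P ∧
      ∫ ω, ev g M (φ ω) c ∂P = ev g M (fun a => ∫ ω, φ ω a ∂P) c := by
  induction c with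
  | done a => exact ⟨hφ a, rfl⟩
  | tick k c ih => exact ih
  | flip p c ih =>
    simp only [ev]
    refine ⟨((ih true).1.const_mul _).add ((ih false).1.const_mul _), ?_⟩
    rw [integral_add ((ih true).1.const_mul _) ((ih false).1.const_mul _), integral_const_mul,
      integral_const_mul, (ih true).2, (ih false).2]
  | value S c ih => exact ih _
  | indep S c ih => exact ih _

end Alg

end

/-! ### Matroid exchange properties and the greedy algorithm -/

section

open Alg

variable {n : ℕ}

/-! ### Matroid exchange -/

section Exchange

variable {α : Type*} [DecidableEq α] {N : Matroid α}

/-- Symmetric exchange between independent sets of the same size. -/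
lemma exists_symmetric_exchange {I J : Finset α} (hI : N.Indep (I : Set α))
    (hJ : N.Indep (J : Set α)) (hcard : I.card = J.card) {e : α} (heI : e ∈ I) (heJ : e ∉ J) :
    ∃ e' ∈ J \ I, N.Indep ((insert e' (I.erase e) : Finset α) : Set α) ∧
      N.Indep ((insert e (J.erase e') : Finset α) : Set α) := by
  have hIe : N.Indep ((I.erase e : Finset α) : Set α) :=
    hI.subset (by exact_mod_cast Finset.erase_subset e I)
  have heE : e ∈ N.E := hI.subset_ground (by simpa using heI)
  -- If J + e is independent, any e' that augments I - e from J works, since J + e - e' lies inside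
  -- J + e. Otherwise e' is taken from the fundamental circuit of e in J.
  by_cases hJe : N.Indep (insert e (J : Set α))
  · obtain ⟨e', he'J, he'I, hind⟩ := hIe.augment_finset hJ (by
      rw [← hcard]; exact Finset.card_erase_lt_of_mem heI)
    have hne : e' ≠ e := fun h => heJ (h ▸ he'J)
    refine ⟨e', ?_, by simpa using hind, hJe.subset ?_⟩
    · simp only [Finset.mem_sdiff]
      exact ⟨he'J, fun h => he'I (Finset.mem_erase.2 ⟨hne, h⟩)⟩
    · simp only [Finset.coe_insert, Finset.coe_erase]
      exact Set.insert_subset_insert Set.sdiff_subset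
  · have hecl : e ∈ N.closure (J : Set α) := by
      rw [hJ.mem_closure_iff_of_notMem (by simpa using heJ), Matroid.dep_iff]
      exact ⟨hJe, Set.insert_subset heE hJ.subset_ground⟩
    have hC := hJ.fundCircuit_isCircuit hecl (by simpa using heJ)
    -- If the circuit without e lay in the closure of I - e, then so would e, contradicting the
    -- independence of I. An element e' of the circuit outside this closure serves both exchanges.
    have hnot : ¬ (N.fundCircuit e (J : Set α) \ {e} ⊆ N.closure ((I.erase e : Finset α) : Set α)) := by
      intro hsub
      have h1 := hC.mem_closure_sdiff_singleton_of_mem (N.mem_fundCircuit e _)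
      have h2 : e ∈ N.closure ((I.erase e : Finset α) : Set α) :=
        (N.closure_subset_closure_of_subset_closure hsub) h1
      rw [hIe.mem_closure_iff_of_notMem (by simp), Matroid.dep_iff] at h2
      apply h2.1
      rw [← Finset.coe_insert, Finset.insert_erase heI]
      exact hI
    obtain ⟨e', he'C, he'⟩ := Set.not_subset.1 hnot
    have hne : e' ≠ e := he'C.2
    have he'J : e' ∈ J := by
      have := N.fundCircuit_subset_insert e (J : Set α) he'C.1
      simpa [hne] using this
    have he'E : e' ∈ N.E := hJ.subset_ground (by simpa using he'J)
    have he'I : e' ∉ I.erase e := fun h =>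
      he' (N.subset_closure _ hIe.subset_ground (by exact_mod_cast h))
    refine ⟨e', ?_, ?_, ?_⟩
    · simp only [Finset.mem_sdiff]
      exact ⟨he'J, fun h => he'I (Finset.mem_erase.2 ⟨hne, h⟩)⟩
    · rw [Finset.coe_insert, hIe.insert_indep_iff]
      exact Or.inl ⟨he'E, he'⟩
    · refine ((hJ.mem_fundCircuit_iff hecl (by simpa using heJ)).1 he'C.1).subset ?_
      intro a ha
      simp only [Finset.coe_insert, Finset.coe_erase, Set.mem_insert_iff, Set.mem_sdiff,
        Finset.mem_coe, Set.mem_singleton_iff] at ha ⊢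
      rcases ha with rfl | ha
      · exact ⟨Or.inl rfl, hne.symm⟩
      · exact ⟨Or.inr ha.1, ha.2⟩

/-- If `B` and `T ∪ H` are bases with `H ⊆ B`, then the elements of `B \ H` can be
matched to elements of `T` that they may replace. -/
lemma exists_exchange_matching (hE : N.E = Set.univ) {B T H : Finset α}
    (hB : N.Indep (B : Set α)) (hHB : H ⊆ B)
    (hTH : N.IsBase ((T ∪ H : Finset α) : Set α)) (hdisj : Disjoint T H) :
    ∃ φ : α → α, Set.InjOn φ (B \ H : Finset α) ∧ ∀ b ∈ B \ H, φ b ∈ T ∧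
      N.Indep ((T.erase (φ b) ∪ insert b H : Finset α) : Set α) ∧
      Disjoint (T.erase (φ b)) (insert b H) := by
  classical
  let good : α → Finset α := fun b => T.filter fun o =>
    N.Indep ((T.erase o ∪ insert b H : Finset α) : Set α) ∧ Disjoint (T.erase o) (insert b H)
  -- Hall's condition. With U the set of all good partners of elements of A, the closure of U ∪ H
  -- contains A; comparing the independent sets A ∪ H and U ∪ H gives |A| ≤ |U|.
  have hall : ∀ A : Finset {b // b ∈ B \ H}, A.card ≤ (A.biUnion fun b => good b.1).card := by
    intro A
    set A' : Finset α := A.map (Function.Embedding.subtype _) with hA'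
    have hA'B : A' ⊆ B \ H := by
      intro a ha
      simp only [hA', Finset.mem_map, Function.Embedding.subtype_apply] at ha
      obtain ⟨a, -, rfl⟩ := ha
      exact a.2
    set U : Finset α := A.biUnion fun b => good b.1 with hU
    have hUT : U ⊆ T := Finset.biUnion_subset.2 fun _ _ => Finset.filter_subset _ _
    have hUH : N.Indep ((U ∪ H : Finset α) : Set α) :=
      hTH.indep.subset (by exact_mod_cast Finset.union_subset_union_left hUT)
    have hAH : N.Indep ((A' ∪ H : Finset α) : Set α) := hB.subset (by
      exact_mod_cast Finset.union_subset (hA'B.trans Finset.sdiff_subset) hHB)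
    -- An element b of T is its own good partner. For b outside T, the fundamental circuit of b in T
    -- ∪ H consists of b, of good partners of b, and of elements of H.
    have hcl : ∀ b ∈ A', b ∈ N.closure ((U ∪ H : Finset α) : Set α) := by
      intro b hb
      have hbB := Finset.mem_sdiff.1 (hA'B hb)
      have hgood : good b ⊆ U := by
        simp only [hA', Finset.mem_map, Function.Embedding.subtype_apply] at hb
        obtain ⟨a, ha, rfl⟩ := hb
        exact Finset.subset_biUnion_of_mem (fun b : {b // b ∈ B \ H} => good b.1) ha
      by_cases hbT : b ∈ T
      · apply N.subset_closure _ hUH.subset_ground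
        have : b ∈ good b := by
          simp only [good, Finset.mem_filter]
          refine ⟨hbT, ?_, ?_⟩
          · have : T.erase b ∪ insert b H = T ∪ H := by
              rw [Finset.union_insert, ← Finset.insert_union, Finset.insert_erase hbT]
            rw [this]; exact hTH.indep
          · rw [Finset.disjoint_insert_right]
            exact ⟨Finset.notMem_erase b T, hdisj.mono_left (Finset.erase_subset _ _)⟩
        exact_mod_cast Finset.mem_union_left H (hgood this)
      · have hbTH : b ∉ ((T ∪ H : Finset α) : Set α) := by
          simp [hbT, hbB.2]
        have hbcl : b ∈ N.closure ((T ∪ H : Finset α) : Set α) := by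
          rw [hTH.closure_eq, hE]; trivial
        have hC := hTH.indep.fundCircuit_isCircuit hbcl hbTH
        refine N.closure_subset_closure ?_
          (hC.mem_closure_sdiff_singleton_of_mem (N.mem_fundCircuit b _))
        rintro o ⟨hoC, hob⟩
        have hob : o ≠ b := hob
        have hoTH := N.fundCircuit_subset_insert b _ hoC
        simp only [Finset.coe_union, Set.mem_insert_iff, hob, Set.mem_union, Finset.mem_coe,
          false_or] at hoTH
        simp only [Finset.coe_union, Set.mem_union, Finset.mem_coe]
        rcases hoTH with hoT | hoH
        · left
          apply hgood
          simp only [good, Finset.mem_filter]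
          refine ⟨hoT, ?_, ?_⟩
          · rw [hTH.indep.mem_fundCircuit_iff hbcl hbTH] at hoC
            refine hoC.subset ?_
            intro a ha
            simp only [Finset.coe_union, Finset.coe_erase, Finset.coe_insert, Set.mem_union,
              Set.mem_sdiff, Finset.mem_coe, Set.mem_singleton_iff, Set.mem_insert_iff] at ha ⊢
            rcases ha with ha | rfl | ha
            · exact ⟨Or.inr (Or.inl ha.1), ha.2⟩
            · exact ⟨Or.inl rfl, hob.symm⟩
            · exact ⟨Or.inr (Or.inr ha), fun h => Finset.disjoint_left.1 hdisj hoT (h ▸ ha)⟩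
          · rw [Finset.disjoint_insert_right]
            exact ⟨fun h => hbT (Finset.mem_of_mem_erase h),
              hdisj.mono_left (Finset.erase_subset _ _)⟩
        · exact Or.inr hoH
    -- Otherwise U ∪ H could be augmented by an element of A, although A lies in its closure.
    have hle : (A' ∪ H).card ≤ (U ∪ H).card := by
      by_contra hlt
      obtain ⟨e, heA, heU, hind⟩ := hUH.augment_finset hAH (not_le.1 hlt)
      have heA' : e ∈ A' := by
        rcases Finset.mem_union.1 heA with h | h
        · exact h
        · exact absurd (Finset.mem_union_right _ h) heU
      have := hcl e heA'
      rw [hUH.mem_closure_iff_of_notMem (by exact_mod_cast heU)] at this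
      exact this.not_indep hind
    rw [Finset.card_union_of_disjoint (hdisj.mono_left hUT),
      Finset.card_union_of_disjoint (Finset.disjoint_of_subset_left hA'B
        Finset.sdiff_disjoint)] at hle
    have hc : A'.card = A.card := Finset.card_map _
    omega
  obtain ⟨ψ, hinj, hψ⟩ := (Finset.all_card_le_biUnion_card_iff_exists_injective
    (fun b : {b // b ∈ B \ H} => good b.1)).1 hall
  refine ⟨fun b => if h : b ∈ B \ H then ψ ⟨b, h⟩ else b, ?_, ?_⟩
  · intro a ha b hb hab
    have ha : a ∈ B \ H := ha
    have hb : b ∈ B \ H := hb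
    simp only [ha, hb, dif_pos] at hab
    exact congrArg Subtype.val (hinj hab)
  · intro b hb
    simp only [hb, dif_pos]
    exact Finset.mem_filter.1 (hψ ⟨b, hb⟩)

end Exchange

/-! ### The greedy algorithm -/

/-- On subsets of `E`, the subroutine `indep` decides independence in `N`. -/
def IsOracle (g : Finset (Fin n) → ℝ) (M : Matroid (Fin n))
    (indep : Finset (Fin n) → Alg n Bool) (N : Matroid (Fin n)) (E : Finset (Fin n)) : Prop :=
  ∀ S ⊆ E, Sat g M (fun b => b = true ↔ N.Indep (S : Set (Fin n))) (indep S)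

variable {g : Finset (Fin n) → ℝ} {M N : Matroid (Fin n)} {E : Finset (Fin n)}
  {ind : Finset (Fin n) → Alg n Bool}

lemma mem_elems {S : Finset (Fin n)} {i : Fin n} : i ∈ elems S ↔ i ∈ S := by
  simp [elems]

lemma nodup_elems (S : Finset (Fin n)) : (elems S).Nodup := (List.nodup_finRange n).filter _

lemma toFinset_elems (S : Finset (Fin n)) : (elems S).toFinset = S := by
  ext i; simp [mem_elems]

lemma length_elems (S : Finset (Fin n)) : (elems S).length = S.card := by
  rw [← List.toFinset_card_of_nodup (nodup_elems S), toFinset_elems]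

/-- Greedy solutions have, within every prefix of the list, the largest possible size. -/
lemma sat_greedyIndep (hind : IsOracle g M ind N E) (L : List (Fin n)) (hL : L.toFinset ⊆ E) :
    Sat g M (fun I => I ⊆ L.toFinset ∧ N.Indep (I : Set (Fin n)) ∧
      ∀ Q, Q <+: L → ∀ J ⊆ Q.toFinset, N.Indep (J : Set (Fin n)) →
        J.card ≤ (I ∩ Q.toFinset).card) (greedyIndep ind L) := by
  unfold greedyIndep
  let Inv : List (Fin n) → Finset (Fin n) → Prop := fun rest I => ∃ P, P ++ rest = L ∧
    I ⊆ P.toFinset ∧ N.Indep (I : Set (Fin n)) ∧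
      ∀ Q, Q <+: P → ∀ J ⊆ Q.toFinset, N.Indep (J : Set (Fin n)) →
        J.card ≤ (I ∩ Q.toFinset).card
  refine Sat.mono ?_ (sat_forList Inv ?_ L ∅ ⟨[], rfl, by simp, by simp, ?_⟩)
  · rintro I ⟨P, hP, h⟩
    rw [List.append_nil] at hP
    subst hP
    exact h
  · rintro i rest I ⟨P, hP, hIP, hI, hmax⟩
    have hiE : insert i I ⊆ E := by
      refine Finset.Subset.trans ?_ hL
      rw [← hP]
      intro a ha
      simp only [Finset.mem_insert] at ha
      simp only [List.mem_toFinset, List.mem_append, List.mem_cons]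
      rcases ha with rfl | ha
      · simp
      · exact Or.inl (List.mem_toFinset.1 (hIP ha))
    -- Accepting and rejecting i are treated together: I' is I or I + i, and contains i whenever I +
    -- i is independent.
    have key : ∀ I' : Finset (Fin n), I ⊆ I' → I' ⊆ insert i I → N.Indep (I' : Set (Fin n)) →
        (N.Indep ((insert i I : Finset (Fin n)) : Set (Fin n)) → i ∈ I') → Inv rest I' := by
      intro I' hII' hI'i hI' hi
      refine ⟨P ++ [i], by simp [hP], ?_, hI', ?_⟩
      · intro a ha
        rcases Finset.mem_insert.1 (hI'i ha) with rfl | ha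
        · simp
        · simp only [List.toFinset_append, Finset.mem_union]
          exact Or.inl (hIP ha)
      · intro Q hQ J hJQ hJ
        rw [List.prefix_concat_iff] at hQ
        rcases hQ with rfl | hQ
        · have hI'Q : I' ∩ (P ++ [i]).toFinset = I' := by
            refine Finset.inter_eq_left.2 (hI'i.trans ?_)
            intro a ha
            rcases Finset.mem_insert.1 ha with rfl | ha
            · simp
            · simp only [List.toFinset_append, Finset.mem_union]
              exact Or.inl (hIP ha)
          rw [hI'Q]
          -- An augmenting element from P would contradict maximality on the prefix P; if it is i
          -- itself, greedy has already taken it.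
          by_contra hlt
          obtain ⟨e, heJ, heI', hins⟩ := hI'.augment_finset hJ (not_le.1 hlt)
          have heQ := hJQ heJ
          simp only [List.toFinset_append, Finset.mem_union, List.mem_toFinset,
            List.mem_singleton] at heQ
          have hinsI : N.Indep ((insert e I : Finset (Fin n)) : Set (Fin n)) := by
            refine hins.subset ?_
            rw [Finset.coe_insert]
            exact Set.insert_subset_insert (by exact_mod_cast hII')
          rcases heQ with heP | heP
          · have hc := hmax P List.prefix_rfl (insert e I)
              (Finset.insert_subset (List.mem_toFinset.2 heP) hIP) hinsI
            rw [Finset.inter_eq_left.2 hIP, Finset.card_insert_of_notMem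
              (fun h => heI' (hII' h))] at hc
            omega
          · subst heP
            exact heI' (hi hinsI)
        · exact (hmax Q hQ J hJQ hJ).trans
            (Finset.card_le_card (Finset.inter_subset_inter_right hII'))
    simp only [sat_bind, sat_charge]
    refine (hind _ hiE).mono fun b hb => ?_
    cases b with
    | true =>
      simp only [if_true, sat_pure]
      exact key _ (Finset.subset_insert _ _) Finset.Subset.rfl (hb.1 rfl)
        fun _ => Finset.mem_insert_self _ _
    | false =>
      simp only [Bool.false_eq_true, if_false, sat_pure]
      exact key _ Finset.Subset.rfl (Finset.subset_insert _ _) hI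
        fun h => absurd (hb.2 h) (by simp)
  · intro Q hQ J hJ _
    rw [List.prefix_nil.1 hQ] at hJ
    simp only [List.toFinset_nil, Finset.subset_empty] at hJ
    simp [hJ]

/-- Summation by parts: if the partial sums of `d` are nonnegative along a list on which `w`
is nonnegative and decreasing, then so is the sum of `d * w`. -/
lemma sum_mul_nonneg_of_prefix {ι : Type*} (w d : ι → ℝ) (L : List ι)
    (hsort : L.Pairwise fun i j => w j ≤ w i) (hw : ∀ i ∈ L, 0 ≤ w i) (c W : ℝ) (hc : 0 ≤ c)
    (hW0 : 0 ≤ W) (hW : ∀ i ∈ L, w i ≤ W) (hpre : ∀ Q, Q <+: L → 0 ≤ c + (Q.map d).sum) :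
    0 ≤ c * W + (L.map fun i => d i * w i).sum := by
  induction L generalizing c W with
  | nil => simpa using mul_nonneg hc hW0
  | cons i L ih =>
    rw [List.pairwise_cons] at hsort
    have h1 : 0 ≤ c + d i := by
      simpa using hpre [i] (by simp)
    -- Abel summation: c is the partial sum of `d` so far and W the preceding weight. Lowering W to
    -- `w i` costs a nonnegative amount, and c + `d i` is carried on.
    have := ih hsort.2 (fun j hj => hw j (List.mem_cons_of_mem _ hj)) (c + d i) (w i) h1
      (hw i (by simp)) hsort.1 (fun Q hQ => by
        have := hpre (i :: Q) (by simpa using hQ)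
        simpa [add_assoc] using this)
    have h2 := mul_le_mul_of_nonneg_left (hW i (by simp)) hc
    simp only [List.map_cons, List.sum_cons]
    nlinarith

lemma sum_map_indicator_eq_card (I : Finset (Fin n)) (Q : List (Fin n)) (hQ : Q.Nodup) :
    (Q.map fun i => if i ∈ I then (1 : ℝ) else 0).sum = ((I ∩ Q.toFinset).card : ℝ) := by
  rw [← List.sum_toFinset _ hQ, Finset.sum_ite_mem, Finset.inter_comm]
  simp

/-- The greedy algorithm finds an independent set of maximum weight. -/
lemma sat_maxWeightIndep (hind : IsOracle g M ind N E) (w : Fin n → ℝ) :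
    Sat g M (fun I => I ⊆ E ∧ N.Indep (I : Set (Fin n)) ∧
      ∀ J ⊆ E, N.Indep (J : Set (Fin n)) → ∑ i ∈ J, w i ≤ ∑ i ∈ I, w i)
      (maxWeightIndep (elems E) ind w) := by
  unfold maxWeightIndep
  simp only [sat_bind, sat_charge]
  set L := ((elems E).filter fun i => 0 < w i).insertionSort fun i j => w j ≤ w i with hLdef
  have hperm : L.Perm ((elems E).filter fun i => 0 < w i) := List.perm_insertionSort _ _
  have hmem : ∀ i, i ∈ L ↔ i ∈ E ∧ 0 < w i := fun i => by
    rw [hperm.mem_iff]; simp [mem_elems]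
  have hnd : L.Nodup := hperm.nodup_iff.2 ((nodup_elems E).filter _)
  have hsort : L.Pairwise fun i j => w j ≤ w i := by
    have : IsTrans (Fin n) fun i j => w j ≤ w i := ⟨fun a b c h h' => le_trans h' h⟩
    have : Std.Total fun i j : Fin n => w j ≤ w i := ⟨fun a b => le_total _ _⟩
    exact List.pairwise_insertionSort _ _
  have hLE : L.toFinset ⊆ E := fun i hi => ((hmem i).1 (List.mem_toFinset.1 hi)).1
  refine (sat_greedyIndep hind L hLE).mono ?_
  rintro I ⟨hIL, hI, hmax⟩
  refine ⟨hIL.trans hLE, hI, fun J hJE hJ => ?_⟩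
  set J' := J.filter fun i => 0 < w i with hJ'
  have hJ'L : J' ⊆ L.toFinset := fun i hi => by
    rw [List.mem_toFinset, hmem]
    exact ⟨hJE (Finset.mem_filter.1 hi).1, (Finset.mem_filter.1 hi).2⟩
  have hJJ' : ∑ i ∈ J, w i ≤ ∑ i ∈ J', w i := by
    rw [← Finset.sum_filter_add_sum_filter_not J fun i => 0 < w i]
    have : ∑ i ∈ J.filter (fun i => ¬ 0 < w i), w i ≤ 0 :=
      Finset.sum_nonpos fun i hi => not_lt.1 (Finset.mem_filter.1 hi).2
    linarith
  refine hJJ'.trans ?_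
  have hsumL : ∀ A ⊆ L.toFinset,
      (L.map fun i => (if i ∈ A then (1 : ℝ) else 0) * w i).sum = ∑ i ∈ A, w i := by
    intro A hA
    rw [← List.sum_toFinset _ hnd]
    simp only [ite_mul, one_mul, zero_mul]
    rw [Finset.sum_ite_mem, Finset.inter_eq_right.2 hA]
  obtain ⟨W, hW⟩ : ∃ W : ℝ, ∀ i ∈ L, w i ≤ W :=
    ⟨∑ i, |w i|, fun i _ => (le_abs_self _).trans
      (Finset.single_le_sum (f := fun i => |w i|) (fun _ _ => abs_nonneg _) (Finset.mem_univ i))⟩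
  -- For the difference of the two indicators, the partial sum over a prefix Q is |I ∩ Q| - |J' ∩
  -- Q|, which is nonnegative by the prefixwise maximality of greedy. The start value 0 makes the
  -- bound W on the weights immaterial.
  have := sum_mul_nonneg_of_prefix w
    (fun i => (if i ∈ I then (1 : ℝ) else 0) - if i ∈ J' then (1 : ℝ) else 0) L hsort
    (fun i hi => ((hmem i).1 hi).2.le) 0 (max W 0) le_rfl (le_max_right _ _)
    (fun i hi => (hW i hi).trans (le_max_left _ _)) (fun Q hQ => by
      have hQn : Q.Nodup := hnd.sublist hQ.sublist
      have hsub : (Q.map fun i => (if i ∈ I then (1 : ℝ) else 0)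
          - if i ∈ J' then (1 : ℝ) else 0).sum
          = ((I ∩ Q.toFinset).card : ℝ) - ((J' ∩ Q.toFinset).card : ℝ) := by
        rw [← sum_map_indicator_eq_card I Q hQn, ← sum_map_indicator_eq_card J' Q hQn,
          ← List.sum_toFinset _ hQn, ← List.sum_toFinset _ hQn, ← List.sum_toFinset _ hQn,
          Finset.sum_sub_distrib]
      rw [hsub]
      have h1 := hmax Q hQ (J' ∩ Q.toFinset) Finset.inter_subset_right
        (hJ.subset (by
          exact_mod_cast Finset.inter_subset_left.trans (Finset.filter_subset _ _)))
      have h2 : ((J' ∩ Q.toFinset).card : ℝ) ≤ ((I ∩ Q.toFinset).card : ℝ) := by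
        exact_mod_cast h1
      linarith)
  simp only [sub_mul] at this
  have hsplit : (L.map fun i => (if i ∈ I then (1 : ℝ) else 0) * w i
      - (if i ∈ J' then (1 : ℝ) else 0) * w i).sum
      = ∑ i ∈ I, w i - ∑ i ∈ J', w i := by
    rw [← hsumL I hIL, ← hsumL J' hJ'L, ← List.sum_toFinset _ hnd, ← List.sum_toFinset _ hnd,
      ← List.sum_toFinset _ hnd, Finset.sum_sub_distrib]
  rw [hsplit] at this
  linarith

lemma isOracle_queryIndep : IsOracle g M queryIndep M E := by
  classical
  intro S _
  simp

/-- The greedy algorithm on the whole ground set computes a base, which does not depend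
on the value oracle. -/
lemma exists_base_greedyIndep :
    ∃ B : Finset (Fin n), M.IsBase (B : Set (Fin n)) ∧ ∀ (g : Finset (Fin n) → ℝ)
      (φ : Finset (Fin n) → ℝ),
      ev g M φ (greedyIndep queryIndep (List.finRange n)) = φ B := by
  classical
  -- The run tosses no coin and never consults the value oracle, so one set B is the output for
  -- every `g`, in particular for every outcome of the noise.
  have hdet : ∀ (L : List (Fin n)) (I : Finset (Fin n)), ∃ B : Finset (Fin n),
      ∀ (g : Finset (Fin n) → ℝ) (φ : Finset (Fin n) → ℝ),
      ev g M φ (forList (fun I i => do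
        charge (n + 1)
        let b ← queryIndep (insert i I)
        if b then pure (insert i I) else pure I) L I) = φ B := by
    intro L
    induction L with
    | nil => exact fun I => ⟨I, fun _ _ => rfl⟩
    | cons i L ih =>
      intro I
      by_cases h : M.Indep ((insert i I : Finset (Fin n)) : Set (Fin n))
      · obtain ⟨B, hB⟩ := ih (insert i I)
        refine ⟨B, fun g φ => ?_⟩
        rw [ev_forList_cons, ← hB g φ]
        simp [-Finset.coe_insert, h]
      · obtain ⟨B, hB⟩ := ih I
        refine ⟨B, fun g φ => ?_⟩
        rw [ev_forList_cons, ← hB g φ]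
        simp [-Finset.coe_insert, h]
  obtain ⟨B, hB⟩ := hdet (List.finRange n) ∅
  refine ⟨B, ?_, hB⟩
  have hsat := sat_greedyIndep (g := fun _ => 0) (isOracle_queryIndep (M := M)
    (E := Finset.univ)) (List.finRange n) (Finset.subset_univ _)
  obtain ⟨-, hBI, hmax⟩ := hsat.of_ev_eq (hB _)
  refine hBI.isBase_of_forall_insert fun e he hins => ?_
  have he' : e ∉ B := by simpa using he.2
  have := hmax _ List.prefix_rfl (insert e B) (fun i _ => by simp) (by simpa using hins)
  rw [Finset.card_insert_of_notMem he', Finset.inter_eq_left.2 (fun i _ => by simp)] at this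
  omega

end

/-! ### Submodular functions and their multilinear extension -/

section

open Alg

variable {n : ℕ}

/-! ### Submodular functions -/

lemma IsSubmodular.pair {f : Finset (Fin n) → ℝ} (hf : IsSubmodular f) (A : Finset (Fin n))
    {e e' : Fin n} (hne : e ≠ e') :
    f A + f (insert e (insert e' A)) ≤ f (insert e A) + f (insert e' A) := by
  by_cases he : e ∈ A
  · rw [Finset.insert_eq_of_mem (Finset.mem_insert_of_mem he), Finset.insert_eq_of_mem he]
  · have := hf A (insert e' A) (Finset.subset_insert _ _) e (by simp [hne, he])
    linarith

lemma IsSubmodular.insert_le {f : Finset (Fin n) → ℝ} (hf : IsSubmodular f)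
    {A B : Finset (Fin n)} (hAB : A ⊆ B) {e : Fin n} (he : e ∈ B → e ∈ A) :
    f (insert e B) - f B ≤ f (insert e A) - f A := by
  by_cases heB : e ∈ B
  · rw [Finset.insert_eq_of_mem heB, Finset.insert_eq_of_mem (he heB)]; simp
  · exact hf A B hAB e heB

lemma IsSubmodular.union_right {f : Finset (Fin n) → ℝ} (hf : IsSubmodular f)
    (C : Finset (Fin n)) : IsSubmodular fun S => f (S ∪ C) := by
  intro A B hAB e he
  simp only [Finset.insert_union]
  refine hf.insert_le (Finset.union_subset_union_left hAB) fun h => ?_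
  rcases Finset.mem_union.1 h with h | h
  · exact absurd h he
  · exact Finset.mem_union_right _ h

lemma IsSubmodular.sum {κ : Type*} {s : Finset κ} {f : κ → Finset (Fin n) → ℝ}
    (hf : ∀ k ∈ s, IsSubmodular (f k)) : IsSubmodular fun S => ∑ k ∈ s, f k S := by
  intro A B hAB e he
  simp only [← Finset.sum_sub_distrib]
  exact Finset.sum_le_sum fun k hk => hf k hk A B hAB e he

lemma IsSubmodular.const_mul {f : Finset (Fin n) → ℝ} (hf : IsSubmodular f) {r : ℝ}
    (hr : 0 ≤ r) : IsSubmodular fun S => r * f S := by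
  intro A B hAB e he
  simp only [← mul_sub]
  exact mul_le_mul_of_nonneg_left (hf A B hAB e he) hr

lemma IsSubmodular.union_sub_le_sum {f : Finset (Fin n) → ℝ} (hf : IsSubmodular f)
    (A O : Finset (Fin n)) : f (A ∪ O) - f A ≤ ∑ i ∈ O, (f (insert i A) - f A) := by
  induction O using Finset.induction_on with
  | empty => simp
  | insert i O hi ih =>
    rw [Finset.sum_insert hi, Finset.union_insert]
    have := hf.insert_le (A := A) (B := A ∪ O) Finset.subset_union_left (e := i) (fun h => by
      rcases Finset.mem_union.1 h with h | h
      · exact h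
      · exact absurd h hi)
    linarith

/-- A nonnegative submodular function is subadditive over singletons. -/
lemma IsSubmodular.le_card_mul {f : Finset (Fin n) → ℝ} (hf : IsSubmodular f)
    (h0 : ∀ S, 0 ≤ f S) {b : ℝ} (hb : f ∅ ≤ b) (S : Finset (Fin n)) (hS : ∀ i ∈ S, f {i} ≤ b)
    (hn : 1 ≤ n) : f S ≤ n * b := by
  have hb0 : 0 ≤ b := (h0 ∅).trans hb
  rcases S.eq_empty_or_nonempty with rfl | hne
  · have : (1 : ℝ) ≤ n := by exact_mod_cast hn
    nlinarith
  · have h1 := hf.union_sub_le_sum ∅ S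
    simp only [Finset.empty_union, insert_empty_eq, Finset.sum_sub_distrib, Finset.sum_const,
      nsmul_eq_mul] at h1
    have h2 : ∑ i ∈ S, f {i} ≤ S.card * b := by
      simpa using Finset.sum_le_card_nsmul S (fun i => f {i}) b hS
    have h3 : (1 : ℝ) ≤ S.card := by exact_mod_cast hne.card_pos
    have h4 : (S.card : ℝ) ≤ n := by
      have := Finset.card_le_univ S
      rw [Fintype.card_fin] at this
      exact_mod_cast this
    nlinarith [h0 ∅]

/-! ### The multilinear extension -/

/-- Add `i` to the argument with probability `p`. -/
def mix (p : ℝ) (i : Fin n) (ψ : Finset (Fin n) → ℝ) (A : Finset (Fin n)) : ℝ :=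
  (1 - p) * ψ A + p * ψ (insert i A)

/-- The expectation of `ψ (A ∪ R)`, where `R` contains each entry `i` of the list independently
with probability `x i`. -/
def ml (x : Fin n → ℝ) : List (Fin n) → (Finset (Fin n) → ℝ) → Finset (Fin n) → ℝ
  | [], ψ => ψ
  | i :: L, ψ => mix (x i) i (ml x L ψ)

variable {x y : Fin n → ℝ} {L : List (Fin n)} {ψ χ : Finset (Fin n) → ℝ}

lemma mix_comm (p q : ℝ) (i j : Fin n) (ψ : Finset (Fin n) → ℝ) :
    mix p i (mix q j ψ) = mix q j (mix p i ψ) := by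
  funext A
  simp only [mix, Finset.insert_comm i j]
  ring

/-- The element is missing afterwards only if both independent trials leave it out. -/
lemma mix_mix {p q r : ℝ} (h : 1 - r = (1 - p) * (1 - q)) (i : Fin n)
    (ψ : Finset (Fin n) → ℝ) : mix p i (mix q i ψ) = mix r i ψ := by
  obtain rfl : r = 1 - (1 - p) * (1 - q) := by linarith
  funext A
  simp only [mix, Finset.insert_idem]
  ring

lemma mix_zero (i : Fin n) (ψ : Finset (Fin n) → ℝ) : mix 0 i ψ = ψ := by
  funext A; simp [mix]

lemma ml_mix (x : Fin n → ℝ) (L : List (Fin n)) (p : ℝ) (i : Fin n) (ψ : Finset (Fin n) → ℝ) :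
    ml x L (mix p i ψ) = mix p i (ml x L ψ) := by
  induction L with
  | nil => rfl
  | cons j L ih => simp only [ml, ih, mix_comm]

/-- With d equal to δ on I and 0 elsewhere, this identifies the measured step x + δ(1 - x) with the
union of R(x) and an independent δ-random subset of I. The analysis of a step thus reduces to a
random subset with constant marginals. -/
lemma ml_ml {d : Fin n → ℝ} (h : ∀ i ∈ L, 1 - y i = (1 - x i) * (1 - d i)) :
    ml x L (ml d L ψ) = ml y L ψ := by
  induction L with
  | nil => rfl
  | cons j L ih =>
    simp only [ml, ml_mix]
    rw [ih fun i hi => h i (List.mem_cons_of_mem _ hi), mix_mix (h j (by simp))]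

lemma ml_congr (h : ∀ i ∈ L, x i = y i) : ml x L ψ = ml y L ψ := by
  induction L with
  | nil => rfl
  | cons j L ih =>
    simp only [ml]
    rw [ih fun i hi => h i (List.mem_cons_of_mem _ hi), h j (by simp)]

/-- Any coordinate can be moved to the front, because the trials for different elements commute.
This exhibits the extension as affine in that coordinate. -/
lemma ml_eq_mix_erase {e : Fin n} (he : e ∈ L) :
    ml x L ψ = mix (x e) e (ml x (L.erase e) ψ) := by
  induction L with
  | nil => simp at he
  | cons j L ih =>
    by_cases hj : j = e
    · subst hj; simp [ml]
    · have heL : e ∈ L := by simpa [Ne.symm hj] using he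
      rw [List.erase_cons_tail (by simpa using hj)]
      simp only [ml]
      rw [ih heL, mix_comm]

lemma ml_update {e : Fin n} (hL : L.Nodup) (he : e ∈ L) (u : ℝ) :
    ml (Function.update x e u) L ψ = mix u e (ml x (L.erase e) ψ) := by
  rw [ml_eq_mix_erase he, Function.update_self]
  congr 1
  refine ml_congr fun i hi => Function.update_of_ne ?_ _ _
  rintro rfl
  exact (List.Nodup.mem_erase_iff hL).1 hi |>.1 rfl

lemma ml_add (A : Finset (Fin n)) :
    ml x L (fun B => ψ B + χ B) A = ml x L ψ A + ml x L χ A := by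
  induction L generalizing A with
  | nil => rfl
  | cons j L ih => simp only [ml, mix, ih]; ring

lemma ml_const_mul (r : ℝ) (A : Finset (Fin n)) :
    ml x L (fun B => r * ψ B) A = r * ml x L ψ A := by
  induction L generalizing A with
  | nil => rfl
  | cons j L ih => simp only [ml, mix, ih]; ring

@[simp] lemma ml_const (r : ℝ) (A : Finset (Fin n)) : ml x L (fun _ => r) A = r := by
  induction L generalizing A with
  | nil => rfl
  | cons j L ih => simp only [ml, mix, ih]; ring

lemma ml_sub (A : Finset (Fin n)) :
    ml x L (fun B => ψ B - χ B) A = ml x L ψ A - ml x L χ A := by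
  have h := ml_add (x := x) (L := L) (ψ := fun B => ψ B - χ B) (χ := χ) A
  simp only [sub_add_cancel] at h
  linarith

lemma ml_sum {κ : Type*} (s : Finset κ) (ψ : κ → Finset (Fin n) → ℝ) (A : Finset (Fin n)) :
    ml x L (fun B => ∑ k ∈ s, ψ k B) A = ∑ k ∈ s, ml x L (ψ k) A := by
  classical
  induction s using Finset.induction_on with
  | empty => simp
  | insert k s hk ih => simp only [Finset.sum_insert hk, ml_add, ih]

/-- Monotonicity of the multilinear extension; only subsets of the support of `x` matter. -/
lemma ml_le_ml (hx0 : ∀ i ∈ L, 0 ≤ x i) (hx1 : ∀ i ∈ L, x i ≤ 1) {Z A : Finset (Fin n)}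
    (hZ : ∀ i ∈ L, x i ≠ 0 → i ∈ Z) (hA : A ⊆ Z) (h : ∀ B ⊆ Z, ψ B ≤ χ B) :
    ml x L ψ A ≤ ml x L χ A := by
  induction L generalizing A with
  | nil => exact h A hA
  | cons j L ih =>
    have ih' := fun A hA => ih (fun i hi => hx0 i (List.mem_cons_of_mem _ hi))
      (fun i hi => hx1 i (List.mem_cons_of_mem _ hi))
      (fun i hi => hZ i (List.mem_cons_of_mem _ hi)) (A := A) hA
    simp only [ml, mix]
    refine add_le_add (mul_le_mul_of_nonneg_left (ih' A hA)
      (sub_nonneg.2 (hx1 j (by simp)))) ?_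
    by_cases hj : x j = 0
    · simp [hj]
    · exact mul_le_mul_of_nonneg_left (ih' _ (Finset.insert_subset (hZ j (by simp) hj) hA))
        (hx0 j (by simp))

lemma ml_mono (hx0 : ∀ i ∈ L, 0 ≤ x i) (hx1 : ∀ i ∈ L, x i ≤ 1) (h : ∀ B, ψ B ≤ χ B)
    (A : Finset (Fin n)) : ml x L ψ A ≤ ml x L χ A :=
  ml_le_ml hx0 hx1 (Z := Finset.univ) (fun _ _ _ => Finset.mem_univ _) (Finset.subset_univ _)
    fun B _ => h B

lemma ml_pair (hx0 : ∀ i ∈ L, 0 ≤ x i) (hx1 : ∀ i ∈ L, x i ≤ 1) {e e' : Fin n}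
    (h : ∀ A, ψ A + ψ (insert e (insert e' A)) ≤ ψ (insert e A) + ψ (insert e' A))
    (A : Finset (Fin n)) : ml x L ψ A + ml x L ψ (insert e (insert e' A))
      ≤ ml x L ψ (insert e A) + ml x L ψ (insert e' A) := by
  induction L generalizing A with
  | nil => exact h A
  | cons j L ih =>
    have ih' := ih (fun i hi => hx0 i (List.mem_cons_of_mem _ hi))
      (fun i hi => hx1 i (List.mem_cons_of_mem _ hi))
    have h1 := mul_le_mul_of_nonneg_left (ih' A) (sub_nonneg.2 (hx1 j (by simp)))
    have h2 := mul_le_mul_of_nonneg_left (ih' (insert j A)) (hx0 j (by simp))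
    simp only [ml, mix]
    rw [Finset.insert_comm j e, Finset.insert_comm j e', Finset.insert_comm j e]
    linarith

/-- The multilinear extension at the indicator of a set. -/
lemma ml_indicator (I : Finset (Fin n)) (A : Finset (Fin n)) :
    ml (fun i => if i ∈ I then 1 else 0) L ψ A = ψ (A ∪ (I ∩ L.toFinset)) := by
  induction L generalizing A with
  | nil => simp [ml]
  | cons j L ih =>
    simp only [ml, mix, ih, List.toFinset_cons]
    by_cases hj : j ∈ I
    · simp [hj, Finset.inter_insert_of_mem hj]
    · simp [hj, Finset.inter_insert_of_notMem hj]

/-- Adding each element of `I` independently with probability `δ` to the argument of a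
submodular function: the multilinear extension is at least the Lovász extension. -/
lemma lovasz_le_ml {f : Finset (Fin n) → ℝ} (hf : IsSubmodular f) {δ : ℝ} (h0 : 0 ≤ δ)
    (h1 : δ ≤ 1) (I : Finset (Fin n)) (hL : L.Nodup) (A : Finset (Fin n)) :
    (1 - δ) * f A + δ * f (A ∪ (I ∩ L.toFinset))
      ≤ ml (fun i => if i ∈ I then δ else 0) L f A := by
  induction L generalizing A with
  | nil => simp only [ml, List.toFinset_nil, Finset.inter_empty, Finset.union_empty]; linarith
  | cons j L ih =>
    rw [List.nodup_cons] at hL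
    simp only [ml, List.toFinset_cons]
    by_cases hj : j ∈ I
    · have e1 := ih hL.2 A
      have e2 := ih hL.2 (insert j A)
      -- After the two induction hypotheses, the surplus over the claim is δ(1 - δ) times this
      -- submodularity gap.
      have e3 := hf.insert_le (A := A) (B := A ∪ (I ∩ L.toFinset)) Finset.subset_union_left
        (e := j) (fun h => by
          rcases Finset.mem_union.1 h with h | h
          · exact h
          · exact absurd (List.mem_toFinset.1 (Finset.mem_inter.1 h).2) hL.1)
      simp only [hj, if_true, mix, Finset.inter_insert_of_mem hj, Finset.union_insert]
      rw [Finset.insert_union] at e2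
      have e4 := mul_le_mul_of_nonneg_left e1 (sub_nonneg.2 h1)
      have e5 := mul_le_mul_of_nonneg_left e2 h0
      have e6 := mul_le_mul_of_nonneg_left e3 (mul_nonneg h0 (sub_nonneg.2 h1))
      linarith
    · simp only [hj, if_false, mix_zero, Finset.inter_insert_of_notMem hj]
      exact ih hL.2 A

/-- Adding each element of `I` independently with probability `δ` to the argument of a
nonnegative function: the contribution of at most one new element. -/
lemma first_order_le_ml {f : Finset (Fin n) → ℝ} (hf : ∀ S, 0 ≤ f S) {δ : ℝ} (h0 : 0 ≤ δ)
    (h1 : δ ≤ 1) (I : Finset (Fin n)) (hL : L.Nodup) (A : Finset (Fin n)) :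
    (1 - δ) ^ (I ∩ L.toFinset).card * (f A + δ * ∑ i ∈ I ∩ L.toFinset, f (insert i A))
      ≤ ml (fun i => if i ∈ I then δ else 0) L f A := by
  induction L generalizing A with
  | nil => simp [ml]
  | cons j L ih =>
    rw [List.nodup_cons] at hL
    simp only [ml, List.toFinset_cons]
    by_cases hj : j ∈ I
    · have hjL : j ∉ I ∩ L.toFinset := fun h => hL.1 (List.mem_toFinset.1 (Finset.mem_inter.1 h).2)
      simp only [hj, if_true, mix, Finset.inter_insert_of_mem hj]
      rw [Finset.card_insert_of_notMem hjL, Finset.sum_insert hjL]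
      have hq : 0 ≤ (1 - δ) ^ (I ∩ L.toFinset).card := pow_nonneg (sub_nonneg.2 h1) _
      have e1 := mul_le_mul_of_nonneg_left (ih hL.2 A) (sub_nonneg.2 h1)
      -- In the branch where j is added, only the outcome without any further element is kept; the
      -- rest is nonnegative.
      have e2 : (1 - δ) ^ (I ∩ L.toFinset).card * f (insert j A)
          ≤ ml (fun i => if i ∈ I then δ else 0) L f (insert j A) := by
        refine le_trans (mul_le_mul_of_nonneg_left ?_ hq) (ih hL.2 (insert j A))
        have := mul_nonneg h0 (Finset.sum_nonneg fun i (_ : i ∈ I ∩ L.toFinset) =>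
          hf (insert i (insert j A)))
        linarith
      have e3 := mul_le_mul_of_nonneg_left e2 h0
      have e4 : 0 ≤ δ * δ * ((1 - δ) ^ (I ∩ L.toFinset).card * f (insert j A)) :=
        mul_nonneg (mul_nonneg h0 h0) (mul_nonneg hq (hf _))
      rw [pow_succ]
      nlinarith
    · simp only [hj, if_false, mix_zero, Finset.inter_insert_of_notMem hj]
      exact ih hL.2 A

/-- The random set drawn by `sampleSet`. -/
lemma ev_sampleSet {g : Finset (Fin n) → ℝ} {M : Matroid (Fin n)} (hx0 : ∀ i ∈ L, 0 ≤ x i)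
    (hx1 : ∀ i ∈ L, x i ≤ 1) : ev g M ψ (sampleSet L x) = ml x L ψ ∅ := by
  have key : ∀ A, ev g M ψ (forList (fun R i => do
      let b ← toss (x i)
      charge 1
      if b then pure (insert i R) else pure R) L A) = ml x L ψ A := by
    induction L with
    | nil => exact fun A => rfl
    | cons j L ih =>
      intro A
      have ih' := ih (fun i hi => hx0 i (List.mem_cons_of_mem _ hi))
        (fun i hi => hx1 i (List.mem_cons_of_mem _ hi))
      rw [ev_forList_cons]
      simp only [ev_bind, ev_toss, ev_charge, if_true, Bool.false_eq_true, if_false, ev_pure, ih',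
        ml, mix, clip_of_mem (hx0 j (by simp)) (hx1 j (by simp))]
      ring
  exact key ∅

end

section

open Alg

variable {n : ℕ}

/-! ### Randomised exchange rounding -/

variable {g : Finset (Fin n) → ℝ} {M N : Matroid (Fin n)} {E : Finset (Fin n)}
  {ind : Finset (Fin n) → Alg n Bool} {x : Fin n → ℝ} {L : List (Fin n)}
  {ψ : Finset (Fin n) → ℝ}

/-- The multilinear extension is affine in each coordinate. -/
lemma ml_coordinate_move (hL : L.Nodup) {e : Fin n} (he : e ∈ L) {p a b : ℝ}
    (hp : p * a = (1 - p) * b) (A : Finset (Fin n)) :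
    p * ml (Function.update x e (x e + a)) L ψ A
      + (1 - p) * ml (Function.update x e (x e - b)) L ψ A = ml x L ψ A := by
  rw [ml_update hL he, ml_update hL he, ml_eq_mix_erase (x := x) he]
  simp only [mix]
  linear_combination (ml x (L.erase e) ψ (insert e A) - ml x (L.erase e) ψ A) * hp

/-- The multilinear extension of a submodular function is convex along the difference of two
coordinate directions. -/
lemma ml_exchange_move (hL : L.Nodup) (hx0 : ∀ i ∈ L, 0 ≤ x i) (hx1 : ∀ i ∈ L, x i ≤ 1)
    {e e' : Fin n} (he : e ∈ L) (he' : e' ∈ L) (hne : e ≠ e')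
    (hψ : ∀ A, ψ A + ψ (insert e (insert e' A)) ≤ ψ (insert e A) + ψ (insert e' A))
    {p a b : ℝ} (hp0 : 0 ≤ p) (hp1 : p ≤ 1) (hp : p * b = (1 - p) * a) (A : Finset (Fin n)) :
    ml x L ψ A ≤
      p * ml (Function.update (Function.update x e (x e + b)) e' (x e' - b)) L ψ A
      + (1 - p) * ml (Function.update (Function.update x e (x e - a)) e' (x e' + a)) L ψ A := by
  have heL : e ∈ L.erase e' := (List.Nodup.mem_erase_iff hL).2 ⟨hne, he⟩
  have hL' : (L.erase e').Nodup := hL.erase e'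
  have hmem : ∀ i ∈ (L.erase e').erase e, i ∈ L := fun i hi =>
    List.mem_of_mem_erase (List.mem_of_mem_erase hi)
  rw [ml_update hL he', ml_update hL he', ml_update hL' heL, ml_update hL' heL,
    ml_eq_mix_erase (x := x) he', ml_eq_mix_erase (x := x) heL]
  have hsub := ml_pair (x := x) (L := (L.erase e').erase e) (fun i hi => hx0 i (hmem i hi))
    (fun i hi => hx1 i (hmem i hi)) hψ A
  simp only [mix]
  set G := ml x ((L.erase e').erase e) ψ
  -- Along the difference of the two directions the extension is a quadratic polynomial whose
  -- leading coefficient is the submodularity gap of G. By `hp` the move has mean zero, so the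
  -- linear terms cancel and the second moment times the gap remains.
  have h1 : 0 ≤ (p * b ^ 2 + (1 - p) * a ^ 2)
      * (G (insert e A) + G (insert e' A) - G A - G (insert e (insert e' A))) :=
    mul_nonneg (add_nonneg (mul_nonneg hp0 (sq_nonneg _))
      (mul_nonneg (sub_nonneg.2 hp1) (sq_nonneg _))) (by linarith)
  have h2 : p * ((1 - (x e' - b)) * ((1 - (x e + b)) * G A + (x e + b) * G (insert e A))
        + (x e' - b) * ((1 - (x e + b)) * G (insert e' A)
          + (x e + b) * G (insert e (insert e' A))))
      + (1 - p) * ((1 - (x e' + a)) * ((1 - (x e - a)) * G A + (x e - a) * G (insert e A))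
        + (x e' + a) * ((1 - (x e - a)) * G (insert e' A)
          + (x e - a) * G (insert e (insert e' A))))
      = (1 - x e') * ((1 - x e) * G A + x e * G (insert e A))
        + x e' * ((1 - x e) * G (insert e' A) + x e * G (insert e (insert e' A)))
        + (p * b ^ 2 + (1 - p) * a ^ 2)
          * (G (insert e A) + G (insert e' A) - G A - G (insert e (insert e' A))) := by
    linear_combination
      ((1 - x e') * (G (insert e A) - G A) + x e' * (G (insert e (insert e' A)) - G (insert e' A))
        + (1 - x e) * (G A - G (insert e' A))
        + x e * (G (insert e A) - G (insert e (insert e' A)))) * hp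
  rw [h2]
  linarith

/-- The fractional point `a • 1_I + b • 1_J + z`. -/
def twoPoint (a b : ℝ) (z : Fin n → ℝ) (IJ : Finset (Fin n) × Finset (Fin n)) (i : Fin n) : ℝ :=
  (if i ∈ IJ.1 then a else 0) + (if i ∈ IJ.2 then b else 0) + z i

/-- The pair consists of independent subsets of `E`. -/
def IndepPair (N : Matroid (Fin n)) (E : Finset (Fin n))
    (IJ : Finset (Fin n) × Finset (Fin n)) : Prop :=
  (IJ.1 ⊆ E ∧ N.Indep (IJ.1 : Set (Fin n))) ∧ (IJ.2 ⊆ E ∧ N.Indep (IJ.2 : Set (Fin n)))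

/-- The size of the symmetric difference. -/
def setDist (IJ : Finset (Fin n) × Finset (Fin n)) : ℕ :=
  (IJ.1 \ IJ.2).card + (IJ.2 \ IJ.1).card

lemma setDist_swap (IJ : Finset (Fin n) × Finset (Fin n)) : setDist IJ.swap = setDist IJ := by
  simp [setDist, add_comm]

lemma setDist_insert_lt {I J : Finset (Fin n)} {e : Fin n} (he : e ∈ J) (heI : e ∉ I) :
    setDist (insert e I, J) < setDist (I, J) := by
  have h1 : insert e I \ J = I \ J := Finset.insert_sdiff_of_mem _ he
  have h2 : (J \ insert e I).card < (J \ I).card := by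
    refine Finset.card_lt_card (Finset.ssubset_iff_of_subset
      (Finset.sdiff_subset_sdiff Finset.Subset.rfl (Finset.subset_insert _ _)) |>.2
      ⟨e, by simp [he, heI], by simp⟩)
  simp only [setDist, h1]
  omega

lemma setDist_erase_lt {I J : Finset (Fin n)} {e : Fin n} (he : e ∈ J) (heI : e ∉ I) :
    setDist (I, J.erase e) < setDist (I, J) := by
  have h1 : I \ J.erase e = I \ J := by
    ext a
    simp only [Finset.mem_sdiff, Finset.mem_erase, not_and]
    constructor
    · rintro ⟨ha, h⟩
      exact ⟨ha, h fun hae => heI (hae ▸ ha)⟩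
    · rintro ⟨ha, h⟩
      exact ⟨ha, fun _ => h⟩
  have h2 : (J.erase e \ I).card < (J \ I).card := by
    refine Finset.card_lt_card (Finset.ssubset_iff_of_subset
      (Finset.sdiff_subset_sdiff (Finset.erase_subset _ _) Finset.Subset.rfl) |>.2
      ⟨e, by simp [he, heI], by simp⟩)
  simp only [setDist, h1]
  omega

lemma setDist_exchange_lt {I J : Finset (Fin n)} {e e' : Fin n} (heI : e ∈ I) (heJ : e ∉ J)
    (he'J : e' ∈ J) (he'I : e' ∉ I) :
    setDist (insert e' (I.erase e), J) < setDist (I, J) := by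
  have h1 : setDist (I.erase e, J) < setDist (I, J) := by
    rw [← setDist_swap, ← setDist_swap (I, J)]
    exact setDist_erase_lt heI heJ
  exact (setDist_insert_lt he'J fun h => he'I (Finset.mem_of_mem_erase h)).trans h1

lemma indep_erase {I : Finset (Fin n)} (h : I ⊆ E ∧ N.Indep (I : Set (Fin n))) (e : Fin n) :
    I.erase e ⊆ E ∧ N.Indep ((I.erase e : Finset (Fin n)) : Set (Fin n)) :=
  ⟨(Finset.erase_subset _ _).trans h.1, h.2.subset (by exact_mod_cast Finset.erase_subset _ _)⟩

lemma sat_find_augment (hind : IsOracle g M ind N E) {I J : Finset (Fin n)} (hI : I ⊆ E)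
    (hJ : J ⊆ E) (k : ℕ) :
    Sat g M (fun r => (∀ e, r = some e → e ∈ J ∧ e ∉ I ∧ insert e I ⊆ E ∧
        N.Indep ((insert e I : Finset (Fin n)) : Set (Fin n))) ∧
      (r = none → ∀ e ∈ J, e ∉ I → ¬ N.Indep ((insert e I : Finset (Fin n)) : Set (Fin n))))
      (findFirst (fun e => do charge k; ind (insert e I)) (elems (J \ I))) := by
  refine (sat_findFirst (fun e => N.Indep ((insert e I : Finset (Fin n)) : Set (Fin n)))
    (elems (J \ I)) fun e he => ?_).mono ?_
  · rw [mem_elems, Finset.mem_sdiff] at he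
    simp only [sat_bind, sat_charge]
    exact hind _ (Finset.insert_subset (hJ he.1) hI)
  · rintro r ⟨h1, h2⟩
    refine ⟨fun e he => ?_, fun hr e heJ heI => h2 hr e (by simp [mem_elems, heJ, heI])⟩
    have := h1 e he
    rw [mem_elems, Finset.mem_sdiff] at this
    exact ⟨this.1.1, this.1.2, Finset.insert_subset (hJ this.1.1) hI, this.2⟩

lemma sat_find_exchange (hind : IsOracle g M ind N E) {I J : Finset (Fin n)} (hI : I ⊆ E)
    (hJ : J ⊆ E) {e : Fin n} (he : e ∈ E) (k : ℕ) :
    Sat g M (fun r => (∀ e', r = some e' → e' ∈ J ∧ e' ∉ I ∧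
        (insert e' (I.erase e) ⊆ E ∧
          N.Indep ((insert e' (I.erase e) : Finset (Fin n)) : Set (Fin n))) ∧
        (insert e (J.erase e') ⊆ E ∧
          N.Indep ((insert e (J.erase e') : Finset (Fin n)) : Set (Fin n)))) ∧
      (r = none → ∀ e' ∈ J \ I,
        ¬ (N.Indep ((insert e' (I.erase e) : Finset (Fin n)) : Set (Fin n)) ∧
          N.Indep ((insert e (J.erase e') : Finset (Fin n)) : Set (Fin n)))))
      (findFirst (fun e' => do
        charge k
        let p ← ind (insert e' (I.erase e))
        let q ← ind (insert e (J.erase e'))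
        pure (p && q)) (elems (J \ I))) := by
  have hs1 : ∀ e' ∈ J, insert e' (I.erase e) ⊆ E := fun e' he' =>
    Finset.insert_subset (hJ he') ((Finset.erase_subset _ _).trans hI)
  have hs2 : ∀ e', insert e (J.erase e') ⊆ E := fun e' =>
    Finset.insert_subset he ((Finset.erase_subset _ _).trans hJ)
  refine (sat_findFirst (fun e' =>
    N.Indep ((insert e' (I.erase e) : Finset (Fin n)) : Set (Fin n)) ∧
      N.Indep ((insert e (J.erase e') : Finset (Fin n)) : Set (Fin n)))
    (elems (J \ I)) fun e' he' => ?_).mono ?_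
  · rw [mem_elems, Finset.mem_sdiff] at he'
    simp only [sat_bind, sat_charge]
    refine (hind _ (hs1 e' he'.1)).mono fun p hp => ?_
    refine (hind _ (hs2 e')).mono fun q hq => ?_
    simp only [sat_pure, Bool.and_eq_true, hp, hq]
  · rintro r ⟨h1, h2⟩
    refine ⟨fun e' he' => ?_, fun hr e' he' => h2 hr e' (by rwa [mem_elems])⟩
    have := h1 e' he'
    rw [mem_elems, Finset.mem_sdiff] at this
    exact ⟨this.1.1, this.1.2, ⟨hs1 e' this.1.1, this.2.1⟩, ⟨hs2 e', this.2.2⟩⟩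

/-- An exchange keeps both sets independent and brings them closer. -/
lemma sat_exchangeStep (hind : IsOracle g M ind N E) (a b : ℝ)
    {IJ : Finset (Fin n) × Finset (Fin n)} (h : IndepPair N E IJ) :
    Sat g M (fun IJ' => IndepPair N E IJ' ∧ setDist IJ' ≤ setDist IJ - 1)
      (exchangeStep ind a b IJ) := by
  obtain ⟨I, J⟩ := IJ
  obtain ⟨hI, hJ⟩ := h
  simp only at hI hJ
  simp only [exchangeStep, sat_bind, sat_charge]
  split_ifs with h1 h2
  · simp only [sat_bind]
    refine (sat_find_augment hind hI.1 hJ.1 (n + 1)).mono ?_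
    rintro (_ | e) ⟨hsome, hnone⟩
    · obtain ⟨e, heJ, heI, hins⟩ := hI.2.augment_finset hJ.2 h1
      exact absurd (by simpa using hins) (hnone rfl e heJ heI)
    · obtain ⟨heJ, heI, hins⟩ := hsome e rfl
      have d1 := setDist_insert_lt heJ heI
      have d2 := setDist_erase_lt heJ heI
      simp only [sat_bind, sat_toss, if_true, Bool.false_eq_true, if_false, sat_pure]
      exact ⟨⟨⟨hins, hJ⟩, by omega⟩, ⟨⟨hI, indep_erase hJ e⟩, by omega⟩⟩
  · simp only [sat_bind]
    refine (sat_find_augment hind hJ.1 hI.1 (n + 1)).mono ?_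
    rintro (_ | e) ⟨hsome, hnone⟩
    · obtain ⟨e, heI, heJ, hins⟩ := hJ.2.augment_finset hI.2 h2
      exact absurd (by simpa using hins) (hnone rfl e heI heJ)
    · obtain ⟨heI, heJ, hins⟩ := hsome e rfl
      have d1 := setDist_insert_lt heI heJ
      have d2 := setDist_erase_lt heI heJ
      rw [← setDist_swap, ← setDist_swap (J, I)] at d1 d2
      simp only [Prod.swap_prod_mk] at d1 d2
      simp only [sat_bind, sat_toss, if_true, Bool.false_eq_true, if_false, sat_pure]
      exact ⟨⟨⟨hI, hins⟩, by omega⟩, ⟨⟨indep_erase hI e, hJ⟩, by omega⟩⟩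
  · have hcard : I.card = J.card := by omega
    rcases hel : elems (I \ J) with _ | ⟨e, l⟩
    · have hsub : I \ J = ∅ := by rw [← toFinset_elems (I \ J), hel]; rfl
      have hIJ : I = J := Finset.eq_of_subset_of_card_le (Finset.sdiff_eq_empty_iff_subset.1 hsub)
        hcard.ge
      subst hIJ
      simp only [sat_pure]
      -- A pair that is already merged has distance 0, and truncated subtraction gives 0 - 1 = 0.
      exact ⟨⟨hI, hI⟩, by simp [setDist]⟩
    · have he : e ∈ I \ J := by rw [← mem_elems, hel]; simp
      rw [Finset.mem_sdiff] at he
      simp only [sat_bind]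
      refine (sat_find_exchange hind hI.1 hJ.1 (hI.1 he.1) (4 * (n + 1))).mono ?_
      rintro (_ | e') ⟨hsome, hnone⟩
      · obtain ⟨e', he', h⟩ := exists_symmetric_exchange hI.2 hJ.2 hcard he.1 he.2
        exact absurd h (hnone rfl e' he')
      · obtain ⟨he'J, he'I, hins1, hins2⟩ := hsome e' rfl
        have d1 := setDist_exchange_lt he.1 he.2 he'J he'I
        have d2 := setDist_exchange_lt he'J he'I he.1 he.2
        rw [← setDist_swap, ← setDist_swap (J, I)] at d2
        simp only [Prod.swap_prod_mk] at d2
        simp only [sat_bind, sat_toss, if_true, Bool.false_eq_true, if_false, sat_pure]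
        exact ⟨⟨⟨hI, hins2⟩, by omega⟩, ⟨⟨hins1, hJ⟩, by omega⟩⟩

lemma twoPoint_insert_left {a b : ℝ} {z : Fin n → ℝ} {I J : Finset (Fin n)} {e : Fin n}
    (he : e ∉ I) : twoPoint a b z (insert e I, J)
      = Function.update (twoPoint a b z (I, J)) e (twoPoint a b z (I, J) e + a) := by
  funext i
  by_cases hi : i = e
  · subst hi; simp [twoPoint, he]; ring
  · simp [twoPoint, hi]

lemma twoPoint_erase_right {a b : ℝ} {z : Fin n → ℝ} {I J : Finset (Fin n)} {e : Fin n}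
    (he : e ∈ J) : twoPoint a b z (I, J.erase e)
      = Function.update (twoPoint a b z (I, J)) e (twoPoint a b z (I, J) e - b) := by
  funext i
  by_cases hi : i = e
  · subst hi; simp [twoPoint, he]; ring
  · simp [twoPoint, hi]

lemma twoPoint_insert_right {a b : ℝ} {z : Fin n → ℝ} {I J : Finset (Fin n)} {e : Fin n}
    (he : e ∉ J) : twoPoint a b z (I, insert e J)
      = Function.update (twoPoint a b z (I, J)) e (twoPoint a b z (I, J) e + b) := by
  funext i
  by_cases hi : i = e
  · subst hi; simp [twoPoint, he]; ring
  · simp [twoPoint, hi]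

lemma twoPoint_erase_left {a b : ℝ} {z : Fin n → ℝ} {I J : Finset (Fin n)} {e : Fin n}
    (he : e ∈ I) : twoPoint a b z (I.erase e, J)
      = Function.update (twoPoint a b z (I, J)) e (twoPoint a b z (I, J) e - a) := by
  funext i
  by_cases hi : i = e
  · subst hi; simp [twoPoint, he]; ring
  · simp [twoPoint, hi]

/-- A gain of b with probability a/(a + b) and a loss of a otherwise has mean zero. If both weights
vanish, the convention 0/0 = 0 makes the identity hold; zero weights do occur, since rounding starts
from the weight 0. -/
lemma weight_ratio {a b : ℝ} (ha : 0 ≤ a) (hb : 0 ≤ b) :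
    0 ≤ a / (a + b) ∧ a / (a + b) ≤ 1 ∧ a / (a + b) * b = (1 - a / (a + b)) * a := by
  refine ⟨by positivity, div_le_one_of_le₀ (by linarith) (by linarith), ?_⟩
  rcases eq_or_lt_of_le (add_nonneg ha hb) with h | h
  · have h1 : a = 0 := by linarith
    have h2 : b = 0 := by linarith
    simp [h1, h2]
  · field_simp
    ring

/-- An exchange does not decrease the expected value of the multilinear extension. -/
lemma le_ev_exchangeStep (hind : IsOracle g M ind N E) (hψ : IsSubmodular ψ)
    {a b : ℝ} {z : Fin n → ℝ} (ha : 0 ≤ a) (hb : 0 ≤ b) (hz0 : ∀ i, 0 ≤ z i)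
    (hz1 : ∀ i, a + b + z i ≤ 1) {IJ : Finset (Fin n) × Finset (Fin n)}
    (h : IndepPair N E IJ) :
    ml (twoPoint a b z IJ) (elems E) ψ ∅
      ≤ ev g M (fun IJ' => ml (twoPoint a b z IJ') (elems E) ψ ∅)
        (exchangeStep ind a b IJ) := by
  obtain ⟨I, J⟩ := IJ
  obtain ⟨hI, hJ⟩ := h
  simp only at hI hJ
  have hx0 : ∀ i, 0 ≤ twoPoint a b z (I, J) i := fun i => by
    have := hz0 i
    simp only [twoPoint]
    split_ifs <;> linarith
  have hx1 : ∀ i, twoPoint a b z (I, J) i ≤ 1 := fun i => by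
    have := hz1 i
    simp only [twoPoint]
    split_ifs <;> linarith
  obtain ⟨ra0, ra1, ra⟩ := weight_ratio ha hb
  obtain ⟨rb0, rb1, rb⟩ := weight_ratio hb ha
  rw [add_comm b a] at rb0 rb1 rb
  set G := ml (twoPoint a b z (I, J)) (elems E) ψ ∅ with hG
  simp only [exchangeStep, ev_bind, ev_charge]
  split_ifs with h1 h2
  · rw [ev_bind, ← ev_const (g := g) (M := M) G (findFirst _ (elems (J \ I)))]
    refine ev_le_ev ((sat_find_augment hind hI.1 hJ.1 (n + 1)).mono ?_)
    rintro (_ | e) ⟨hsome, -⟩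
    · exact le_rfl
    · obtain ⟨heJ, heI, -⟩ := hsome e rfl
      simp only [ev_bind, ev_toss, if_true, Bool.false_eq_true, if_false, ev_pure,
        clip_of_mem rb0 rb1, twoPoint_insert_left heI, twoPoint_erase_right heJ]
      exact (ml_coordinate_move (nodup_elems E) (mem_elems.2 (hJ.1 heJ)) rb ∅).ge
  · rw [ev_bind, ← ev_const (g := g) (M := M) G (findFirst _ (elems (I \ J)))]
    refine ev_le_ev ((sat_find_augment hind hJ.1 hI.1 (n + 1)).mono ?_)
    rintro (_ | e) ⟨hsome, -⟩
    · exact le_rfl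
    · obtain ⟨heI, heJ, -⟩ := hsome e rfl
      simp only [ev_bind, ev_toss, if_true, Bool.false_eq_true, if_false, ev_pure,
        clip_of_mem ra0 ra1, twoPoint_insert_right heJ, twoPoint_erase_left heI]
      exact (ml_coordinate_move (nodup_elems E) (mem_elems.2 (hI.1 heI)) ra ∅).ge
  · rcases hel : elems (I \ J) with _ | ⟨e, l⟩
    · exact le_rfl
    · have he : e ∈ I \ J := by rw [← mem_elems, hel]; simp
      rw [Finset.mem_sdiff] at he
      simp only [ev_bind]
      rw [← ev_const (g := g) (M := M) G (findFirst _ (elems (J \ I)))]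
      refine ev_le_ev ((sat_find_exchange hind hI.1 hJ.1 (hI.1 he.1) (4 * (n + 1))).mono ?_)
      rintro (_ | e') ⟨hsome, -⟩
      · exact le_rfl
      · obtain ⟨he'J, he'I, -⟩ := hsome e' rfl
        have hne : e ≠ e' := fun h => he.2 (h ▸ he'J)
        have p1 : twoPoint a b z (I, insert e (J.erase e'))
            = Function.update (Function.update (twoPoint a b z (I, J)) e
              (twoPoint a b z (I, J) e + b)) e' (twoPoint a b z (I, J) e' - b) := by
          rw [twoPoint_insert_right (by simp [he.2]), twoPoint_erase_right he'J,
            Function.update_of_ne hne, Function.update_comm hne]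
        have p2 : twoPoint a b z (insert e' (I.erase e), J)
            = Function.update (Function.update (twoPoint a b z (I, J)) e
              (twoPoint a b z (I, J) e - a)) e' (twoPoint a b z (I, J) e' + a) := by
          rw [twoPoint_insert_left (by simp [he'I]), twoPoint_erase_left he.1,
            Function.update_of_ne hne.symm]
        simp only [ev_bind, ev_toss, if_true, Bool.false_eq_true, if_false, ev_pure,
          clip_of_mem ra0 ra1, p1, p2]
        exact ml_exchange_move (nodup_elems E) (fun i _ => hx0 i) (fun i _ => hx1 i)
          (mem_elems.2 (hI.1 he.1)) (mem_elems.2 (hJ.1 he'J)) hne (fun A => hψ.pair A hne)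
          ra0 ra1 ra ∅

/-- The symmetric difference has at most n elements and every exchange shrinks it until it is empty,
so n rounds suffice. -/
lemma sat_exchangeLoop (hind : IsOracle g M ind N E) (a b : ℝ)
    {IJ : Finset (Fin n) × Finset (Fin n)} (h : IndepPair N E IJ) :
    Sat g M (fun IJ' => IndepPair N E IJ' ∧ IJ'.1 = IJ'.2)
      (loop (exchangeStep ind a b) n IJ) := by
  have hd : setDist IJ ≤ n := by
    have h1 : Disjoint (IJ.1 \ IJ.2) (IJ.2 \ IJ.1) :=
      Finset.disjoint_left.2 fun a ha hb =>
        (Finset.mem_sdiff.1 hb).2 (Finset.mem_sdiff.1 ha).1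
    have h2 := Finset.card_le_univ ((IJ.1 \ IJ.2) ∪ (IJ.2 \ IJ.1))
    rwa [Finset.card_union_of_disjoint h1, Fintype.card_fin] at h2
  refine (sat_loop (fun k IJ' => IndepPair N E IJ' ∧ setDist IJ' ≤ n - k) ?_ n 0 IJ
    ⟨h, by simpa using hd⟩).mono ?_
  · rintro k IJ' ⟨hp, hk⟩
    refine (sat_exchangeStep hind a b hp).mono ?_
    rintro IJ'' ⟨hp', hk'⟩
    exact ⟨hp', by omega⟩
  · rintro IJ' ⟨hp, hk⟩
    refine ⟨hp, ?_⟩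
    have hk0 : setDist IJ' = 0 := by omega
    simp only [setDist, Nat.add_eq_zero_iff, Finset.card_eq_zero,
      Finset.sdiff_eq_empty_iff_subset] at hk0
    exact Finset.Subset.antisymm hk0.1 hk0.2

lemma le_ev_exchangeLoop (hind : IsOracle g M ind N E) (hψ : IsSubmodular ψ)
    {a b : ℝ} {z : Fin n → ℝ} (ha : 0 ≤ a) (hb : 0 ≤ b) (hz0 : ∀ i, 0 ≤ z i)
    (hz1 : ∀ i, a + b + z i ≤ 1) (k : ℕ) {IJ : Finset (Fin n) × Finset (Fin n)}
    (h : IndepPair N E IJ) :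
    ml (twoPoint a b z IJ) (elems E) ψ ∅
      ≤ ev g M (fun IJ' => ml (twoPoint a b z IJ') (elems E) ψ ∅)
        (loop (exchangeStep ind a b) k IJ) := by
  induction k generalizing IJ with
  | zero => exact le_rfl
  | succ k ih =>
    rw [ev_loop_succ]
    exact (le_ev_exchangeStep hind hψ ha hb hz0 hz1 h).trans
      (ev_le_ev ((sat_exchangeStep hind a b h).mono fun IJ' h' => ih h'.1))

/-- The fractional point `∑ c • 1_I` over the entries `(c, I)` of a list. -/
def partsPoint (parts : List (ℝ × Finset (Fin n))) (i : Fin n) : ℝ :=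
  (parts.map fun q => if i ∈ q.2 then q.1 else 0).sum

lemma partsPoint_nonneg {parts : List (ℝ × Finset (Fin n))} (h : ∀ q ∈ parts, 0 ≤ q.1)
    (i : Fin n) : 0 ≤ partsPoint parts i := by
  refine List.sum_nonneg fun r hr => ?_
  obtain ⟨q, hq, rfl⟩ := List.mem_map.1 hr
  split_ifs
  · exact h q hq
  · exact le_rfl

lemma partsPoint_le {parts : List (ℝ × Finset (Fin n))} (h : ∀ q ∈ parts, 0 ≤ q.1)
    (i : Fin n) : partsPoint parts i ≤ (parts.map Prod.fst).sum := by
  refine List.sum_le_sum fun q hq => ?_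
  split_ifs
  · exact le_rfl
  · exact h q hq

/-- The entries are independent subsets of `E`. -/
def IndepParts (N : Matroid (Fin n)) (E : Finset (Fin n))
    (parts : List (ℝ × Finset (Fin n))) : Prop :=
  ∀ q ∈ parts, q.2 ⊆ E ∧ N.Indep (q.2 : Set (Fin n))

lemma sat_roundParts (hind : IsOracle g M ind N E) {parts : List (ℝ × Finset (Fin n))}
    (h : IndepParts N E parts) :
    Sat g M (fun I => I ⊆ E ∧ N.Indep (I : Set (Fin n))) (roundParts ind parts) := by
  unfold roundParts
  simp only [sat_bind, sat_pure]
  refine (sat_forList (fun rest (s : ℝ × Finset (Fin n)) => IndepParts N E rest ∧ s.2 ⊆ E ∧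
    N.Indep (s.2 : Set (Fin n))) ?_ parts (0, ∅) ⟨h, by simp, by simp⟩).mono
    fun s hs => hs.2
  rintro q rest s ⟨hq, hs⟩
  simp only [sat_bind, sat_charge, sat_pure]
  refine (sat_exchangeLoop hind s.1 q.1 ⟨hs, hq q (by simp)⟩).mono fun IJ hIJ => ?_
  exact ⟨fun q' hq' => hq q' (List.mem_cons_of_mem _ hq'), hIJ.1.1⟩

/-- Rounding does not decrease the expected value of the multilinear extension. -/
lemma le_ev_roundParts (hind : IsOracle g M ind N E) (hψ : IsSubmodular ψ)
    {parts : List (ℝ × Finset (Fin n))} (h : IndepParts N E parts)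
    (h0 : ∀ q ∈ parts, 0 ≤ q.1) (h1 : (parts.map Prod.fst).sum = 1) :
    ml (partsPoint parts) (elems E) ψ ∅ ≤ ev g M ψ (roundParts ind parts) := by
  unfold roundParts
  simp only [ev_bind, ev_pure]
  -- The sets merged so far form the single entry s with their accumulated weight; the entries not
  -- yet treated are the fixed background of `twoPoint`. Total weight 1 keeps every point in the
  -- unit cube, and once I = J the two weights add up to one entry.
  have key : ∀ (parts : List (ℝ × Finset (Fin n))) (s : ℝ × Finset (Fin n)),
      IndepParts N E parts → (∀ q ∈ parts, 0 ≤ q.1) → 0 ≤ s.1 → s.2 ⊆ E →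
      N.Indep (s.2 : Set (Fin n)) → s.1 + (parts.map Prod.fst).sum = 1 →
      ml (partsPoint (s :: parts)) (elems E) ψ ∅
        ≤ ev g M (fun s => ψ s.2) (forList (fun (s : ℝ × Finset (Fin n)) q => do
          let IJ ← loop (exchangeStep ind s.1 q.1) n (s.2, q.2)
          charge (n + 2)
          pure (s.1 + q.1, IJ.1)) parts s) := by
    intro parts
    induction parts with
    | nil =>
      intro s _ _ _ hsE _ hs1
      have hs1 : s.1 = 1 := by simpa using hs1
      rw [ev_forList_nil]
      have : partsPoint [s] = fun i => if i ∈ s.2 then (1 : ℝ) else 0 := by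
        funext i; simp [partsPoint, hs1]
      rw [this, ml_indicator, toFinset_elems, Finset.empty_union, Finset.inter_eq_left.2 hsE]
    | cons q rest ih =>
      intro s hparts hpos hs0 hsE hsI hsum
      rw [ev_forList_cons]
      simp only [ev_bind, ev_charge, ev_pure]
      have hq0 : 0 ≤ q.1 := hpos q (by simp)
      have hrest0 : ∀ q ∈ rest, 0 ≤ q.1 := fun q hq => hpos q (List.mem_cons_of_mem _ hq)
      simp only [List.map_cons, List.sum_cons] at hsum
      have e1 : partsPoint (s :: q :: rest) = twoPoint s.1 q.1 (partsPoint rest) (s.2, q.2) := by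
        funext i; simp [partsPoint, twoPoint, add_assoc]
      have hpair : IndepPair N E (s.2, q.2) := ⟨⟨hsE, hsI⟩, hparts q (by simp)⟩
      rw [e1]
      refine (le_ev_exchangeLoop hind hψ hs0 hq0 (partsPoint_nonneg hrest0) (fun i => ?_) n
        hpair).trans (ev_le_ev ((sat_exchangeLoop hind s.1 q.1 hpair).mono ?_))
      · have := partsPoint_le hrest0 i
        linarith
      · rintro ⟨I, J⟩ ⟨hp, hIJ⟩
        obtain rfl : I = J := hIJ
        have e2 : twoPoint s.1 q.1 (partsPoint rest) (I, I)
            = partsPoint ((s.1 + q.1, I) :: rest) := by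
          funext i
          simp only [partsPoint, twoPoint, List.map_cons, List.sum_cons]
          split_ifs <;> ring
        simp only [e2]
        exact ih (s.1 + q.1, I) (fun q' hq' => hparts q' (List.mem_cons_of_mem _ hq')) hrest0
          (add_nonneg hs0 hq0) hp.1.1 hp.1.2 (by simp only; linarith)
  have := key parts (0, ∅) h h0 le_rfl (by simp) (by simp) (by simpa using h1)
  have e : partsPoint ((0, ∅) :: parts) = partsPoint parts := by
    funext i; simp [partsPoint]
  rwa [e] at this

end

section

open Alg

variable {n : ℕ}

/-! ### Measured continuous greedy -/

section PrefixChain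

variable {v : Fin n → ℝ}

lemma prefixChain_subset (L : List (Fin n)) (u : ℝ) (I : Finset (Fin n)) :
    ∀ q ∈ prefixChain v L u I, q.2 ⊆ I ∪ L.toFinset := by
  induction L generalizing u I with
  | nil => simp [prefixChain]
  | cons i L ih =>
    intro q hq
    simp only [prefixChain, List.mem_cons] at hq
    rcases hq with rfl | hq
    · exact Finset.subset_union_left
    · refine (ih _ _ q hq).trans ?_
      rw [List.toFinset_cons, Finset.union_insert, Finset.insert_union]

lemma prefixChain_sum (L : List (Fin n)) (u : ℝ) (I : Finset (Fin n)) :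
    ((prefixChain v L u I).map Prod.fst).sum = u := by
  induction L generalizing u I with
  | nil => simp [prefixChain]
  | cons i L ih => simp [prefixChain, ih]

lemma prefixChain_nonneg (L : List (Fin n)) (u : ℝ) (I : Finset (Fin n)) (hu : 0 ≤ u)
    (hsort : L.Pairwise fun i j => v j ≤ v i) (hv0 : ∀ i ∈ L, 0 ≤ v i) (hvu : ∀ i ∈ L, v i ≤ u) :
    ∀ q ∈ prefixChain v L u I, 0 ≤ q.1 := by
  induction L generalizing u I with
  | nil => simpa [prefixChain] using hu
  | cons i L ih =>
    rw [List.pairwise_cons] at hsort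
    intro q hq
    simp only [prefixChain, List.mem_cons] at hq
    rcases hq with rfl | hq
    · exact sub_nonneg.2 (hvu i (by simp))
    · exact ih _ _ (hv0 i (by simp)) hsort.2 (fun j hj => hv0 j (List.mem_cons_of_mem _ hj))
        hsort.1 q hq

/-- The coefficients are consecutive differences of the values. They telescope over the members of
the chain that contain a given element, namely those after its position. -/
lemma partsPoint_prefixChain (L : List (Fin n)) (u : ℝ) (I : Finset (Fin n)) (hL : L.Nodup)
    (hI : ∀ i ∈ L, i ∉ I) (i : Fin n) :
    partsPoint (prefixChain v L u I) i = if i ∈ I then u else if i ∈ L then v i else 0 := by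
  induction L generalizing u I with
  | nil => simp [prefixChain, partsPoint]
  | cons j L ih =>
    rw [List.nodup_cons] at hL
    have h1 : partsPoint (prefixChain v (j :: L) u I) i
        = (if i ∈ I then u - v j else 0) + partsPoint (prefixChain v L (v j) (insert j I)) i := by
      simp [prefixChain, partsPoint]
    rw [h1, ih _ _ hL.2 (fun a ha => by
      simp only [Finset.mem_insert, not_or]
      exact ⟨fun h => hL.1 (h ▸ ha), hI a (List.mem_cons_of_mem _ ha)⟩)]
    by_cases hiI : i ∈ I
    · simp [hiI]
    · by_cases hij : i = j
      · subst hij; simp [hiI]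
      · simp [hiI, hij]

lemma length_prefixChain (L : List (Fin n)) (u : ℝ) (I : Finset (Fin n)) :
    (prefixChain v L u I).length = L.length + 1 := by
  induction L generalizing u I with
  | nil => rfl
  | cons i L ih => simp [prefixChain, ih]

end PrefixChain

lemma partsPoint_append (p q : List (ℝ × Finset (Fin n))) (i : Fin n) :
    partsPoint (p ++ q) i = partsPoint p i + partsPoint q i := by
  simp [partsPoint]

lemma partsPoint_scale (δ : ℝ) (p : List (ℝ × Finset (Fin n))) (i : Fin n) :
    partsPoint (p.map fun q => (δ * q.1, q.2)) i = δ * partsPoint p i := by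
  simp only [partsPoint, List.map_map, Function.comp_def, ← List.sum_map_mul_left, mul_ite,
    mul_zero]

variable {g : Finset (Fin n) → ℝ} {M N : Matroid (Fin n)} {E : Finset (Fin n)}
  {ind : Finset (Fin n) → Alg n Bool} {x : Fin n → ℝ}
  {fhat : Finset (Fin n) → Alg n ℝ} {Fh F : Finset (Fin n) → ℝ}

/-- The sampled marginals deviate little from their means. -/
lemma ev_abs_estimateMarginal_sub_le {L : List (Fin n)} (hx0 : ∀ i ∈ L, 0 ≤ x i)
    (hx1 : ∀ i ∈ L, x i ≤ 1) (hfhat : ∀ S (φ : ℝ → ℝ), ev g M φ (fhat S) = φ (Fh S))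
    {Z : Finset (Fin n)} (hZ : ∀ i ∈ L, x i ≠ 0 → i ∈ Z) {B δ : ℝ} (hB : ∀ S ⊆ Z, |Fh S| ≤ B)
    (hB0 : 0 < B) (hδ : 0 < δ) {K : ℕ} (hK : 1 / δ ^ 2 ≤ K) {i : Fin n} (hi : i ∈ Z) :
    ev g M (fun a => |a - ml x L (fun R => Fh (insert i R) - Fh R) ∅|)
      (estimateMarginal L fhat K x i) ≤ 2 * B * δ := by
  set D : Finset (Fin n) → ℝ := fun R => Fh (insert i R) - Fh R with hD
  set μ := ml x L D ∅ with hμ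
  have hV : ml x L (fun R => D R ^ 2) ∅ ≤ 4 * B ^ 2 := by
    have := ml_le_ml (χ := fun _ => 4 * B ^ 2) hx0 hx1 hZ (Finset.empty_subset Z)
      (ψ := fun R => D R ^ 2) (fun S hS => by
        have h1 := abs_le.1 (hB S hS)
        have h2 := abs_le.1 (hB _ (Finset.insert_subset hi hS))
        simp only [hD]
        nlinarith)
    simpa using this
  have hstep : ∀ (φ : ℝ → ℝ) (s : ℝ), ev g M φ (do
      let R ← sampleSet L x
      charge (n + 1)
      let a ← fhat (insert i R)
      let b ← fhat R
      pure (s + (a - b))) = ml x L (fun R => φ (s + D R)) ∅ := by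
    intro φ s
    simp only [ev_bind, ev_charge, hfhat, ev_pure, hD]
    rw [ev_sampleSet hx0 hx1]
  -- Variance of a sum of independent samples, by induction on their number: each adds its mean to
  -- the centre and at most 4B² to the second moment.
  have hloop : ∀ (k : ℕ) (s c : ℝ), ev g M (fun s' => (s' - c) ^ 2) (loop (fun (s : ℝ) => do
      let R ← sampleSet L x
      charge (n + 1)
      let a ← fhat (insert i R)
      let b ← fhat R
      pure (s + (a - b))) k s) ≤ (s + k * μ - c) ^ 2 + k * (4 * B ^ 2) := by
    intro k
    induction k with
    | zero => intro s c; simp [ev_loop_zero]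
    | succ k ih =>
      intro s c
      rw [ev_loop_succ]
      refine (ev_mono (fun s' => ih s' c) _).trans ?_
      rw [hstep]
      have hexp : (fun R => (s + D R + k * μ - c) ^ 2 + k * (4 * B ^ 2))
          = fun R => ((s + k * μ - c) ^ 2 + k * (4 * B ^ 2))
            + (2 * (s + k * μ - c) * D R + D R ^ 2) := by
        funext R; ring
      rw [hexp, ml_add, ml_const, ml_add, ml_const_mul, ← hμ]
      push_cast
      nlinarith [sq_nonneg μ]
  unfold estimateMarginal
  simp only [ev_bind, ev_charge, ev_pure]
  have hδ2 : 0 < δ ^ 2 := by positivity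
  have hKpos : (0 : ℝ) < K := lt_of_lt_of_le (by positivity) hK
  have hKδ : 1 ≤ K * δ ^ 2 := by
    rwa [div_le_iff₀ hδ2] at hK
  -- The inequality |y| ≤ y²/(4β) + β with β = Bδ replaces Cauchy–Schwarz and leaves a second
  -- moment. A mean absolute error is enough because the gain of a step is linear in the errors.
  have hpt : ∀ s : ℝ, |s / K - μ|
      ≤ (1 / (K ^ 2 * (4 * B * δ))) * (s - K * μ) ^ 2 + B * δ := by
    intro s
    have hβ : 0 < 2 * B * δ := by positivity
    have e1 : (1 / (K ^ 2 * (4 * B * δ))) * (s - K * μ) ^ 2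
        = (s / K - μ) ^ 2 / (4 * B * δ) := by
      field_simp
    rw [e1, ← sq_abs (s / K - μ), div_add' _ _ _ (by positivity), le_div_iff₀ (by positivity)]
    nlinarith [sq_nonneg (|s / K - μ| - 2 * B * δ)]
  refine (ev_mono hpt _).trans ?_
  rw [ev_add, ev_const_mul, ev_const]
  have h1 := hloop K 0 (K * μ)
  simp only [zero_add, sub_self, ne_eq, OfNat.ofNat_ne_zero, not_false_eq_true, zero_pow] at h1
  have h2 := mul_le_mul_of_nonneg_left h1
    (show 0 ≤ 1 / ((K : ℝ) ^ 2 * (4 * B * δ)) by positivity)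
  -- The left side is B/(Kδ), and Kδ² ≥ 1.
  have h3 : 1 / ((K : ℝ) ^ 2 * (4 * B * δ)) * (K * (4 * B ^ 2)) ≤ B * δ := by
    rw [div_mul_eq_mul_div, div_le_iff₀ (by positivity)]
    have : 4 * K * B ^ 2 * 1 ≤ 4 * K * B ^ 2 * (K * δ ^ 2) :=
      mul_le_mul_of_nonneg_left hKδ (by positivity)
    nlinarith
  linarith

/-- The gain of one step of measured continuous greedy, when the weights `w` approximate
the true marginals. -/
lemma greedy_gain (hF : IsSubmodular F) (hF0 : ∀ S, 0 ≤ F S) {δ : ℝ} (hδ0 : 0 ≤ δ)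
    (hδE : δ * E.card ≤ 1) (hδ1 : δ ≤ 1) (hx0 : ∀ i, 0 ≤ x i) (hx1 : ∀ i, x i ≤ 1)
    {Z : Finset (Fin n)} {w : Fin n → ℝ} {I O : Finset (Fin n)} (hIE : I ⊆ E) (hIZ : I ⊆ Z)
    (hOZ : O ⊆ Z) (hw : ∑ i ∈ O, w i ≤ ∑ i ∈ I, w i) {X : ℝ} (hX0 : 0 ≤ X)
    (hX : X ≤ ml x (elems E) (fun R => F (R ∪ O)) ∅) :
    (1 - δ - δ ^ 2 * E.card ^ 2) * ml x (elems E) F ∅ + δ * (1 - δ * E.card) * X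
      - 2 * δ * ∑ i ∈ Z, |w i - ml x (elems E) (fun R => F (insert i R) - F R) ∅|
    ≤ ml (fun i => if i ∈ I then x i + δ * (1 - x i) else x i) (elems E) F ∅ := by
  set ω : Fin n → ℝ := fun i => ml x (elems E) (fun R => F (insert i R) - F R) ∅ with hω
  set G := ml x (elems E) F ∅ with hG
  set e := ∑ i ∈ Z, |w i - ω i| with he
  have he0 : 0 ≤ e := Finset.sum_nonneg fun _ _ => abs_nonneg _
  have hG0 : 0 ≤ G := by
    have := ml_mono (x := x) (L := elems E) (ψ := fun _ => 0) (χ := F) (fun i _ => hx0 i)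
      (fun i _ => hx1 i) hF0 ∅
    simpa using this
  have hsub : ∀ A ⊆ Z, |∑ i ∈ A, w i - ∑ i ∈ A, ω i| ≤ e := by
    intro A hA
    rw [← Finset.sum_sub_distrib]
    exact (Finset.abs_sum_le_sum_abs _ _).trans
      (Finset.sum_le_sum_of_subset_of_nonneg hA fun _ _ _ => abs_nonneg _)
  have hO : X - G ≤ ∑ i ∈ O, ω i := by
    simp only [hω]
    rw [← ml_sum]
    have := ml_mono (x := x) (L := elems E) (fun i _ => hx0 i) (fun i _ => hx1 i)
      (fun B => hF.union_sub_le_sum B O) ∅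
    rw [ml_sub] at this
    linarith
  -- I is optimal for the estimated weights only; passing from true to estimated weights on O and
  -- back on I costs e twice.
  have hI : X - G - 2 * e ≤ ∑ i ∈ I, ω i := by
    have h1 := abs_le.1 (hsub I hIZ)
    have h2 := abs_le.1 (hsub O hOZ)
    linarith
  have hIL : I ∩ (elems E).toFinset = I := by rw [toFinset_elems, Finset.inter_eq_left.2 hIE]
  -- The new point is reached by adding to R(x) an independent δ-random subset of I, to which
  -- `first_order_le_ml` applies.
  rw [← ml_ml (x := x) (d := fun i => if i ∈ I then δ else 0) (fun i _ => by
    split_ifs <;> ring)]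
  have hmain := ml_mono (x := x) (L := elems E) (fun i _ => hx0 i) (fun i _ => hx1 i)
    (fun A => first_order_le_ml hF0 hδ0 hδ1 I (nodup_elems E) A) ∅
  rw [hIL] at hmain
  refine le_trans ?_ hmain
  have hexp : ml x (elems E) (fun A => (1 - δ) ^ I.card * (F A + δ * ∑ i ∈ I, F (insert i A))) ∅
      = (1 - δ) ^ I.card * (G + δ * (∑ i ∈ I, ω i + I.card * G)) := by
    rw [ml_const_mul, ml_add, ml_const_mul, ml_sum]
    congr 4
    simp only [hω, ml_sub, Finset.sum_sub_distrib, Finset.sum_const, nsmul_eq_mul]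
    ring
  rw [hexp]
  have hs : (I.card : ℝ) ≤ E.card := by exact_mod_cast Finset.card_le_card hIE
  set q := (1 - δ) ^ I.card with hq
  have hs0 : (0 : ℝ) ≤ I.card := Nat.cast_nonneg _
  have hq1 : q ≤ 1 := pow_le_one₀ (sub_nonneg.2 hδ1) (by linarith)
  -- Bernoulli's inequality. Multiplied by 1 + δ|I| it leaves only the second-order loss δ²|I|² in
  -- the coefficient of G.
  have hqs : 1 - δ * I.card ≤ q := by
    have := one_add_mul_le_pow (a := -δ) (by linarith) I.card
    rw [← sub_eq_add_neg] at this
    linarith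
  have hδs : δ * I.card ≤ δ * E.card := mul_le_mul_of_nonneg_left hs hδ0
  have hq0 : 0 ≤ q := by linarith
  have hδs0 : 0 ≤ δ * I.card := mul_nonneg hδ0 hs0
  have i1 : (1 - δ ^ 2 * E.card ^ 2) * G ≤ q * (1 + δ * I.card) * G := by
    refine mul_le_mul_of_nonneg_right ?_ hG0
    nlinarith
  have i2 : q * (δ * (X - G - 2 * e)) ≤ q * (δ * ∑ i ∈ I, ω i) :=
    mul_le_mul_of_nonneg_left (mul_le_mul_of_nonneg_left hI hδ0) hq0
  have i3 : q * (δ * G) ≤ δ * G := mul_le_of_le_one_left (mul_nonneg hδ0 hG0) hq1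
  have i4 : q * (δ * e) ≤ δ * e := mul_le_of_le_one_left (mul_nonneg hδ0 he0) hq1
  have i5 : (1 - δ * E.card) * (δ * X) ≤ q * (δ * X) :=
    mul_le_mul_of_nonneg_right (by linarith) (mul_nonneg hδ0 hX0)
  nlinarith

/-- Independence of the sets recorded in the state. -/
lemma sat_greedyStep_indepParts (hind : IsOracle g M ind N E) (δ : ℝ) (K : ℕ)
    {s : GreedyState n} (hs : IndepParts N E s.parts) :
    Sat g M (fun s' => IndepParts N E s'.parts) (greedyStep (elems E) fhat ind δ K s) := by
  unfold greedyStep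
  simp only [sat_bind, sat_charge, sat_pure]
  refine sat_of_forall (fun w => ?_) _
  refine (sat_maxWeightIndep hind w).mono ?_
  rintro I ⟨hIE, hI, -⟩ q hq
  simp only [List.mem_append, List.mem_map] at hq
  rcases hq with ⟨p, hp, rfl⟩ | hq
  · have hsub := prefixChain_subset _ _ _ p hp
    rw [Finset.empty_union, List.toFinset_eq_of_perm _ _ (List.perm_insertionSort _ _),
      toFinset_elems] at hsub
    exact ⟨hsub.trans hIE, hI.subset (by exact_mod_cast hsub)⟩
  · exact hs q hq

/-- The invariant of measured continuous greedy after `k` steps. -/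
structure GreedyInv (N : Matroid (Fin n)) (E Z O : Finset (Fin n)) (F : Finset (Fin n) → ℝ)
    (δ : ℝ) (k : ℕ) (s : GreedyState n) : Prop where
  nonneg : ∀ i, 0 ≤ s.x i
  le_one : ∀ i, s.x i ≤ 1
  active : ∀ i, s.x i ≠ 0 → i ∈ Z
  indep : IndepParts N E s.parts
  point : partsPoint s.parts = s.x
  weight_nonneg : ∀ q ∈ s.parts, 0 ≤ q.1
  weight_sum : (s.parts.map Prod.fst).sum = k * δ
  union : (1 - δ) ^ k * F O ≤ ml s.x (elems E) (fun R => F (R ∪ O)) ∅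

/-- The last field replaces monotonicity: the Lovász bound for R ↦ F(R ∪ O) gives (1 - δ) F(A ∪ O)
plus a nonnegative term, so each step multiplies the guarantee by 1 - δ. For the decomposition, the
values 1 - x on I are a convex combination of indicators of prefixes of I, each of them independent.
-/
lemma GreedyInv.step (hF : IsSubmodular F) (hF0 : ∀ S, 0 ≤ F S) {δ : ℝ} (hδ0 : 0 ≤ δ)
    (hδ1 : δ ≤ 1) {Z O : Finset (Fin n)} {k : ℕ} {s : GreedyState n}
    (hs : GreedyInv N E Z O F δ k s) {I : Finset (Fin n)} (hIE : I ⊆ E)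
    (hI : N.Indep (I : Set (Fin n))) (hIZ : I ⊆ Z) :
    GreedyInv N E Z O F δ (k + 1)
      { x := fun i => if i ∈ I then s.x i + δ * (1 - s.x i) else s.x i
        parts := (prefixChain (fun i => 1 - s.x i)
          ((elems I).insertionSort fun i j => 1 - s.x j ≤ 1 - s.x i) 1 ∅).map
            (fun q => (δ * q.1, q.2)) ++ s.parts } := by
  set v : Fin n → ℝ := fun i => 1 - s.x i with hv
  set C := (elems I).insertionSort fun i j => 1 - s.x j ≤ 1 - s.x i with hC
  have hperm : C.Perm (elems I) := List.perm_insertionSort _ _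
  have hmem : ∀ i, i ∈ C ↔ i ∈ I := fun i => by rw [hperm.mem_iff, mem_elems]
  have hnd : C.Nodup := hperm.nodup_iff.2 (nodup_elems I)
  have hsort : C.Pairwise fun i j => v j ≤ v i := by
    have : IsTrans (Fin n) fun i j => v j ≤ v i := ⟨fun a b c h h' => le_trans h' h⟩
    have : Std.Total fun i j : Fin n => v j ≤ v i := ⟨fun a b => le_total _ _⟩
    exact List.pairwise_insertionSort (fun i j => v j ≤ v i) _
  have hCI : C.toFinset = I := by
    ext i; simp [hmem]
  constructor
  · intro i
    have h1 := hs.nonneg i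
    have h2 := mul_nonneg hδ0 (sub_nonneg.2 (hs.le_one i))
    dsimp only
    split_ifs <;> linarith
  · intro i
    have h1 := hs.le_one i
    have h2 := mul_le_mul_of_nonneg_right hδ1 (sub_nonneg.2 (hs.le_one i))
    dsimp only
    split_ifs <;> linarith
  · intro i hi
    by_cases hiI : i ∈ I
    · exact hIZ hiI
    · simp only [hiI, if_false] at hi
      exact hs.active i hi
  · intro q hq
    simp only [List.mem_append, List.mem_map] at hq
    rcases hq with ⟨p, hp, rfl⟩ | hq
    · have hsub := prefixChain_subset _ _ _ p hp
      rw [Finset.empty_union, hCI] at hsub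
      exact ⟨hsub.trans hIE, hI.subset (by exact_mod_cast hsub)⟩
    · exact hs.indep q hq
  · funext i
    simp only [partsPoint_append, partsPoint_scale, hs.point]
    rw [partsPoint_prefixChain C 1 ∅ hnd (by simp)]
    simp only [Finset.notMem_empty, if_false, hmem, hv]
    split_ifs <;> ring
  · intro q hq
    simp only [List.mem_append, List.mem_map] at hq
    rcases hq with ⟨p, hp, rfl⟩ | hq
    · exact mul_nonneg hδ0 (prefixChain_nonneg C 1 ∅ zero_le_one hsort
        (fun i _ => sub_nonneg.2 (hs.le_one i)) (fun i _ => by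
          have := hs.nonneg i
          simp only [hv]; linarith) p hp)
    · exact hs.weight_nonneg q hq
  · have h1 : (((prefixChain v C 1 ∅).map fun q => (δ * q.1, q.2)).map Prod.fst).sum
        = δ * ((prefixChain v C 1 ∅).map Prod.fst).sum := by
      rw [List.map_map, ← List.sum_map_mul_left]
      rfl
    simp only [List.map_append, List.sum_append, h1, prefixChain_sum, hs.weight_sum]
    push_cast
    ring
  · rw [← ml_ml (x := s.x) (d := fun i => if i ∈ I then δ else 0) (fun i _ => by
      dsimp only
      split_ifs <;> ring)]
    have h1 : ∀ A : Finset (Fin n), (1 - δ) * F (A ∪ O)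
        ≤ ml (fun i => if i ∈ I then δ else 0) (elems E) (fun R => F (R ∪ O)) A := by
      intro A
      refine le_trans ?_ (lovasz_le_ml (hF.union_right O) hδ0 hδ1 I (nodup_elems E) A)
      have := mul_nonneg hδ0 (hF0 (A ∪ I ∩ (elems E).toFinset ∪ O))
      linarith
    have h2 := ml_mono (x := s.x) (L := elems E) (fun i _ => hs.nonneg i)
      (fun i _ => hs.le_one i) h1 ∅
    rw [ml_const_mul] at h2
    have h3 := mul_le_mul_of_nonneg_left hs.union (sub_nonneg.2 hδ1)
    rw [pow_succ]
    linarith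

/-- The estimated marginals of all elements. -/
lemma ev_sum_abs_estimates_le {Z : Finset (Fin n)} {est : Fin n → Alg n ℝ} {ω : Fin n → ℝ}
    {b : ℝ} (hb : 0 ≤ b) (hest : ∀ i ∈ Z, ev g M (fun a => |a - ω i|) (est i) ≤ b)
    (L : List (Fin n)) (w : Fin n → ℝ) :
    ev g M (fun w' => ∑ i ∈ Z, |w' i - ω i|) (forList (fun (w : Fin n → ℝ) i => do
      let a ← est i
      charge (n + 1)
      pure (Function.update w i a)) L w)
      ≤ L.length * b + ∑ i ∈ Z.filter (· ∉ L), |w i - ω i| := by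
  induction L generalizing w with
  | nil => simp [ev_forList_nil]
  | cons j L ih =>
    rw [ev_forList_cons]
    simp only [ev_bind, ev_charge, ev_pure]
    have hpt : ∀ a, ev g M (fun w' => ∑ i ∈ Z, |w' i - ω i|) (forList (fun (w : Fin n → ℝ) i => do
        let a ← est i
        charge (n + 1)
        pure (Function.update w i a)) L (Function.update w j a))
        ≤ (L.length * b + ∑ i ∈ Z.filter (· ∉ j :: L), |w i - ω i|)
          + (if j ∈ Z then 1 else 0) * |a - ω j| := by
      intro a
      refine (ih (Function.update w j a)).trans ?_
      rw [add_assoc]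
      refine add_le_add le_rfl ?_
      have hsub : Z.filter (· ∉ L) ⊆ Z.filter (· ∉ j :: L) ∪ Z.filter (· = j) := by
        intro i hi
        simp only [Finset.mem_filter, Finset.mem_union, List.mem_cons, not_or] at hi ⊢
        by_cases hij : i = j
        · exact Or.inr ⟨hi.1, hij⟩
        · exact Or.inl ⟨hi.1, hij, hi.2⟩
      have hdisj : Disjoint (Z.filter (· ∉ j :: L)) (Z.filter (· = j)) := by
        rw [Finset.disjoint_left]
        intro i hi hi'
        simp only [Finset.mem_filter, List.mem_cons, not_or] at hi hi'
        exact hi.2.1 hi'.2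
      refine (Finset.sum_le_sum_of_subset_of_nonneg hsub fun _ _ _ => abs_nonneg _).trans ?_
      rw [Finset.sum_union hdisj]
      refine add_le_add (Finset.sum_le_sum fun i hi => ?_) ?_
      · simp only [Finset.mem_filter, List.mem_cons, not_or] at hi
        rw [Function.update_of_ne hi.2.1]
      · rw [Finset.filter_eq']
        split_ifs <;> simp
    refine (ev_mono hpt _).trans ?_
    rw [ev_add, ev_const, ev_const_mul]
    have : (if j ∈ Z then (1 : ℝ) else 0) * ev g M (fun a => |a - ω j|) (est j) ≤ b := by
      split_ifs with hj
      · rw [one_mul]; exact hest j hj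
      · simpa using hb
    rw [List.length_cons]
    push_cast
    linarith

/-- One step of measured continuous greedy with an approximate value oracle. -/
lemma greedyStep_spec (hind : IsOracle g M ind N E)
    (hfhat : ∀ S (φ : ℝ → ℝ), ev g M φ (fhat S) = φ (Fh S)) (hF : IsSubmodular F)
    (hF0 : ∀ S, 0 ≤ F S) {δ : ℝ} (hδ0 : 0 < δ) (hδE : δ * E.card ≤ 1) (hδ1 : δ ≤ 1)
    {Z O : Finset (Fin n)} (hZE : Z ⊆ E)
    (hZ : ∀ I ⊆ E, N.Indep (I : Set (Fin n)) → I ⊆ Z) (hOE : O ⊆ E)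
    (hO : N.Indep (O : Set (Fin n))) {B η : ℝ} (hB : ∀ S ⊆ Z, |Fh S| ≤ B) (hB0 : 0 < B)
    (hη : ∀ S ⊆ Z, |Fh S - F S| ≤ η) {K : ℕ} (hK : 1 / δ ^ 2 ≤ K) {k : ℕ} {s : GreedyState n}
    (hs : GreedyInv N E Z O F δ k s) :
    Sat g M (GreedyInv N E Z O F δ (k + 1)) (greedyStep (elems E) fhat ind δ K s) ∧
    (1 - δ - δ ^ 2 * E.card ^ 2) * ml s.x (elems E) F ∅
      + δ * (1 - δ * E.card) * ((1 - δ) ^ k * F O)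
      - 2 * δ * (E.card * (2 * B * δ + 2 * η))
    ≤ ev g M (fun s' => ml s'.x (elems E) F ∅) (greedyStep (elems E) fhat ind δ K s) := by
  have hη0 : 0 ≤ η := (abs_nonneg _).trans (hη ∅ (Finset.empty_subset _))
  constructor
  · unfold greedyStep
    simp only [sat_bind, sat_charge, sat_pure]
    refine sat_of_forall (fun w => ?_) _
    refine (sat_maxWeightIndep hind w).mono ?_
    rintro I ⟨hIE, hI, -⟩
    exact hs.step hF hF0 hδ0.le hδ1 hIE hI (hZ I hIE hI)
  · set ω : Fin n → ℝ := fun i => ml s.x (elems E) (fun R => F (insert i R) - F R) ∅ with hω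
    have hest : ∀ i ∈ Z, ev g M (fun a => |a - ω i|) (estimateMarginal (elems E) fhat K s.x i)
        ≤ 2 * B * δ + 2 * η := by
      intro i hi
      have h1 := ev_abs_estimateMarginal_sub_le (L := elems E) (fun i _ => hs.nonneg i)
        (fun i _ => hs.le_one i) hfhat (fun i _ => hs.active i) hB hB0 hδ0 hK hi
      set μ := ml s.x (elems E) (fun R => Fh (insert i R) - Fh R) ∅ with hμ
      -- Under the law of R(x) only subsets of Z have positive probability, so closeness of `Fh` to
      -- F is required on Z alone.
      have h2 : |μ - ω i| ≤ 2 * η := by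
        simp only [hμ, hω]
        rw [← ml_sub, abs_le]
        have hb : ∀ R ⊆ Z, |Fh (insert i R) - Fh R - (F (insert i R) - F R)| ≤ 2 * η := by
          intro R hR
          have e1 := abs_le.1 (hη R hR)
          have e2 := abs_le.1 (hη _ (Finset.insert_subset hi hR))
          rw [abs_le]
          constructor <;> linarith
        constructor
        · have := ml_le_ml (x := s.x) (L := elems E) (ψ := fun _ => -(2 * η))
            (fun i _ => hs.nonneg i) (fun i _ => hs.le_one i) (fun i _ => hs.active i)
            (Finset.empty_subset Z) (fun R hR => (abs_le.1 (hb R hR)).1)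
          simpa using this
        · have := ml_le_ml (x := s.x) (L := elems E) (χ := fun _ => 2 * η)
            (fun i _ => hs.nonneg i) (fun i _ => hs.le_one i) (fun i _ => hs.active i)
            (Finset.empty_subset Z) (fun R hR => (abs_le.1 (hb R hR)).2)
          simpa using this
      have h3 := ev_mono (g := g) (M := M) (φ := fun a => |a - ω i|)
        (ψ := fun a => |a - μ| + |μ - ω i|) (fun a => abs_sub_le _ _ _)
        (estimateMarginal (elems E) fhat K s.x i)
      rw [ev_add, ev_const] at h3
      linarith
    have herr := ev_sum_abs_estimates_le (g := g) (M := M) (ω := ω) (b := 2 * B * δ + 2 * η)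
      (by positivity) hest (elems E) fun _ => 0
    have hfil : Z.filter (· ∉ elems E) = ∅ := by
      rw [Finset.filter_eq_empty_iff]
      intro i hi h
      exact h (mem_elems.2 (hZE hi))
    rw [hfil, Finset.sum_empty, add_zero, length_elems] at herr
    unfold greedyStep
    simp only [ev_bind, ev_charge, ev_pure]
    have hgain : ∀ w : Fin n → ℝ, ((1 - δ - δ ^ 2 * E.card ^ 2) * ml s.x (elems E) F ∅
        + δ * (1 - δ * E.card) * ((1 - δ) ^ k * F O)) - 2 * δ * ∑ i ∈ Z, |w i - ω i|
        ≤ ev g M (fun I => ml (fun i => if i ∈ I then s.x i + δ * (1 - s.x i) else s.x i)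
          (elems E) F ∅) (maxWeightIndep (elems E) ind w) := by
      intro w
      rw [← ev_const (g := g) (M := M) (_ - _) (maxWeightIndep (elems E) ind w)]
      refine ev_le_ev ((sat_maxWeightIndep hind w).mono ?_)
      rintro I ⟨hIE, hI, hmax⟩
      exact greedy_gain hF hF0 hδ0.le hδE hδ1 hs.nonneg hs.le_one hIE (hZ I hIE hI)
        (hZ O hOE hO) (hmax O hOE hO)
        (mul_nonneg (pow_nonneg (sub_nonneg.2 hδ1) _) (hF0 O)) hs.union
    refine le_trans ?_ (ev_mono hgain _)
    rw [ev_sub, ev_const, ev_const_mul]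
    have := mul_le_mul_of_nonneg_left herr (show 0 ≤ 2 * δ by linarith)
    linarith

lemma sat_measuredContinuousGreedy (hind : IsOracle g M ind N E) :
    Sat g M (fun I => I ⊆ E ∧ N.Indep (I : Set (Fin n)))
      (measuredContinuousGreedy (elems E) fhat ind) := by
  unfold measuredContinuousGreedy
  simp only [sat_bind, sat_charge]
  refine (sat_loop (fun _ (s : GreedyState n) => IndepParts N E s.parts) (fun k s hs => ?_) _ 0 _
    ?_).mono fun s hs => sat_roundParts hind hs
  · exact sat_greedyStep_indepParts hind _ _ hs
  · intro q hq
    simp at hq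

/-- The approximation guarantee of measured continuous greedy with an approximate value
oracle. -/
lemma le_ev_measuredContinuousGreedy (hind : IsOracle g M ind N E)
    (hfhat : ∀ S (φ : ℝ → ℝ), ev g M φ (fhat S) = φ (Fh S)) (hF : IsSubmodular F)
    (hF0 : ∀ S, 0 ≤ F S) (hE : 2 ≤ E.card) {δ : ℝ} (hδ : δ = 1 / (E.card : ℝ) ^ 4)
    {Z O : Finset (Fin n)} (hZE : Z ⊆ E)
    (hZ : ∀ I ⊆ E, N.Indep (I : Set (Fin n)) → I ⊆ Z) (hOE : O ⊆ E)
    (hO : N.Indep (O : Set (Fin n))) {B η : ℝ} (hB : ∀ S ⊆ Z, |Fh S| ≤ B) (hB0 : 0 < B)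
    (hη : ∀ S ⊆ Z, |Fh S - F S| ≤ η) :
    (1 - δ * E.card) * (1 - δ - δ ^ 2 * E.card ^ 2) ^ (E.card ^ 4) * F O
      - 2 * (E.card * (2 * B * δ + 2 * η))
    ≤ ev g M F (measuredContinuousGreedy (elems E) fhat ind) := by
  have hη0 : 0 ≤ η := (abs_nonneg _).trans (hη ∅ (Finset.empty_subset _))
  have hE' : (2 : ℝ) ≤ E.card := by exact_mod_cast hE
  set c : ℝ := (E.card : ℝ) with hc
  have hc4 : (0 : ℝ) < c ^ 4 := by positivity
  have hδ0 : 0 < δ := by rw [hδ]; positivity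
  have hδc4 : c ^ 4 * δ = 1 := by rw [hδ]; field_simp
  have hc2 : (4 : ℝ) ≤ c ^ 2 := by nlinarith
  have hδc2 : δ * c ^ 2 ≤ 1 / 4 := by
    have : δ * c ^ 2 * c ^ 2 = 1 := by linarith [hδc4, show δ * c ^ 2 * c ^ 2 = c ^ 4 * δ by ring]
    have h0 : 0 ≤ δ * c ^ 2 := by positivity
    nlinarith
  have hδE : δ * c ≤ 1 := by nlinarith
  have hδ4 : δ ≤ 1 / 4 := by nlinarith
  have hδ1 : δ ≤ 1 := by linarith
  set ρ : ℝ := 1 - δ - δ ^ 2 * c ^ 2 with hρ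
  have hρ0 : 0 ≤ ρ := by
    have : δ ^ 2 * c ^ 2 ≤ 1 / 4 := by nlinarith
    linarith
  have hρδ : ρ ≤ 1 - δ := by
    have : 0 ≤ δ ^ 2 * c ^ 2 := by positivity
    linarith
  have hρ1 : ρ ≤ 1 := by linarith
  set err : ℝ := 2 * δ * (c * (2 * B * δ + 2 * η)) with herr
  have herr0 : 0 ≤ err := by positivity
  set a : ℝ := δ * (1 - δ * c) * F O with ha
  have ha0 : 0 ≤ a := mul_nonneg (mul_nonneg hδ0.le (sub_nonneg.2 hδE)) (hF0 O)
  unfold measuredContinuousGreedy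
  simp only [length_elems, ← hc, ← hδ, ev_bind, ev_charge]
  set K : ℕ := ⌈10 / δ ^ 2 * Real.log (2 * c)⌉₊ with hKdef
  -- The second moment argument needs no more than this; 10 log(2c) ≥ 1 because c ≥ 2.
  have hK : 1 / δ ^ 2 ≤ K := by
    refine le_trans ?_ (Nat.le_ceil _)
    have hlog : (1 : ℝ) / 10 ≤ Real.log (2 * c) := by
      have h1 : Real.log 2 ≤ Real.log (2 * c) := Real.log_le_log (by norm_num) (by linarith)
      have := Real.log_two_gt_d9
      linarith
    rw [div_mul_eq_mul_div]
    refine div_le_div_of_nonneg_right ?_ (by positivity)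
    linarith
  have hstep := fun (k : ℕ) (s : GreedyState n) (hs : GreedyInv N E Z O F δ k s) =>
    greedyStep_spec hind hfhat hF hF0 hδ0 hδE hδ1 hZE hZ hOE hO hB hB0 hη hK hs
  -- One step maps the value G to at least ρG + a(1 - δ)^k - err. Since ρ ≤ 1 - δ, each of the j
  -- contributions of a is at least aρ^(k + j), and factors ρ ≤ 1 only shrink the errors.
  have hloop : ∀ (j k : ℕ) (s : GreedyState n), GreedyInv N E Z O F δ k s →
      j * (a * ρ ^ (k + j)) - j * err
        ≤ ev g M (fun s' => ml s'.x (elems E) F ∅)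
          (loop (greedyStep (elems E) fhat ind δ K) j s) - ρ ^ j * ml s.x (elems E) F ∅ := by
    intro j
    induction j with
    | zero => intro k s _; simp [ev_loop_zero]
    | succ j ih =>
      intro k s hs
      obtain ⟨hsat, hev⟩ := hstep k s hs
      rw [ev_loop_succ]
      have h1 : ev g M (fun s' => ρ ^ j * ml s'.x (elems E) F ∅
          + (j * (a * ρ ^ (k + 1 + j)) - j * err)) (greedyStep (elems E) fhat ind δ K s)
          ≤ ev g M (fun s' => ev g M (fun s' => ml s'.x (elems E) F ∅)
            (loop (greedyStep (elems E) fhat ind δ K) j s'))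
            (greedyStep (elems E) fhat ind δ K s) :=
        ev_le_ev (hsat.mono fun s' hs' => by linarith [ih (k + 1) s' hs'])
      rw [ev_add, ev_const, ev_const_mul] at h1
      have h2 : ρ ^ j * (ρ * ml s.x (elems E) F ∅ + a * (1 - δ) ^ k - err)
          ≤ ρ ^ j * ev g M (fun s' => ml s'.x (elems E) F ∅)
            (greedyStep (elems E) fhat ind δ K s) := by
        refine mul_le_mul_of_nonneg_left (le_trans (le_of_eq ?_) hev) (pow_nonneg hρ0 j)
        simp only [ha, herr]
        ring
      have h3 : ρ ^ j * err ≤ err := mul_le_of_le_one_left herr0 (pow_le_one₀ hρ0 hρ1)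
      have h4 : a * ρ ^ (k + (j + 1)) ≤ ρ ^ j * (a * (1 - δ) ^ k) := by
        have e1 : ρ ^ (k + (j + 1)) ≤ ρ ^ (k + j) :=
          pow_le_pow_of_le_one hρ0 hρ1 (by omega)
        have e2 : ρ ^ (k + j) ≤ ρ ^ j * (1 - δ) ^ k := by
          rw [add_comm k j, pow_add]
          exact mul_le_mul_of_nonneg_left (pow_le_pow_left₀ hρ0 hρδ k) (pow_nonneg hρ0 j)
        calc a * ρ ^ (k + (j + 1)) ≤ a * (ρ ^ j * (1 - δ) ^ k) :=
              mul_le_mul_of_nonneg_left (e1.trans e2) ha0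
          _ = ρ ^ j * (a * (1 - δ) ^ k) := by ring
      have e5 : k + 1 + j = k + (j + 1) := by ring
      rw [e5] at h1
      have e6 : ρ ^ (j + 1) * ml s.x (elems E) F ∅ = ρ ^ j * (ρ * ml s.x (elems E) F ∅) := by
        rw [pow_succ]; ring
      rw [e6]
      push_cast
      nlinarith
  have hinit : GreedyInv N E Z O F δ 0 { x := fun _ => 0, parts := [] } := by
    constructor
    · simp
    · simp
    · simp
    · intro q hq; simp at hq
    · funext i; simp [partsPoint]
    · simp
    · simp
    · have : (fun _ : Fin n => (0 : ℝ)) = fun i => if i ∈ (∅ : Finset (Fin n)) then 1 else 0 := by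
        funext i; simp
      simp only [this, ml_indicator]
      simp
  have hT : ((E.card ^ 4 : ℕ) : ℝ) = c ^ 4 := by push_cast; rfl
  have hfin := hloop (E.card ^ 4) 0 _ hinit
  have hinv := sat_loop (fun k s => GreedyInv N E Z O F δ k s) (fun k s hs => (hstep k s hs).1)
    (E.card ^ 4) 0 _ hinit
  rw [zero_add] at hfin hinv
  have hround : ev g M (fun s' : GreedyState n => ml s'.x (elems E) F ∅)
      (loop (greedyStep (elems E) fhat ind δ K) (E.card ^ 4) { x := fun _ => 0, parts := [] })
      ≤ ev g M (fun s' => ev g M F (roundParts ind s'.parts))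
        (loop (greedyStep (elems E) fhat ind δ K) (E.card ^ 4)
          { x := fun _ => 0, parts := [] }) := by
    -- Rounding needs total weight exactly 1, which holds because the number of steps is 1/δ.
    refine ev_le_ev (hinv.mono fun s hs => ?_)
    rw [← hs.point]
    refine le_ev_roundParts hind hF hs.indep hs.weight_nonneg ?_
    rw [hs.weight_sum, hT, hδc4]
  refine le_trans ?_ hround
  have hG0 : 0 ≤ ρ ^ (E.card ^ 4) * ml (fun _ => 0) (elems E) F ∅ := by
    refine mul_nonneg (pow_nonneg hρ0 _) ?_
    have := ml_mono (x := fun _ => 0) (L := elems E) (ψ := fun _ => 0) (χ := F)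
      (fun i _ => le_rfl) (fun i _ => zero_le_one) hF0 ∅
    simpa using this
  rw [hT] at hfin
  have e1 : c ^ 4 * (a * ρ ^ (E.card ^ 4)) = (1 - δ * c) * ρ ^ (E.card ^ 4) * F O := by
    calc c ^ 4 * (a * ρ ^ (E.card ^ 4))
        = (c ^ 4 * δ) * ((1 - δ * c) * ρ ^ (E.card ^ 4) * F O) := by simp only [ha]; ring
      _ = _ := by rw [hδc4, one_mul]
  have e2 : c ^ 4 * err = 2 * (c * (2 * B * δ + 2 * η)) := by
    calc c ^ 4 * err = (c ^ 4 * δ) * (2 * (c * (2 * B * δ + 2 * η))) := by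
          simp only [herr]; ring
      _ = _ := by rw [hδc4, one_mul]
  rw [e1, e2] at hfin
  linarith

end

/-! ### Uniform subsets, averages over them, the surrogate and the contracted optimum -/

section

open Alg

variable {n : ℕ} {g : Finset (Fin n) → ℝ} {M : Matroid (Fin n)}

/-! ### Random subsets of fixed size -/

lemma sum_powersetCard_succ_insert {α : Type*} [DecidableEq α] {x : α} {s : Finset α}
    (hx : x ∉ s) (k : ℕ) (φ : Finset α → ℝ) :
    ∑ S ∈ Finset.powersetCard (k + 1) (insert x s), φ S
      = ∑ S ∈ Finset.powersetCard k s, φ (insert x S)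
        + ∑ S ∈ Finset.powersetCard (k + 1) s, φ S := by
  rw [Finset.powersetCard_succ_insert hx, Finset.sum_union, Finset.sum_image, add_comm]
  · intro S hS T hT h
    have hS' : x ∉ S := fun h => hx ((Finset.mem_powersetCard.1 hS).1 h)
    have hT' : x ∉ T := fun h => hx ((Finset.mem_powersetCard.1 hT).1 h)
    rw [← Finset.erase_insert hS', ← Finset.erase_insert hT', h]
  · rw [Finset.disjoint_left]
    intro S hS hS'
    obtain ⟨T, -, rfl⟩ := Finset.mem_image.1 hS'
    exact hx ((Finset.mem_powersetCard.1 hS).1 (Finset.mem_insert_self x T))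

/-- Selection sampling produces a uniformly random subset. -/
lemma choose_mul_ev_sampleSubset (φ : Finset (Fin n) → ℝ) (L : List (Fin n)) (hL : L.Nodup)
    (k : ℕ) (hk : k ≤ L.length) :
    (L.length.choose k : ℝ) * ev g M φ (sampleSubset L k)
      = ∑ S ∈ Finset.powersetCard k L.toFinset, φ S := by
  induction L generalizing k φ with
  | nil =>
    obtain rfl : k = 0 := by simpa using hk
    simp [sampleSubset]
  | cons x L ih =>
    rw [List.nodup_cons] at hL
    have hx : x ∉ L.toFinset := by simpa using hL.1
    simp only [sampleSubset, ev_bind, ev_charge, ev_toss, if_true, Bool.false_eq_true, if_false,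
      ev_pure, List.length_cons, List.toFinset_cons]
    have hl : (0 : ℝ) < (L.length : ℝ) + 1 := by positivity
    rcases k with _ | k
    · have h0 := ih φ hL.2 0 (Nat.zero_le _)
      simp only [Nat.choose_zero_right, Nat.cast_one, one_mul, Finset.powersetCard_zero,
        Finset.sum_singleton] at h0
      simp [clip, h0]
    · rw [List.length_cons] at hk
      have hk' : k ≤ L.length := by omega
      have hkr : ((k + 1 : ℕ) : ℝ) ≤ (L.length : ℝ) + 1 := by exact_mod_cast hk
      rw [clip_of_mem (by positivity) (div_le_one_of_le₀ hkr hl.le), Nat.add_sub_cancel,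
        sum_powersetCard_succ_insert hx, ← ih (fun S => φ (insert x S)) hL.2 k hk']
      have h1 : ((L.length + 1).choose (k + 1) : ℝ) * (((k + 1 : ℕ) : ℝ) / ((L.length : ℝ) + 1))
          = L.length.choose k := by
        have := Nat.add_one_mul_choose_eq L.length k
        have h : ((L.length : ℝ) + 1) * (L.length.choose k : ℝ)
            = ((L.length + 1).choose (k + 1) : ℝ) * ((k + 1 : ℕ) : ℝ) := by exact_mod_cast this
        field_simp
        linarith
      have h2 : ((L.length + 1).choose (k + 1) : ℝ)
          = (L.length.choose k : ℝ) + (L.length.choose (k + 1) : ℝ) := by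
        exact_mod_cast Nat.choose_succ_succ L.length k
      have h3 : (L.length.choose (k + 1) : ℝ) * ev g M φ (sampleSubset L (k + 1))
          = ∑ S ∈ Finset.powersetCard (k + 1) L.toFinset, φ S := by
        -- If k + 1 exceeds the length of the rest, the coin surely takes x, and both sides vanish.
        rcases Nat.lt_or_ge L.length (k + 1) with hlt | hge
        · rw [Nat.choose_eq_zero_of_lt hlt, Finset.powersetCard_eq_empty.2]
          · simp
          · rwa [List.toFinset_card_of_nodup hL.2]
        · exact ih φ hL.2 (k + 1) hge
      rw [← h3]
      set p := ((k + 1 : ℕ) : ℝ) / ((L.length : ℝ) + 1)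
      linear_combination (ev g M (fun a => φ (insert x a)) (sampleSubset L k)
        - ev g M φ (sampleSubset L (k + 1))) * h1 + ev g M φ (sampleSubset L (k + 1)) * h2

lemma ev_sampleSubset_elems (φ : Finset (Fin n) → ℝ) (H : Finset (Fin n)) {k : ℕ}
    (hk : k ≤ H.card) :
    ev g M φ (sampleSubset (elems H) k)
      = (H.card.choose k : ℝ)⁻¹ * ∑ S ∈ Finset.powersetCard k H, φ S := by
  have h := choose_mul_ev_sampleSubset (g := g) (M := M) φ (elems H) (nodup_elems H) k
    (by rwa [length_elems])
  rw [length_elems, toFinset_elems] at h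
  have hc : (0 : ℝ) < H.card.choose k := by exact_mod_cast Nat.choose_pos hk
  rw [← h, inv_mul_cancel_left₀ hc.ne']

lemma sat_sampleSubset (L : List (Fin n)) (k : ℕ) :
    Sat g M (fun S => S ⊆ L.toFinset) (sampleSubset L k) := by
  induction L generalizing k with
  | nil => simp [sampleSubset]
  | cons x L ih =>
    simp only [sampleSubset, sat_bind, sat_charge, sat_toss, if_true, Bool.false_eq_true,
      if_false, sat_pure, List.toFinset_cons]
    exact ⟨(ih (k - 1)).mono fun S hS => Finset.insert_subset_insert x hS,
      (ih k).mono fun S hS => hS.trans (Finset.subset_insert _ _)⟩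

open Classical in
/-- The sum of `φ` over the subsets of size `k` that differ on `s` from the entries of `avoid`. -/
def avoidingSum (s : Finset (Fin n)) (k : ℕ) (avoid : List (Finset (Fin n)))
    (φ : Finset (Fin n) → ℝ) : ℝ :=
  ∑ S ∈ Finset.powersetCard k s, if ∃ A ∈ avoid, A ∩ s = S then 0 else φ S

lemma length_le_choose {s : Finset (Fin n)} {k : ℕ} {avoid : List (Finset (Fin n))}
    (hnd : (avoid.map (· ∩ s)).Nodup) (hcard : ∀ A ∈ avoid, (A ∩ s).card = k) :
    avoid.length ≤ s.card.choose k := by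
  rw [← List.length_map (f := (· ∩ s)), ← List.toFinset_card_of_nodup hnd,
    ← Finset.card_powersetCard]
  refine Finset.card_le_card fun S hS => ?_
  obtain ⟨A, hA, rfl⟩ := List.mem_map.1 (List.mem_toFinset.1 hS)
  exact Finset.mem_powersetCard.2 ⟨Finset.inter_subset_right, hcard A hA⟩

/-- Among entries that agree about x, the trace on s determines the trace on s + x. Distinctness, on
which the count of admissible sets relies, thus passes to the recursive calls. -/
lemma nodup_map_filter_inter {x : Fin n} {s : Finset (Fin n)} {avoid : List (Finset (Fin n))}
    (hnd : (avoid.map (· ∩ insert x s)).Nodup) {p : Finset (Fin n) → Prop} [DecidablePred p]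
    (hp : ∀ A B, p A → p B → (x ∈ A ↔ x ∈ B)) :
    ((avoid.filter (p ·)).map (· ∩ s)).Nodup := by
  have h1 : ((avoid.filter (p ·)).map (· ∩ insert x s)).Nodup :=
    hnd.sublist (List.filter_sublist.map _)
  have h2 := List.inj_on_of_nodup_map h1
  refine List.Nodup.map_on (fun A hA B hB hAB => h2 hA hB ?_) h1.of_map
  have hx := hp A B (by simpa using (List.mem_filter.1 hA).2)
    (by simpa using (List.mem_filter.1 hB).2)
  by_cases hxA : x ∈ A
  · rw [Finset.inter_insert_of_mem hxA, Finset.inter_insert_of_mem (hx.1 hxA)]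
    exact congrArg _ hAB
  · rw [Finset.inter_insert_of_notMem hxA, Finset.inter_insert_of_notMem (fun h => hxA (hx.2 h))]
    exact hAB

/-- `sampleAvoiding` produces a uniformly random set among the admissible ones. -/
lemma choose_sub_mul_ev_sampleAvoiding (φ : Finset (Fin n) → ℝ) (L : List (Fin n))
    (hL : L.Nodup) (k : ℕ) (avoid : List (Finset (Fin n)))
    (hnd : (avoid.map (· ∩ L.toFinset)).Nodup)
    (hcard : ∀ A ∈ avoid, (A ∩ L.toFinset).card = k) :
    ((L.length.choose k : ℝ) - avoid.length) * ev g M φ (sampleAvoiding L k avoid)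
      = avoidingSum L.toFinset k avoid φ := by
  induction L generalizing k φ avoid with
  | nil =>
    simp only [List.toFinset_nil, Finset.inter_empty, Finset.card_empty] at hcard
    rcases k with _ | k
    · have hlen := length_le_choose hnd (k := 0) (by simp)
      simp only [List.toFinset_nil, Finset.card_empty, Nat.choose_self] at hlen
      rcases avoid with _ | ⟨A, avoid⟩
      · simp [sampleAvoiding, avoidingSum]
      · obtain rfl : avoid = [] := by
          rcases avoid with _ | ⟨A', avoid⟩
          · rfl
          · simp at hlen
        simp [sampleAvoiding, avoidingSum]
    · obtain rfl : avoid = [] := by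
        rcases avoid with _ | ⟨A, avoid⟩
        · rfl
        · exact absurd (hcard A (by simp)) (by omega)
      have : Finset.powersetCard (k + 1) (∅ : Finset (Fin n)) = ∅ :=
        Finset.powersetCard_eq_empty.2 (by simp)
      simp [sampleAvoiding, avoidingSum, this]
  | cons x L ih =>
    rw [List.nodup_cons] at hL
    have hx : x ∉ L.toFinset := by simpa using hL.1
    rw [List.toFinset_cons] at hnd hcard ⊢
    have hcardL : L.toFinset.card = L.length := List.toFinset_card_of_nodup hL.2
    have hlenle := length_le_choose hnd hcard
    rw [Finset.card_insert_of_notMem hx, hcardL] at hlenle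
    have hsplit : avoid.length
        = (avoid.filter (x ∈ ·)).length + (avoid.filter (x ∉ ·)).length := by
      have := List.length_eq_length_filter_add (l := avoid) (fun A => decide (x ∈ A))
      simpa using this
    have hnd2 : ((avoid.filter (x ∉ ·)).map (· ∩ L.toFinset)).Nodup :=
      nodup_map_filter_inter hnd (p := (x ∉ ·)) fun A B hA hB => iff_of_false hA hB
    have hcard2 : ∀ A ∈ avoid.filter (x ∉ ·), (A ∩ L.toFinset).card = k := by
      intro A hA
      rw [List.mem_filter] at hA
      have := hcard A hA.1
      rwa [Finset.inter_insert_of_notMem (by simpa using hA.2)] at this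
    have ih2 := ih φ hL.2 k _ hnd2 hcard2
    have hlen2 := length_le_choose hnd2 hcard2
    rw [hcardL] at hlen2
    have hsum2 : ∀ k, (∑ S ∈ Finset.powersetCard k L.toFinset,
        open Classical in if ∃ A ∈ avoid, A ∩ insert x L.toFinset = S then 0 else φ S)
        = avoidingSum L.toFinset k (avoid.filter (x ∉ ·)) φ := by
      intro k
      refine Finset.sum_congr rfl fun S hS => ?_
      have hxS : x ∉ S := fun h => hx ((Finset.mem_powersetCard.1 hS).1 h)
      congr 1
      simp only [eq_iff_iff]
      constructor
      · rintro ⟨A, hA, hAS⟩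
        have hxA : x ∉ A := fun h => hxS (hAS ▸ by simp [h])
        exact ⟨A, List.mem_filter.2 ⟨hA, by simpa using hxA⟩, by
          rwa [Finset.inter_insert_of_notMem hxA] at hAS⟩
      · rintro ⟨A, hA, hAS⟩
        rw [List.mem_filter] at hA
        exact ⟨A, hA.1, by rwa [Finset.inter_insert_of_notMem (by simpa using hA.2)]⟩
    simp only [sampleAvoiding, ev_bind, ev_charge, ev_toss, if_true, Bool.false_eq_true, if_false,
      ev_pure, List.length_cons]
    rcases k with _ | k
    -- Forbidden sets of size 0 do not contain x, so the coin shows `false` surely.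
    · have hfil : avoid.filter (x ∈ ·) = [] := by
        rw [List.filter_eq_nil_iff]
        intro A hA
        have := hcard A hA
        rw [Finset.card_eq_zero] at this
        simp only [decide_eq_true_eq]
        intro hxA
        have : x ∈ A ∩ insert x L.toFinset := by simp [hxA]
        simp_all
      have h0 : avoidingSum (insert x L.toFinset) 0 avoid φ
          = avoidingSum L.toFinset 0 (avoid.filter (x ∉ ·)) φ := by
        rw [← hsum2 0]
        simp [avoidingSum]
      rw [h0, ← ih2]
      rw [hfil, List.length_nil, zero_add] at hsplit
      simp [hfil, clip, hsplit]
    · have hnd1 : ((avoid.filter (x ∈ ·)).map (· ∩ L.toFinset)).Nodup :=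
        nodup_map_filter_inter hnd (p := (x ∈ ·)) fun A B hA hB => iff_of_true hA hB
      have hcard1 : ∀ A ∈ avoid.filter (x ∈ ·), (A ∩ L.toFinset).card = k := by
        intro A hA
        rw [List.mem_filter] at hA
        have := hcard A hA.1
        rw [Finset.inter_insert_of_mem (by simpa using hA.2), Finset.card_insert_of_notMem
          (fun h => hx (Finset.mem_inter.1 h).2)] at this
        omega
      have ih1 := ih (fun S => φ (insert x S)) hL.2 k _ hnd1 hcard1
      have hlen1 := length_le_choose hnd1 hcard1
      rw [hcardL] at hlen1
      have hsum1 : (∑ S ∈ Finset.powersetCard k L.toFinset,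
          open Classical in if ∃ A ∈ avoid, A ∩ insert x L.toFinset = insert x S then 0
            else φ (insert x S))
          = avoidingSum L.toFinset k (avoid.filter (x ∈ ·)) fun S => φ (insert x S) := by
        refine Finset.sum_congr rfl fun S hS => ?_
        have hxS : x ∉ S := fun h => hx ((Finset.mem_powersetCard.1 hS).1 h)
        congr 1
        simp only [eq_iff_iff]
        constructor
        · rintro ⟨A, hA, hAS⟩
          have hxA : x ∈ A := by
            have : x ∈ A ∩ insert x L.toFinset := hAS ▸ Finset.mem_insert_self x S
            exact (Finset.mem_inter.1 this).1
          refine ⟨A, List.mem_filter.2 ⟨hA, by simpa using hxA⟩, ?_⟩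
          rw [Finset.inter_insert_of_mem hxA] at hAS
          rw [← Finset.erase_insert (fun h => hx (Finset.mem_inter.1 h).2), hAS,
            Finset.erase_insert hxS]
        · rintro ⟨A, hA, hAS⟩
          rw [List.mem_filter] at hA
          exact ⟨A, hA.1, by rw [Finset.inter_insert_of_mem (by simpa using hA.2), hAS]⟩
      have hrhs : avoidingSum (insert x L.toFinset) (k + 1) avoid φ
          = avoidingSum L.toFinset k (avoid.filter (x ∈ ·)) (fun S => φ (insert x S))
            + avoidingSum L.toFinset (k + 1) (avoid.filter (x ∉ ·)) φ := by
        rw [← hsum1, ← hsum2 (k + 1)]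
        exact sum_powersetCard_succ_insert hx k _
      rw [hrhs, ← ih1, ← ih2, Nat.add_sub_cancel]
      have hpas : ((L.length + 1).choose (k + 1) : ℝ)
          = (L.length.choose k : ℝ) + (L.length.choose (k + 1) : ℝ) := by
        exact_mod_cast Nat.choose_succ_succ L.length k
      have hsplit' : (avoid.length : ℝ)
          = (avoid.filter (x ∈ ·)).length + (avoid.filter (x ∉ ·)).length := by
        exact_mod_cast hsplit
      -- By Pascal's rule, a and b count the admissible sets with and without x, and the coin has
      -- bias a/(a + b). The multiplied form of the claim also covers a + b = 0.
      set a : ℝ := (L.length.choose k : ℝ) - (avoid.filter (x ∈ ·)).length with ha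
      set b : ℝ := (L.length.choose (k + 1) : ℝ) - (avoid.filter (x ∉ ·)).length with hb
      have ha0 : 0 ≤ a := sub_nonneg.2 (by exact_mod_cast hlen1)
      have hb0 : 0 ≤ b := sub_nonneg.2 (by exact_mod_cast hlen2)
      have e1 : ((L.length + 1).choose (k + 1) : ℝ) - avoid.length = a + b := by
        rw [hpas, hsplit', ha, hb]; ring
      have e2 : ((L.length + 1).choose (k + 1) : ℝ) - (L.length.choose (k + 1) : ℝ)
          - ((avoid.filter (x ∈ ·)).length : ℝ) = a := by
        rw [hpas, ha]; ring
      rw [e1, e2, clip_of_mem (by positivity) (div_le_one_of_le₀ (by linarith) (by linarith))]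
      rcases eq_or_lt_of_le (add_nonneg ha0 hb0) with h | h
      · have ha' : a = 0 := by linarith
        have hb' : b = 0 := by linarith
        simp [ha', hb']
      · field_simp
        ring

/-- The list consists of distinct subsets of `H` of size `t`. -/
def ValidSample (H : Finset (Fin n)) (t : ℕ) (Hs : List (Finset (Fin n))) : Prop :=
  Hs.Nodup ∧ ∀ A ∈ Hs, A ∈ Finset.powersetCard t H

lemma ev_sampleAvoiding_of_valid (φ : Finset (Fin n) → ℝ) {H : Finset (Fin n)} {t : ℕ}
    {Hs : List (Finset (Fin n))} (hv : ValidSample H t Hs) (hlen : Hs.length < H.card.choose t) :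
    ev g M φ (sampleAvoiding (elems H) t Hs) = ((H.card.choose t : ℝ) - Hs.length)⁻¹
      * ∑ S ∈ (Finset.powersetCard t H).filter (· ∉ Hs), φ S := by
  have hinter : ∀ A ∈ Hs, A ∩ H = A := fun A hA =>
    Finset.inter_eq_left.2 (Finset.mem_powersetCard.1 (hv.2 A hA)).1
  have hmap : Hs.map (· ∩ H) = Hs := by
    conv_rhs => rw [← List.map_id Hs]
    exact List.map_congr_left hinter
  have h := choose_sub_mul_ev_sampleAvoiding (g := g) (M := M) φ (elems H) (nodup_elems H) t Hs
    (by rw [toFinset_elems, hmap]; exact hv.1) (fun A hA => by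
      rw [toFinset_elems, hinter A hA]; exact (Finset.mem_powersetCard.1 (hv.2 A hA)).2)
  rw [length_elems, toFinset_elems] at h
  have hpos : (0 : ℝ) < (H.card.choose t : ℝ) - Hs.length := sub_pos.2 (by exact_mod_cast hlen)
  have hs : avoidingSum H t Hs φ = ∑ S ∈ (Finset.powersetCard t H).filter (· ∉ Hs), φ S := by
    rw [Finset.sum_filter, avoidingSum]
    refine Finset.sum_congr rfl fun S _ => ?_
    by_cases hS : S ∈ Hs
    · rw [if_pos ⟨S, hS, hinter S hS⟩, if_neg (not_not.2 hS)]
    · rw [if_neg, if_pos hS]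
      rintro ⟨A, hA, rfl⟩
      rw [hinter A hA] at hS
      exact hS hA
  rw [← hs, ← h, inv_mul_cancel_left₀ hpos.ne']

lemma ValidSample.cons {H : Finset (Fin n)} {t : ℕ} {Hs : List (Finset (Fin n))}
    (hv : ValidSample H t Hs) {S : Finset (Fin n)}
    (hS : S ∈ (Finset.powersetCard t H).filter (· ∉ Hs)) : ValidSample H t (S :: Hs) := by
  rw [Finset.mem_filter] at hS
  refine ⟨List.nodup_cons.2 ⟨hS.2, hv.1⟩, fun A hA => ?_⟩
  rcases List.mem_cons.1 hA with rfl | hA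
  · exact hS.1
  · exact hv.2 A hA

/-- Expectations over samples without replacement only see valid samples. -/
lemma ev_sampleDistinct_mono {H : Finset (Fin n)} {t m : ℕ} (hm : m ≤ H.card.choose t)
    {φ ψ : List (Finset (Fin n)) → ℝ}
    (h : ∀ Hs, ValidSample H t Hs → Hs.length = m → φ Hs ≤ ψ Hs) :
    ev g M φ (sampleDistinct H t m) ≤ ev g M ψ (sampleDistinct H t m) := by
  unfold sampleDistinct
  have key : ∀ (k : ℕ) (Hs : List (Finset (Fin n))), ValidSample H t Hs → Hs.length + k = m →
      ev g M φ (loop (fun Hs => do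
        charge (n + 1)
        let H' ← sampleAvoiding (elems H) t Hs
        pure (H' :: Hs)) k Hs) ≤ ev g M ψ (loop (fun Hs => do
        charge (n + 1)
        let H' ← sampleAvoiding (elems H) t Hs
        pure (H' :: Hs)) k Hs) := by
    intro k
    induction k with
    | zero => exact fun Hs hv hl => h Hs hv (by omega)
    | succ k ih =>
      intro Hs hv hl
      have hlt : Hs.length < H.card.choose t := by omega
      rw [ev_loop_succ, ev_loop_succ]
      simp only [ev_bind, ev_charge, ev_pure]
      rw [ev_sampleAvoiding_of_valid _ hv hlt, ev_sampleAvoiding_of_valid _ hv hlt]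
      have hpos : (0 : ℝ) < (H.card.choose t : ℝ) - Hs.length := sub_pos.2 (by exact_mod_cast hlt)
      refine mul_le_mul_of_nonneg_left (Finset.sum_le_sum fun S hS => ?_) (inv_nonneg.2 hpos.le)
      exact ih _ (hv.cons hS) (by rw [List.length_cons]; omega)
  exact key m [] ⟨List.nodup_nil, by simp⟩ (by simp)

/-- Exponential moments of samples without replacement. -/
lemma ev_sampleDistinct_exp_le {H : Finset (Fin n)} {t m : ℕ} (hm : m < H.card.choose t)
    (w : Finset (Fin n) → ℝ) :
    ev g M (fun Hs => Real.exp (Hs.map w).sum) (sampleDistinct H t m)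
      ≤ (((H.card.choose t : ℝ) - m)⁻¹
        * ∑ S ∈ Finset.powersetCard t H, Real.exp (w S)) ^ m := by
  unfold sampleDistinct
  set A : ℝ := ((H.card.choose t : ℝ) - m)⁻¹
    * ∑ S ∈ Finset.powersetCard t H, Real.exp (w S) with hA
  have hpos : (0 : ℝ) < (H.card.choose t : ℝ) - m := sub_pos.2 (by exact_mod_cast hm)
  have hs0 : 0 ≤ ∑ S ∈ Finset.powersetCard t H, Real.exp (w S) :=
    Finset.sum_nonneg fun _ _ => (Real.exp_pos _).le
  have hA0 : 0 ≤ A := mul_nonneg (inv_nonneg.2 hpos.le) hs0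
  have key : ∀ (k : ℕ) (Hs : List (Finset (Fin n))), ValidSample H t Hs → Hs.length + k = m →
      ev g M (fun Hs => Real.exp (Hs.map w).sum) (loop (fun Hs => do
        charge (n + 1)
        let H' ← sampleAvoiding (elems H) t Hs
        pure (H' :: Hs)) k Hs) ≤ Real.exp (Hs.map w).sum * A ^ k := by
    intro k
    induction k with
    | zero => intro Hs _ _; simp [ev_loop_zero]
    | succ k ih =>
      intro Hs hv hl
      have hlt : Hs.length < H.card.choose t := by omega
      rw [ev_loop_succ]
      simp only [ev_bind, ev_charge, ev_pure]
      rw [ev_sampleAvoiding_of_valid _ hv hlt]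
      have hle : (H.card.choose t : ℝ) - m ≤ (H.card.choose t : ℝ) - Hs.length := by
        have : (Hs.length : ℝ) ≤ m := by exact_mod_cast (by omega : Hs.length ≤ m)
        linarith
      -- The next set is uniform among more than C - m unused ones. Enlarging the sum to all
      -- t-subsets and shrinking the denominator to C - m gives a factor that does not depend on the
      -- sets already drawn.
      have h1 : ∑ S ∈ (Finset.powersetCard t H).filter (· ∉ Hs),
          ev g M (fun Hs => Real.exp (Hs.map w).sum) (loop (fun Hs => do
            charge (n + 1)
            let H' ← sampleAvoiding (elems H) t Hs
            pure (H' :: Hs)) k (S :: Hs))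
          ≤ (Real.exp (Hs.map w).sum * A ^ k)
            * ∑ S ∈ Finset.powersetCard t H, Real.exp (w S) := by
        rw [Finset.mul_sum]
        refine (Finset.sum_le_sum fun S hS => ?_).trans
          (Finset.sum_le_sum_of_subset_of_nonneg (Finset.filter_subset _ _) fun S _ _ =>
            mul_nonneg (mul_nonneg (Real.exp_pos _).le (pow_nonneg hA0 k)) (Real.exp_pos _).le)
        refine (ih (S :: Hs) (hv.cons hS) (by rw [List.length_cons]; omega)).trans (le_of_eq ?_)
        rw [List.map_cons, List.sum_cons, Real.exp_add]
        ring
      have h0 : 0 ≤ (Real.exp (Hs.map w).sum * A ^ k)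
          * ∑ S ∈ Finset.powersetCard t H, Real.exp (w S) :=
        mul_nonneg (mul_nonneg (Real.exp_pos _).le (pow_nonneg hA0 k)) hs0
      calc _ ≤ ((H.card.choose t : ℝ) - m)⁻¹ * ((Real.exp (Hs.map w).sum * A ^ k)
            * ∑ S ∈ Finset.powersetCard t H, Real.exp (w S)) :=
            (mul_le_mul_of_nonneg_left h1 (inv_nonneg.2 (hpos.le.trans hle))).trans
              (mul_le_mul_of_nonneg_right (inv_anti₀ hpos hle) h0)
        _ = _ := by rw [pow_succ, hA]; ring
  have := key m [] ⟨List.nodup_nil, by simp⟩ (by simp)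
  simpa using this

lemma oblivious_sampleAvoiding (L : List (Fin n)) (k : ℕ) (avoid : List (Finset (Fin n))) :
    Oblivious M (sampleAvoiding L k avoid) := by
  induction L generalizing k avoid with
  | nil => exact oblivious_pure _
  | cons x L ih =>
    refine oblivious_bind (oblivious_charge _) fun _ => oblivious_bind (oblivious_toss _) fun b => ?_
    cases b
    · exact ih k _
    · exact oblivious_bind (ih (k - 1) _) fun _ => oblivious_pure _

lemma oblivious_sampleDistinct (H : Finset (Fin n)) (t m : ℕ) :
    Oblivious M (sampleDistinct H t m) :=
  oblivious_loop (fun _ => oblivious_bind (oblivious_charge _) fun _ =>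
    oblivious_bind (oblivious_sampleAvoiding _ _ _) fun _ => oblivious_pure _) _ _

/-! ### Averages over subsets of fixed size -/

/-- Double counting of the pairs of a (k + 1)-set and one of its elements. -/
lemma sum_powersetCard_sum_insert {α : Type*} [DecidableEq α] (B : Finset α) (k : ℕ)
    (G : Finset α → ℝ) :
    ∑ S ∈ Finset.powersetCard k B, ∑ b ∈ B \ S, G (insert b S)
      = (k + 1) * ∑ T ∈ Finset.powersetCard (k + 1) B, G T := by
  have h : (k + 1) * ∑ T ∈ Finset.powersetCard (k + 1) B, G T
      = ∑ T ∈ Finset.powersetCard (k + 1) B, ∑ _b ∈ T, G T := by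
    rw [Finset.mul_sum]
    refine Finset.sum_congr rfl fun T hT => ?_
    rw [Finset.sum_const, (Finset.mem_powersetCard.1 hT).2, nsmul_eq_mul]
    push_cast
    ring
  rw [h, Finset.sum_sigma', Finset.sum_sigma']
  refine Finset.sum_bij' (fun p _ => ⟨insert p.2 p.1, p.2⟩) (fun p _ => ⟨p.1.erase p.2, p.2⟩)
    ?_ ?_ ?_ ?_ ?_
  · rintro ⟨S, b⟩ hp
    simp only [Finset.mem_sigma, Finset.mem_powersetCard, Finset.mem_sdiff] at hp ⊢
    exact ⟨⟨Finset.insert_subset hp.2.1 hp.1.1, by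
      rw [Finset.card_insert_of_notMem hp.2.2, hp.1.2]⟩, Finset.mem_insert_self _ _⟩
  · rintro ⟨T, b⟩ hp
    simp only [Finset.mem_sigma, Finset.mem_powersetCard, Finset.mem_sdiff] at hp ⊢
    exact ⟨⟨(Finset.erase_subset _ _).trans hp.1.1, by
      rw [Finset.card_erase_of_mem hp.2, hp.1.2]; rfl⟩, hp.1.1 hp.2, Finset.notMem_erase _ _⟩
  · rintro ⟨S, b⟩ hp
    simp only [Finset.mem_sigma, Finset.mem_sdiff] at hp
    simp [Finset.erase_insert hp.2.2]
  · rintro ⟨T, b⟩ hp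
    simp only [Finset.mem_sigma] at hp
    simp [Finset.insert_erase hp.2]
  · rintro ⟨S, b⟩ _
    rfl

/-- If, on average, adding one element loses at most a fraction of one over the number of the
remaining elements, then the average over the `k`-subsets of `B` loses at most
a fraction of `k / |B|`. -/
lemma average_powersetCard_ge {α : Type*} [DecidableEq α] {B : Finset α} {G : Finset α → ℝ}
    (hG : ∀ S ⊆ B, ((B.card : ℝ) - S.card - 1) * G S ≤ ∑ b ∈ B \ S, G (insert b S))
    {k : ℕ} (hk : k ≤ B.card) :
    (1 - k / B.card) * G ∅
      ≤ (B.card.choose k : ℝ)⁻¹ * ∑ S ∈ Finset.powersetCard k B, G S := by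
  -- With r = |B|, the average over (k + 1)-sets is at least (r - k - 1)/(r - k) times the average
  -- over k-sets; the product of these factors telescopes to 1 - k/r.
  have key : ((B.card.choose k : ℕ) : ℝ) * ((1 - k / B.card) * G ∅)
      ≤ ∑ S ∈ Finset.powersetCard k B, G S := by
    induction k with
    | zero => simp
    | succ k ih =>
      have hr : (0 : ℝ) < B.card := by exact_mod_cast (by omega : 0 < B.card)
      have hkr : (k : ℝ) + 1 ≤ B.card := by exact_mod_cast hk
      have h1 := sum_powersetCard_sum_insert B k G
      have h2 : ((B.card : ℝ) - k - 1) * ∑ S ∈ Finset.powersetCard k B, G S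
          ≤ ∑ S ∈ Finset.powersetCard k B, ∑ b ∈ B \ S, G (insert b S) := by
        rw [Finset.mul_sum]
        refine Finset.sum_le_sum fun S hS => ?_
        rw [Finset.mem_powersetCard] at hS
        have := hG S hS.1
        rwa [hS.2] at this
      have h3 := mul_le_mul_of_nonneg_left (ih (by omega))
        (show (0 : ℝ) ≤ (B.card : ℝ) - k - 1 by linarith)
      have h4 : ((B.card.choose (k + 1) : ℕ) : ℝ) * ((k : ℝ) + 1)
          = (B.card.choose k : ℕ) * ((B.card : ℝ) - k) := by
        have := Nat.choose_succ_right_eq B.card k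
        rw [← Nat.cast_sub (by omega)]
        exact_mod_cast this
      have hk1 : (0 : ℝ) < (k : ℝ) + 1 := by positivity
      refine le_of_mul_le_mul_left ?_ hk1
      have h5 : ((k : ℝ) + 1) * (((B.card.choose (k + 1) : ℕ) : ℝ)
          * ((1 - ((k + 1 : ℕ) : ℝ) / B.card) * G ∅))
          = ((B.card : ℝ) - k - 1) * (((B.card.choose k : ℕ) : ℝ) * ((1 - k / B.card) * G ∅)) := by
        calc _ = (((B.card.choose (k + 1) : ℕ) : ℝ) * ((k : ℝ) + 1))
              * ((1 - ((k + 1 : ℕ) : ℝ) / B.card) * G ∅) := by ring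
          _ = _ := by
            rw [h4]
            push_cast
            field_simp
            ring
      linarith
  have hc : (0 : ℝ) < B.card.choose k := by exact_mod_cast Nat.choose_pos hk
  rw [le_inv_mul_iff₀ hc]
  exact key

/-! ### The surrogate function -/

/-- The average of `f (S ∪ H')` over the subsets `H'` of `H` of size `t`. -/
def surrogate (f : Finset (Fin n) → ℝ) (H : Finset (Fin n)) (t : ℕ) (S : Finset (Fin n)) : ℝ :=
  (H.card.choose t : ℝ)⁻¹ * ∑ H' ∈ Finset.powersetCard t H, f (S ∪ H')

variable {f : Finset (Fin n) → ℝ}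

lemma isSubmodular_surrogate (hf : IsSubmodular f) (H : Finset (Fin n)) (t : ℕ) :
    IsSubmodular (surrogate f H t) :=
  (IsSubmodular.sum fun H' _ => hf.union_right H').const_mul (by positivity)

lemma surrogate_nonneg (hf0 : ∀ S, 0 ≤ f S) (H : Finset (Fin n)) (t : ℕ)
    (S : Finset (Fin n)) : 0 ≤ surrogate f H t S :=
  mul_nonneg (by positivity) (Finset.sum_nonneg fun _ _ => hf0 _)

lemma surrogate_le {H : Finset (Fin n)} {t : ℕ} (ht : t ≤ H.card) {S : Finset (Fin n)} {b : ℝ}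
    (hb : ∀ H' ∈ Finset.powersetCard t H, f (S ∪ H') ≤ b) : surrogate f H t S ≤ b := by
  have hc : (0 : ℝ) < H.card.choose t := by exact_mod_cast Nat.choose_pos ht
  rw [surrogate, inv_mul_le_iff₀ hc]
  refine (Finset.sum_le_card_nsmul _ _ b hb).trans (le_of_eq ?_)
  rw [Finset.card_powersetCard, nsmul_eq_mul]

/-- Adding elements may destroy value, but the marginals of all remaining elements of `H` sum to at
least minus the current value, since f stays nonnegative after adding them all. This is the
hypothesis of `average_powersetCard_ge`. -/
lemma le_surrogate (hf : IsSubmodular f) (hf0 : ∀ S, 0 ≤ f S) {H : Finset (Fin n)} {t : ℕ}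
    (ht : t ≤ H.card) (S : Finset (Fin n)) :
    (1 - t / H.card) * f S ≤ surrogate f H t S := by
  have := average_powersetCard_ge (B := H) (G := fun H' => f (S ∪ H')) (fun H' hH' => ?_) ht
  · simpa [surrogate] using this
  · have h1 := hf.union_sub_le_sum (S ∪ H') (H \ H')
    rw [Finset.sum_sub_distrib, Finset.sum_const, nsmul_eq_mul,
      Finset.card_sdiff_of_subset hH', Nat.cast_sub (Finset.card_le_card hH')] at h1
    simp only [Finset.union_insert]
    have := hf0 (S ∪ H' ∪ H \ H')
    linarith

/-! ### The optimum after contraction -/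

/-- When Q is removed one element at a time, each removal costs at least as much as it would from
the full set S. -/
lemma sum_sub_erase_le (hf : IsSubmodular f) (S Q : Finset (Fin n)) (hQ : Q ⊆ S) :
    ∑ o ∈ Q, (f S - f (S.erase o)) ≤ f S - f (S \ Q) := by
  induction Q using Finset.induction_on with
  | empty => simp
  | insert o Q ho ih =>
    have hoS : o ∈ S := hQ (Finset.mem_insert_self _ _)
    have ih' := ih ((Finset.subset_insert _ _).trans hQ)
    rw [Finset.sum_insert ho]
    have h1 := hf (S \ insert o Q) (S.erase o) (fun a ha => by
      simp only [Finset.mem_sdiff, Finset.mem_insert, not_or] at ha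
      exact Finset.mem_erase.2 ⟨ha.2.1, ha.1⟩) o (Finset.notMem_erase _ _)
    have h2 : insert o (S \ insert o Q) = S \ Q := by
      ext a
      simp only [Finset.mem_insert, Finset.mem_sdiff, not_or]
      constructor
      · rintro (rfl | h)
        · exact ⟨hoS, ho⟩
        · exact ⟨h.1, h.2.2⟩
      · intro h
        by_cases hao : a = o
        · exact Or.inl hao
        · exact Or.inr ⟨h.1, hao, h.2⟩
    rw [Finset.insert_erase hoS, h2] at h1
    linarith

/-- Distinct removals cost at most f(S) in total, as what is left has nonnegative value. Values of φ
outside S are harmless: erasing them changes nothing. -/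
lemma sum_erase_ge (hf : IsSubmodular f) (hf0 : ∀ S, 0 ≤ f S) (S D : Finset (Fin n))
    {φ : Fin n → Fin n} (hφ : Set.InjOn φ D) :
    ((D.card : ℝ) - 1) * f S ≤ ∑ b ∈ D, f (S.erase (φ b)) := by
  have h1 : ∑ b ∈ D, (f S - f (S.erase (φ b))) = ∑ o ∈ D.image φ, (f S - f (S.erase o)) :=
    (Finset.sum_image (f := fun o => f S - f (S.erase o)) hφ).symm
  have h2 : ∑ o ∈ D.image φ, (f S - f (S.erase o))
      = ∑ o ∈ D.image φ ∩ S, (f S - f (S.erase o)) := by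
    refine (Finset.sum_subset Finset.inter_subset_left fun o ho ho' => ?_).symm
    rw [Finset.erase_eq_of_notMem fun h => ho' (Finset.mem_inter.2 ⟨ho, h⟩), sub_self]
  have h3 := sum_sub_erase_le hf S (D.image φ ∩ S) Finset.inter_subset_right
  have h4 := hf0 (S \ (D.image φ ∩ S))
  rw [Finset.sum_sub_distrib, Finset.sum_const, nsmul_eq_mul] at h1
  linarith

/-- On average over the subsets `H` of size `h` of a base `B`, contracting `H` loses at most a
fraction of `h / |B|` of the optimum. -/
lemma exists_contracted_optimum (hM : M.E = Set.univ) (hf : IsSubmodular f)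
    (hf0 : ∀ S, 0 ≤ f S) {B O : Finset (Fin n)} (hB : M.IsBase (B : Set (Fin n)))
    (hO : M.Indep (O : Set (Fin n))) {h : ℕ} (hh : h ≤ B.card) :
    ∃ opt : Finset (Fin n) → Finset (Fin n),
      (∀ H ⊆ B, Disjoint (opt H) H ∧ M.Indep ((opt H ∪ H : Finset (Fin n)) : Set (Fin n))) ∧
      (1 - h / B.card) * f O
        ≤ (B.card.choose h : ℝ)⁻¹ * ∑ H ∈ Finset.powersetCard h B, f (opt H) := by
  classical
  let cand : Finset (Fin n) → Finset (Finset (Fin n)) := fun H =>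
    Finset.univ.filter fun S =>
      Disjoint S H ∧ M.Indep ((S ∪ H : Finset (Fin n)) : Set (Fin n))
  have hcand : ∀ H ⊆ B, (cand H).Nonempty := fun H hH => ⟨∅, by
    simp only [cand, Finset.mem_filter, Finset.mem_univ, true_and]
    exact ⟨Finset.disjoint_empty_left _, hB.indep.subset (by simpa using hH)⟩⟩
  have hex : ∀ H, ∃ S, H ⊆ B → S ∈ cand H ∧ ∀ T ∈ cand H, f T ≤ f S := by
    intro H
    by_cases hH : H ⊆ B
    · obtain ⟨S, hS, hmax⟩ := Finset.exists_max_image (cand H) f (hcand H hH)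
      exact ⟨S, fun _ => ⟨hS, hmax⟩⟩
    · exact ⟨∅, fun h => absurd h hH⟩
  choose opt hopt using hex
  have hmem : ∀ H ⊆ B, Disjoint (opt H) H ∧
      M.Indep ((opt H ∪ H : Finset (Fin n)) : Set (Fin n)) := fun H hH => by
    have := (hopt H hH).1
    simpa only [cand, Finset.mem_filter, Finset.mem_univ, true_and] using this
  refine ⟨opt, hmem, ?_⟩
  have hstart : f O ≤ f (opt ∅) := (hopt ∅ (Finset.empty_subset _)).2 O (by
    simp only [cand, Finset.mem_filter, Finset.mem_univ, true_and]
    exact ⟨Finset.disjoint_empty_right _, by simpa using hO⟩)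
  have hfrac : (0 : ℝ) ≤ 1 - h / B.card :=
    sub_nonneg.2 (div_le_one_of_le₀ (by exact_mod_cast hh) (Nat.cast_nonneg _))
  refine (mul_le_mul_of_nonneg_left hstart hfrac).trans
    (average_powersetCard_ge (G := fun H => f (opt H)) (fun H hH => ?_) hh)
  obtain ⟨hdisj, hind⟩ := hmem H hH
  -- Complete opt(H) ∪ H to a base T ∪ H. Each b in B \ H has its own partner φ(b) in T, and opt(H)
  -- without φ(b) is a candidate for H + b.
  obtain ⟨B', hB', hsub⟩ := hind.exists_isBase_superset
  set T : Finset (Fin n) := B'.toFinset \ H with hT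
  have hHB' : H ⊆ B'.toFinset := fun a ha => by
    rw [Set.mem_toFinset]
    exact hsub (by simp [ha])
  have hTH : T ∪ H = B'.toFinset := Finset.sdiff_union_of_subset hHB'
  have hoptT : opt H ⊆ T := fun a ha => by
    rw [hT, Finset.mem_sdiff, Set.mem_toFinset]
    exact ⟨hsub (by simp [ha]), fun h => Finset.disjoint_left.1 hdisj ha h⟩
  obtain ⟨φ, hinj, hφ⟩ := exists_exchange_matching hM (T := T) hB.indep hH
    (by rw [hTH, Set.coe_toFinset]; exact hB') Finset.sdiff_disjoint
  have h1 := sum_erase_ge hf hf0 (opt H) (B \ H) hinj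
  rw [Finset.card_sdiff_of_subset hH, Nat.cast_sub (Finset.card_le_card hH)] at h1
  refine h1.trans (Finset.sum_le_sum fun b hb => ?_)
  obtain ⟨-, hi, hd⟩ := hφ b hb
  have hers : (opt H).erase (φ b) ⊆ T.erase (φ b) := Finset.erase_subset_erase _ hoptT
  refine (hopt (insert b H) (Finset.insert_subset (Finset.mem_sdiff.1 hb).1 hH)).2 _ ?_
  simp only [cand, Finset.mem_filter, Finset.mem_univ, true_and]
  exact ⟨hd.mono_left hers,
    hi.subset (by exact_mod_cast Finset.union_subset_union_left hers)⟩

end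

section

open Alg

variable {n : ℕ} {g : Finset (Fin n) → ℝ} {M : Matroid (Fin n)} {f : Finset (Fin n) → ℝ}

/-! ### Concentration of the sampled noisy surrogate -/

/-- A two-sided exponential potential. -/
def pot (l a X : ℝ) : ℝ := Real.exp (l * X - l * a) + Real.exp (-l * X - l * a)

lemma pot_nonneg (l a X : ℝ) : 0 ≤ pot l a X := by unfold pot; positivity

/-- Chernoff's argument without events: where |X| ≥ a, one of the two exponentials is at least 1.
The mean of the potential can then stand in for a failure probability. -/
lemma abs_lt_of_pot_lt_one {l a X : ℝ} (hl : 0 < l) (h : pot l a X < 1) : |X| < a := by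
  have h1 : Real.exp (l * X - l * a) < 1 := by
    have := Real.exp_pos (-l * X - l * a)
    unfold pot at h
    linarith
  have h2 : Real.exp (-l * X - l * a) < 1 := by
    have := Real.exp_pos (l * X - l * a)
    unfold pot at h
    linarith
  rw [Real.exp_lt_one_iff] at h1 h2
  rw [abs_lt]
  constructor <;> nlinarith

/-- The exponential moment of a centred, bounded, finite family of numbers. -/
lemma sum_exp_le_of_centred {ι : Type*} (s : Finset ι) (y : ι → ℝ) {R : ℝ} (hR : 0 < R)
    (hy : ∀ i ∈ s, |y i| ≤ R) (hsum : ∑ i ∈ s, y i = 0) (l : ℝ) :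
    ∑ i ∈ s, Real.exp (l * y i) ≤ s.card * Real.exp ((l * R) ^ 2 / 2) := by
  -- Hoeffding's argument: on [-R, R] the convex exponential lies below its chord. The linear term
  -- cancels because the family is centred, and cosh z ≤ exp(z²/2).
  have hpt : ∀ i ∈ s, Real.exp (l * y i)
      ≤ Real.cosh (l * R) + Real.sinh (l * R) / R * y i := by
    intro i hi
    have hyi := abs_le.1 (hy i hi)
    have h : Real.exp (((R + y i) / (2 * R)) • (l * R) + ((R - y i) / (2 * R)) • -(l * R))
        ≤ ((R + y i) / (2 * R)) • Real.exp (l * R)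
          + ((R - y i) / (2 * R)) • Real.exp (-(l * R)) :=
      convexOn_exp.2 (Set.mem_univ _) (Set.mem_univ _) (div_nonneg (by linarith) (by linarith))
        (div_nonneg (by linarith) (by linarith))
      (by field_simp; ring)
    simp only [smul_eq_mul] at h
    have e1 : (R + y i) / (2 * R) * (l * R) + (R - y i) / (2 * R) * -(l * R) = l * y i := by
      field_simp; ring
    rw [e1] at h
    refine h.trans (le_of_eq ?_)
    rw [Real.cosh_eq, Real.sinh_eq]
    field_simp
    ring
  calc ∑ i ∈ s, Real.exp (l * y i)
      ≤ ∑ i ∈ s, (Real.cosh (l * R) + Real.sinh (l * R) / R * y i) := Finset.sum_le_sum hpt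
    _ = s.card * Real.cosh (l * R) := by
      rw [Finset.sum_add_distrib, ← Finset.mul_sum, hsum, Finset.sum_const, nsmul_eq_mul]
      ring
    _ ≤ _ := mul_le_mul_of_nonneg_left (Real.cosh_le_exp_half_sq _) (Nat.cast_nonneg _)

/-- The deviation of the sampled surrogate from its mean, times the number of samples. -/
def sampleDev (f : Finset (Fin n) → ℝ) (H : Finset (Fin n)) (t : ℕ) (S : Finset (Fin n))
    (Hs : List (Finset (Fin n))) : ℝ :=
  (Hs.map fun H' => f (S ∪ H') - surrogate f H t S).sum

/-- The contribution of the noise to the sampled surrogate, times the number of samples. -/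
def noiseDev {Ω : Type*} (ξ : Finset (Fin n) → Ω → ℝ) (f : Finset (Fin n) → ℝ)
    (S : Finset (Fin n)) (Hs : List (Finset (Fin n))) (ω : Ω) : ℝ :=
  (Hs.map fun H' => (ξ (S ∪ H') ω - 1) * f (S ∪ H')).sum

/-- The price of sampling without replacement: C/(C - m) = 1 + m/(C - m), whose m-th power is at
most exp(m²/(C - m)), and m² ≤ C - m. -/
lemma ratio_pow_le_exp_one {C : ℝ} {m : ℕ} (hC : (m : ℝ) ^ 2 + m < C) :
    ((C - m)⁻¹ * C) ^ m ≤ Real.exp 1 := by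
  have hpos : 0 < C - m := by nlinarith [sq_nonneg (m : ℝ)]
  have h1 : (C - m)⁻¹ * C = m / (C - m) + 1 := by field_simp; ring
  rw [h1]
  calc (m / (C - m) + 1) ^ m ≤ Real.exp (m / (C - m)) ^ m :=
        pow_le_pow_left₀ (by positivity) (Real.add_one_le_exp _) m
    _ = Real.exp (m * (m / (C - m))) := (Real.exp_nat_mul _ m).symm
    _ ≤ Real.exp 1 := by
      rw [Real.exp_le_exp, mul_div_assoc', div_le_one hpos]
      nlinarith

/-- Both f(S ∪ H') and its mean lie in [0, R], so the centred values are bounded by R and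
Hoeffding's estimate holds up to the factor e. -/
lemma ev_exp_sampleDev_le {H S : Finset (Fin n)} {t m : ℕ}
    (hC : (m : ℝ) ^ 2 + m < (H.card.choose t : ℝ)) {R : ℝ} (hR : 0 < R)
    (hf : ∀ H' ∈ Finset.powersetCard t H, 0 ≤ f (S ∪ H') ∧ f (S ∪ H') ≤ R) (l : ℝ) :
    ev g M (fun Hs => Real.exp (l * sampleDev f H t S Hs)) (sampleDistinct H t m)
      ≤ Real.exp 1 * Real.exp (m * ((l * R) ^ 2 / 2)) := by
  set C : ℝ := (H.card.choose t : ℝ) with hCdef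
  have hm0 : (0 : ℝ) ≤ m := Nat.cast_nonneg m
  have hC0 : 0 < C := by nlinarith
  have hmC : m < H.card.choose t := by
    have : (m : ℝ) < (H.card.choose t : ℝ) := by nlinarith
    exact_mod_cast this
  have ht : t ≤ H.card := by
    by_contra h
    rw [Nat.choose_eq_zero_of_lt (not_le.1 h)] at hmC
    omega
  have hF1 : surrogate f H t S ≤ R := surrogate_le ht fun H' hH' => (hf H' hH').2
  have hF0 : 0 ≤ surrogate f H t S :=
    mul_nonneg (by positivity) (Finset.sum_nonneg fun H' hH' => (hf H' hH').1)
  have hcard : ((Finset.powersetCard t H).card : ℝ) = C := by rw [Finset.card_powersetCard]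
  have hsum : ∑ H' ∈ Finset.powersetCard t H, (f (S ∪ H') - surrogate f H t S) = 0 := by
    rw [Finset.sum_sub_distrib, Finset.sum_const, nsmul_eq_mul, hcard, surrogate,
      mul_inv_cancel_left₀ hC0.ne', sub_self]
  have hexp := sum_exp_le_of_centred (Finset.powersetCard t H)
    (fun H' => f (S ∪ H') - surrogate f H t S) hR (fun H' hH' => by
      have := hf H' hH'
      rw [abs_le]
      constructor <;> linarith) hsum l
  rw [hcard] at hexp
  have hev := ev_sampleDistinct_exp_le (g := g) (M := M) hmC
    fun H' => l * (f (S ∪ H') - surrogate f H t S)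
  have hpos : 0 < C - m := by nlinarith
  simp only [List.sum_map_mul_left] at hev
  refine hev.trans ?_
  calc ((C - m)⁻¹ * ∑ S_1 ∈ Finset.powersetCard t H,
        Real.exp (l * (f (S ∪ S_1) - surrogate f H t S))) ^ m
      ≤ ((C - m)⁻¹ * C * Real.exp ((l * R) ^ 2 / 2)) ^ m := by
        refine pow_le_pow_left₀ (mul_nonneg (inv_nonneg.2 hpos.le)
          (Finset.sum_nonneg fun _ _ => (Real.exp_pos _).le)) ?_ m
        rw [mul_assoc]
        exact mul_le_mul_of_nonneg_left hexp (inv_nonneg.2 hpos.le)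
    _ = ((C - m)⁻¹ * C) ^ m * Real.exp (m * ((l * R) ^ 2 / 2)) := by
        rw [mul_pow, Real.exp_nat_mul]
    _ ≤ _ := mul_le_mul_of_nonneg_right (ratio_pow_le_exp_one hC) (Real.exp_pos _).le

/-- Sampling without replacement concentrates. -/
lemma ev_pot_sampleDev_le {H S : Finset (Fin n)} {t m : ℕ}
    (hC : (m : ℝ) ^ 2 + m < (H.card.choose t : ℝ)) {R σ : ℝ} (hR : 0 < R)
    (hf : ∀ H' ∈ Finset.powersetCard t H, 0 ≤ f (S ∪ H') ∧ f (S ∪ H') ≤ R) :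
    ev g M (fun Hs => pot (σ / R) (m * (σ * R)) (sampleDev f H t S Hs)) (sampleDistinct H t m)
      ≤ 2 * Real.exp 1 * Real.exp (-(m * σ ^ 2 / 2)) := by
  -- For l = ±σ/R the exponent is mσ²/2 - mσ² = -mσ²/2.
  have hone : ∀ l : ℝ, (l * R) ^ 2 = σ ^ 2 →
      ev g M (fun Hs => Real.exp (l * sampleDev f H t S Hs - σ / R * (m * (σ * R))))
        (sampleDistinct H t m) ≤ Real.exp 1 * Real.exp (-(m * σ ^ 2 / 2)) := by
    intro l hl
    have h1 : (fun Hs => Real.exp (l * sampleDev f H t S Hs - σ / R * (m * (σ * R))))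
        = fun Hs => Real.exp (-(σ / R * (m * (σ * R)))) * Real.exp (l * sampleDev f H t S Hs) := by
      funext Hs
      rw [← Real.exp_add]
      congr 1
      ring
    rw [h1, ev_const_mul]
    have h2 := mul_le_mul_of_nonneg_left (ev_exp_sampleDev_le (g := g) (M := M) hC hR hf l)
      (Real.exp_pos (-(σ / R * (m * (σ * R))))).le
    refine h2.trans (le_of_eq ?_)
    rw [hl, ← Real.exp_add, ← Real.exp_add, ← Real.exp_add]
    congr 1
    field_simp
    ring
  simp only [pot]
  rw [ev_add]
  have h1 := hone (σ / R) (by field_simp)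
  have h2 := hone (-(σ / R)) (by field_simp)
  linarith

section Noise

variable {Ω : Type*} [MeasurableSpace Ω] {P : Measure Ω} [IsProbabilityMeasure P]
  {ξ : Finset (Fin n) → Ω → ℝ} {D : Measure ℝ} {ν α : ℝ}

/-- Exponential moments of linear combinations of the noise. -/
lemma IsNoise.exp_sum (hξ : IsNoise P ξ D ν α) (𝒯 : Finset (Finset (Fin n)))
    (c : Finset (Fin n) → ℝ) (hc : ∀ T ∈ 𝒯, α * |c T| ≤ 1) :
    Integrable (fun ω => Real.exp (∑ T ∈ 𝒯, c T * (ξ T ω - 1))) P ∧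
      ∫ ω, Real.exp (∑ T ∈ 𝒯, c T * (ξ T ω - 1)) ∂P
        ≤ Real.exp (∑ T ∈ 𝒯, ν ^ 2 * c T ^ 2 / 2) := by
  set X : Finset (Fin n) → Ω → ℝ := fun T ω => c T * (ξ T ω - 1) with hX
  have hmeas : ∀ T, AEMeasurable (X T) P := fun T =>
    (((hξ.hasLaw T).aemeasurable.sub_const 1).const_mul (c T))
  have hindep : iIndepFun X P :=
    hξ.indep.comp (fun T x => c T * (x - 1)) fun T => by fun_prop
  have hone : ∀ T ∈ 𝒯, Integrable (fun ω => Real.exp (1 * X T ω)) P ∧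
      mgf (X T) P 1 ≤ Real.exp (ν ^ 2 * c T ^ 2 / 2) := by
    intro T hT
    obtain ⟨hInt, hle⟩ := hξ.subexponential (c T) (hc T hT)
    rw [hξ.mean_one] at hInt hle
    have hlaw := hξ.hasLaw T
    have hsm : AEStronglyMeasurable (fun x => Real.exp (c T * (x - 1))) (P.map (ξ T)) := by
      fun_prop
    constructor
    · simp only [one_mul, hX]
      rw [← hlaw.map_eq] at hInt
      exact hInt.comp_aemeasurable hlaw.aemeasurable
    · simp only [mgf, one_mul, hX]
      rw [← hlaw.map_eq, integral_map hlaw.aemeasurable hsm] at hle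
      exact hle
  have hmgf := hindep.mgf_sum₀ (t := 1) hmeas 𝒯
  have hfun : (fun ω => Real.exp (1 * (∑ T ∈ 𝒯, X T) ω))
      = fun ω => Real.exp (∑ T ∈ 𝒯, c T * (ξ T ω - 1)) := by
    funext ω
    simp [Finset.sum_apply, hX]
  have hprodpos : 0 < ∏ T ∈ 𝒯, mgf (X T) P 1 :=
    Finset.prod_pos fun T hT => mgf_pos (hone T hT).1
  unfold mgf at hmgf
  rw [hfun] at hmgf
  refine ⟨?_, ?_⟩
  -- A non-integrable function would have integral 0, while the product of the individual moments is
  -- positive.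
  · by_contra hni
    rw [integral_undef hni] at hmgf
    exact hprodpos.ne hmgf
  · rw [hmgf, Real.exp_sum]
    exact Finset.prod_le_prod (fun T hT => (mgf_pos (hone T hT).1).le) fun T hT => (hone T hT).2

/-- As S is disjoint from `H`, the map H' ↦ S ∪ H' is injective on subsets of `H`. The sample
therefore meets distinct, hence independent, multipliers with coefficients at most |l|R. -/
lemma IsNoise.exp_noiseDev (hξ : IsNoise P ξ D ν α) {H S : Finset (Fin n)} {t : ℕ}
    (hSH : Disjoint S H) {Hs : List (Finset (Fin n))} (hv : ValidSample H t Hs) {R : ℝ}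
    (hf : ∀ H' ∈ Finset.powersetCard t H, 0 ≤ f (S ∪ H') ∧ f (S ∪ H') ≤ R) {l : ℝ}
    (hα : 0 ≤ α) (hl : α * (|l| * R) ≤ 1) :
    Integrable (fun ω => Real.exp (l * noiseDev ξ f S Hs ω)) P ∧
      ∫ ω, Real.exp (l * noiseDev ξ f S Hs ω) ∂P
        ≤ Real.exp (Hs.length * (ν ^ 2 * (l * R) ^ 2 / 2)) := by
  have hinj : Set.InjOn (S ∪ ·) (Hs.toFinset : Set (Finset (Fin n))) := by
    intro A hA B hB hAB
    have hA' := (Finset.mem_powersetCard.1 (hv.2 A (by simpa using hA))).1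
    have hB' := (Finset.mem_powersetCard.1 (hv.2 B (by simpa using hB))).1
    have h1 : ∀ T ⊆ H, (S ∪ T) \ S = T := fun T hT => by
      rw [Finset.union_sdiff_left, Finset.sdiff_eq_self_iff_disjoint]
      exact hSH.symm.mono_left hT
    rw [← h1 A hA', ← h1 B hB']
    exact congrArg (· \ S) hAB
  have hfT : ∀ T ∈ Hs.toFinset.image (S ∪ ·), 0 ≤ f T ∧ f T ≤ R := by
    intro T hT
    obtain ⟨H', hH', rfl⟩ := Finset.mem_image.1 hT
    exact hf H' (hv.2 H' (List.mem_toFinset.1 hH'))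
  have hsum : ∀ ω, l * noiseDev ξ f S Hs ω
      = ∑ T ∈ Hs.toFinset.image (S ∪ ·), (l * f T) * (ξ T ω - 1) := by
    intro ω
    rw [Finset.sum_image hinj, noiseDev, ← List.sum_toFinset _ hv.1, Finset.mul_sum]
    exact Finset.sum_congr rfl fun _ _ => by ring
  obtain ⟨hInt, hle⟩ := hξ.exp_sum (Hs.toFinset.image (S ∪ ·)) (fun T => l * f T) fun T hT => by
    obtain ⟨h0, h1⟩ := hfT T hT
    rw [abs_mul, abs_of_nonneg h0]
    exact (mul_le_mul_of_nonneg_left (mul_le_mul_of_nonneg_left h1 (abs_nonneg l)) hα).trans hl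
  simp only [hsum]
  refine ⟨hInt, hle.trans ?_⟩
  rw [Real.exp_le_exp]
  have hcard : (Hs.toFinset.image (S ∪ ·)).card = Hs.length := by
    rw [Finset.card_image_of_injOn hinj, List.toFinset_card_of_nodup hv.1]
  refine (Finset.sum_le_card_nsmul _ _ (ν ^ 2 * (l * R) ^ 2 / 2) fun T hT => ?_).trans
    (le_of_eq ?_)
  · obtain ⟨h0, h1⟩ := hfT T hT
    have h2 : f T ^ 2 ≤ R ^ 2 := pow_le_pow_left₀ h0 h1 2
    have h3 := mul_le_mul_of_nonneg_left h2 (mul_nonneg (sq_nonneg ν) (sq_nonneg l))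
    simp only [mul_pow]
    linarith
  · rw [hcard, nsmul_eq_mul]

/-- The noise of a sample of distinct sets averages out. -/
lemma IsNoise.pot_noiseDev (hξ : IsNoise P ξ D ν α) (hν : 0 < ν) (hα : 0 ≤ α)
    {H S : Finset (Fin n)} {t : ℕ} (hSH : Disjoint S H) {Hs : List (Finset (Fin n))}
    (hv : ValidSample H t Hs) {R σ : ℝ} (hR : 0 < R) (hσ : 0 ≤ σ) (hασ : α * σ ≤ ν ^ 2)
    (hf : ∀ H' ∈ Finset.powersetCard t H, 0 ≤ f (S ∪ H') ∧ f (S ∪ H') ≤ R) :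
    Integrable (fun ω => pot (σ / (ν ^ 2 * R)) (Hs.length * (σ * R)) (noiseDev ξ f S Hs ω)) P ∧
      ∫ ω, pot (σ / (ν ^ 2 * R)) (Hs.length * (σ * R)) (noiseDev ξ f S Hs ω) ∂P
        ≤ 2 * Real.exp (-(Hs.length * σ ^ 2 / (2 * ν ^ 2))) := by
  set m : ℝ := (Hs.length : ℝ) with hm
  have hν2 : 0 < ν ^ 2 := by positivity
  -- This |l| minimises the exponent ν²l²R²/2 - |l|σR per sample, and `hασ` keeps it in the range of
  -- the sub-exponential bound.
  have hone : ∀ l : ℝ, |l| = σ / (ν ^ 2 * R) →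
      Integrable (fun ω => Real.exp (l * noiseDev ξ f S Hs ω
        - σ / (ν ^ 2 * R) * (m * (σ * R)))) P ∧
      ∫ ω, Real.exp (l * noiseDev ξ f S Hs ω - σ / (ν ^ 2 * R) * (m * (σ * R))) ∂P
        ≤ Real.exp (-(m * σ ^ 2 / (2 * ν ^ 2))) := by
    intro l hl
    have hlR : |l| * R = σ / ν ^ 2 := by rw [hl]; field_simp
    obtain ⟨hInt, hle⟩ := hξ.exp_noiseDev hSH hv hf (l := l) hα (by
      rw [hlR, mul_div_assoc', div_le_one hν2]; exact hασ)
    have h1 : (fun ω => Real.exp (l * noiseDev ξ f S Hs ω - σ / (ν ^ 2 * R) * (m * (σ * R))))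
        = fun ω => Real.exp (-(σ / (ν ^ 2 * R) * (m * (σ * R))))
          * Real.exp (l * noiseDev ξ f S Hs ω) := by
      funext ω
      rw [← Real.exp_add]
      congr 1
      ring
    rw [h1]
    refine ⟨hInt.const_mul _, ?_⟩
    rw [integral_const_mul]
    have h2 := mul_le_mul_of_nonneg_left hle
      (Real.exp_pos (-(σ / (ν ^ 2 * R) * (m * (σ * R))))).le
    refine h2.trans (le_of_eq ?_)
    have h3 : (l * R) ^ 2 = (σ / ν ^ 2) ^ 2 := by
      rw [← hlR, mul_pow, mul_pow, sq_abs]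
    rw [h3, ← Real.exp_add]
    congr 1
    field_simp
    ring
  have hl0 : 0 ≤ σ / (ν ^ 2 * R) := by positivity
  obtain ⟨i1, l1⟩ := hone (σ / (ν ^ 2 * R)) (abs_of_nonneg hl0)
  obtain ⟨i2, l2⟩ := hone (-(σ / (ν ^ 2 * R))) (by rw [abs_neg, abs_of_nonneg hl0])
  simp only [pot]
  refine ⟨i1.add i2, ?_⟩
  rw [integral_add i1 i2]
  linarith

end Noise

/-- The value computed by `sampledSurrogate`. -/
lemma ev_sampledSurrogate (Hs : List (Finset (Fin n))) (S : Finset (Fin n)) (φ : ℝ → ℝ) :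
    ev g M φ (sampledSurrogate Hs S)
      = φ ((Hs.map fun H' => g (S ∪ H')).sum / (Hs.length : ℝ)) := by
  have key : ∀ (L : List (Finset (Fin n))) (s : ℝ) (φ : ℝ → ℝ),
      ev g M φ (forList (fun (s : ℝ) H' => do
        charge (n + 1)
        let v ← queryValue (S ∪ H')
        pure (s + v)) L s) = φ (s + (L.map fun H' => g (S ∪ H')).sum) := by
    intro L
    induction L with
    | nil => intro s φ; simp [ev_forList_nil]
    | cons H' L ih =>
      intro s φ
      rw [ev_forList_cons]
      simp only [ev_bind, ev_charge, ev_queryValue, ev_pure, ih, List.map_cons, List.sum_cons,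
        add_assoc]
  unfold sampledSurrogate
  simp only [ev_bind, key, ev_charge, ev_pure, zero_add]

end

section

open Alg

variable {n : ℕ} {g : Finset (Fin n) → ℝ} {M : Matroid (Fin n)} {f : Finset (Fin n) → ℝ}

/-! ### The meta-algorithm -/

/-- The independence oracle of the contraction, as it is used by the meta-algorithm. -/
lemma isOracle_contract {H : Finset (Fin n)} (hH : M.Indep (H : Set (Fin n))) :
    IsOracle g M (fun S => do charge (n + 1); queryIndep (S ∪ H))
      (M.contract (H : Set (Fin n))) Hᶜ := by
  classical
  intro S hS
  have hdisj : Disjoint (S : Set (Fin n)) (H : Set (Fin n)) := by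
    rw [Finset.disjoint_coe]
    exact Finset.disjoint_left.2 fun a ha haH => Finset.mem_compl.1 (hS ha) haH
  simp only [sat_bind, sat_charge, sat_queryIndep, decide_eq_true_eq, hH.contract_indep_iff,
    hdisj, true_and, Finset.coe_union]

/-- No property of the noise enters: S is independent in the contraction by `H`, so S ∪ H is
independent, and H' ⊆ H. -/
lemma sat_metaAlgorithm (h t m : ℕ) :
    Sat g M (fun S : Finset (Fin n) => M.Indep (S : Set (Fin n)))
      (metaAlgorithm measuredContinuousGreedy h t m) := by
  unfold metaAlgorithm
  simp only [sat_bind, sat_charge, sat_pure]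
  refine (sat_greedyIndep (isOracle_queryIndep (E := Finset.univ)) _
    (Finset.subset_univ _)).mono ?_
  rintro B ⟨-, hB, -⟩
  refine (sat_sampleSubset (elems B) h).mono fun H hH => ?_
  rw [toFinset_elems] at hH
  have hHI : M.Indep (H : Set (Fin n)) := hB.subset (by exact_mod_cast hH)
  refine sat_of_forall (fun Hs => ?_) _
  refine (sat_measuredContinuousGreedy (isOracle_contract hHI)).mono ?_
  rintro S ⟨-, hS⟩
  rw [hHI.contract_indep_iff] at hS
  refine (sat_sampleSubset (elems H) t).mono fun H' hH' => ?_
  rw [toFinset_elems] at hH'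
  refine hS.2.subset ?_
  rw [Finset.coe_union]
  exact Set.union_subset_union_right _ (by exact_mod_cast hH')

/-- The elements that can be added to `H`. -/
def activeSet (M : Matroid (Fin n)) (H : Finset (Fin n)) : Finset (Fin n) :=
  open Classical in Hᶜ.filter fun i => M.Indep ((insert i H : Finset (Fin n)) : Set (Fin n))

lemma subset_activeSet {H I : Finset (Fin n)} (hH : M.Indep (H : Set (Fin n)))
    (hI : (M.contract (H : Set (Fin n))).Indep (I : Set (Fin n))) : I ⊆ activeSet M H := by
  classical
  rw [hH.contract_indep_iff, Finset.disjoint_coe] at hI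
  intro i hi
  simp only [activeSet, Finset.mem_filter, Finset.mem_compl]
  refine ⟨Finset.disjoint_left.1 hI.1 hi, hI.2.subset ?_⟩
  rw [Finset.coe_insert]
  exact Set.insert_subset (Or.inl (by exact_mod_cast hi)) Set.subset_union_right

lemma activeSet_subset (M : Matroid (Fin n)) (H : Finset (Fin n)) : activeSet M H ⊆ Hᶜ := by
  classical
  intro i hi
  simp only [activeSet, Finset.mem_filter] at hi
  exact hi.1

/-- Sets without loops have at most `n` times the value of the optimum. -/
lemma le_of_subset_activeSet (hf : IsSubmodular f) (hf0 : ∀ S, 0 ≤ f S) (hn : 1 ≤ n)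
    {O : Finset (Fin n)} (hO : ∀ S : Finset (Fin n), M.Indep (S : Set (Fin n)) → f S ≤ f O)
    {H : Finset (Fin n)} (hH : M.Indep (H : Set (Fin n))) {S H' : Finset (Fin n)}
    (hS : S ⊆ activeSet M H) (hH' : H' ⊆ H) : f (S ∪ H') ≤ n * f O := by
  classical
  -- Every element of S ∪ H' is active or belongs to the independent set `H`, so its singleton is
  -- independent and worth at most f(O).
  refine hf.le_card_mul hf0 (hO ∅ (by simp)) _ (fun i hi => hO {i} ?_) hn
  rcases Finset.mem_union.1 hi with h | h
  · have := hS h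
    simp only [activeSet, Finset.mem_filter] at this
    exact this.2.subset (by simp)
  · exact hH.subset (by simpa using hH' h)

/-- The factor lost to the discretisation of measured continuous greedy on `k` elements. -/
def greedyFactor (k : ℕ) : ℝ :=
  (1 - 1 / (k : ℝ) ^ 4 * k) * (1 - 1 / (k : ℝ) ^ 4 - (1 / (k : ℝ) ^ 4) ^ 2 * (k : ℝ) ^ 2) ^ (k ^ 4)

/-- Put y = 1/k² and u = y² + y³, so that k⁴u = 1 + y. From 1 - u ≥ exp(-u/(1 - u)) the power is at
least exp(-(1 + 3y)) ≥ (1 - 3y)/e. The remaining factor is at least 1 - y, and e⁻¹ ≤ 1 bounds the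
total loss by 4y. -/
lemma le_greedyFactor {k : ℕ} (hk : 2 ≤ k) :
    1 / Real.exp 1 - 4 / (k : ℝ) ^ 2 ≤ greedyFactor k := by
  have hk2 : (2 : ℝ) ≤ k := by exact_mod_cast hk
  have hk0 : (0 : ℝ) < k := by linarith
  set y : ℝ := 1 / (k : ℝ) ^ 2 with hy
  have hy0 : 0 < y := by positivity
  have hy4 : y ≤ 1 / 4 := by
    rw [hy, div_le_div_iff₀ (by positivity) (by norm_num)]
    nlinarith
  set u : ℝ := y ^ 2 + y ^ 3 with hu
  have hu0 : 0 < u := by positivity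
  have hu2 : u ≤ 5 / 4 * y ^ 2 := by
    have : 0 < y ^ 2 := by positivity
    nlinarith
  have hu1 : u < 1 := by nlinarith
  have e1 : 1 - 1 / (k : ℝ) ^ 4 - (1 / (k : ℝ) ^ 4) ^ 2 * (k : ℝ) ^ 2 = 1 - u := by
    rw [hu, hy]; field_simp; ring
  have e2 : 1 - 1 / (k : ℝ) ^ 4 * k ≥ 1 - y := by
    have : 1 / (k : ℝ) ^ 4 * k ≤ y := by
      rw [hy, div_mul_eq_mul_div, div_le_div_iff₀ (by positivity) (by positivity)]
      have : (k : ℝ) ^ 3 ≤ (k : ℝ) ^ 4 := pow_le_pow_right₀ (by linarith) (by norm_num)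
      nlinarith
    linarith
  have hpow : Real.exp (-(1 + 3 * y)) ≤ (1 - u) ^ (k ^ 4) := by
    have h1 : Real.exp (-(u / (1 - u))) ≤ 1 - u := by
      rw [Real.exp_neg]
      refine inv_le_of_inv_le₀ (by linarith) ?_
      have : (1 - u)⁻¹ = u / (1 - u) + 1 := by
        field_simp [show (1 : ℝ) - u ≠ 0 by linarith]
        ring
      rw [this]
      exact Real.add_one_le_exp _
    refine le_trans ?_ (pow_le_pow_left₀ (Real.exp_pos _).le h1 _)
    rw [← Real.exp_nat_mul, Real.exp_le_exp]
    push_cast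
    have h2 : (k : ℝ) ^ 4 * u = 1 + y := by
      rw [hu, hy]; field_simp
    have h3 : (k : ℝ) ^ 4 * (u / (1 - u)) = (1 + y) / (1 - u) := by
      rw [← h2]; ring
    rw [mul_neg, h3, neg_le_neg_iff, div_le_iff₀ (by linarith)]
    nlinarith
  have hexp : Real.exp (-1) * (1 - 3 * y) ≤ Real.exp (-(1 + 3 * y)) := by
    rw [show -(1 + 3 * y) = -1 + -(3 * y) by ring, Real.exp_add]
    refine mul_le_mul_of_nonneg_left ?_ (Real.exp_pos _).le
    have := Real.add_one_le_exp (-(3 * y))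
    linarith
  have hE : Real.exp (-1) ≤ 1 := Real.exp_le_one_iff.2 (by norm_num)
  have hE0 := Real.exp_pos (-1)
  rw [greedyFactor, e1]
  calc 1 / Real.exp 1 - 4 / (k : ℝ) ^ 2 = Real.exp (-1) - 4 * y := by
        rw [Real.exp_neg, hy]; ring
    _ ≤ (1 - y) * (Real.exp (-1) * (1 - 3 * y)) := by nlinarith
    _ ≤ (1 - 1 / (k : ℝ) ^ 4 * k) * (1 - u) ^ (k ^ 4) :=
        mul_le_mul e2 (hexp.trans hpow) (mul_nonneg hE0.le (by linarith)) (by linarith)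

/-- The last part of the meta-algorithm, for a given sample. -/
def afterSampling (H : Finset (Fin n)) (t : ℕ) (Hs : List (Finset (Fin n))) :
    Alg n (Finset (Fin n)) := do
  charge (2 * (n + 1))
  let S ← measuredContinuousGreedy (elems Hᶜ) (sampledSurrogate Hs)
    (fun S => do charge (n + 1); queryIndep (S ∪ H))
  let H' ← sampleSubset (elems H) t
  charge (n + 1)
  pure (S ∪ H')

/-- The guarantee for a given sample that represents the surrogate function well. -/
lemma le_ev_afterSampling (hf : IsSubmodular f) (hf0 : ∀ S, 0 ≤ f S) {H : Finset (Fin n)}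
    (hH : M.Indep (H : Set (Fin n))) {t : ℕ} (ht : t ≤ H.card) (hk : 2 ≤ (Hᶜ).card)
    {Hs : List (Finset (Fin n))} {B η : ℝ} (hB0 : 0 < B)
    (hB : ∀ S ⊆ activeSet M H, |(Hs.map fun H' => g (S ∪ H')).sum / (Hs.length : ℝ)| ≤ B)
    (hη : ∀ S ⊆ activeSet M H,
      |(Hs.map fun H' => g (S ∪ H')).sum / (Hs.length : ℝ) - surrogate f H t S| ≤ η)
    {O : Finset (Fin n)} (hO : Disjoint O H)
    (hOH : M.Indep ((O ∪ H : Finset (Fin n)) : Set (Fin n))) :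
    greedyFactor (Hᶜ).card * surrogate f H t O
      - 2 * ((Hᶜ).card * (2 * B * (1 / ((Hᶜ).card : ℝ) ^ 4) + 2 * η))
    ≤ ev g M f (afterSampling H t Hs) := by
  have hN : (M.contract (H : Set (Fin n))).Indep (O : Set (Fin n)) := by
    rw [hH.contract_indep_iff, Finset.disjoint_coe]
    exact ⟨hO, by simpa using hOH⟩
  have := le_ev_measuredContinuousGreedy (g := g) (isOracle_contract hH)
    (fun S φ => ev_sampledSurrogate Hs S φ) (isSubmodular_surrogate hf H t)
    (surrogate_nonneg hf0 H t) hk rfl (activeSet_subset M H)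
    (fun I _ hI => subset_activeSet hH hI)
    (fun a ha => Finset.mem_compl.2 fun h => Finset.disjoint_left.1 hO ha h) hN hB hB0 hη
  unfold afterSampling
  simp only [ev_bind, ev_charge, ev_pure]
  -- The fresh uniform H' turns the value f of the returned set into the surrogate of the greedy
  -- output.
  have hev : (fun S => ev g M (fun H' => f (S ∪ H')) (sampleSubset (elems H) t))
      = surrogate f H t := by
    funext S
    rw [ev_sampleSubset_elems _ H ht, surrogate]
  rw [hev]
  exact this

section Noise

variable {Ω : Type*} {ξ : Finset (Fin n) → Ω → ℝ} {ν α : ℝ}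

/-- The potential that bounds the failure of the sampled noisy surrogate. -/
def failure (ξ : Finset (Fin n) → Ω → ℝ) (f : Finset (Fin n) → ℝ) (H Z : Finset (Fin n))
    (t m : ℕ) (σ R ν : ℝ) (Hs : List (Finset (Fin n))) (ω : Ω) : ℝ :=
  ∑ S ∈ Z.powerset, (pot (σ / R) (m * (σ * R)) (sampleDev f H t S Hs)
    + pot (σ / (ν ^ 2 * R)) (m * (σ * R)) (noiseDev ξ f S Hs ω))

/-- A sum of nonnegative potentials below 1 has all its terms below 1. Sampling and noise then each
contribute less than σR to the average, at every S ⊆ Z at once. -/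
lemma abs_sub_surrogate_le_of_failure {H Z : Finset (Fin n)} {t : ℕ} {σ R : ℝ} (hσ : 0 < σ)
    (hR : 0 < R) (hν : 0 < ν) {Hs : List (Finset (Fin n))} (hm : 0 < Hs.length) {ω : Ω}
    (h : failure ξ f H Z t Hs.length σ R ν Hs ω < 1) {S : Finset (Fin n)} (hS : S ⊆ Z) :
    |(Hs.map fun H' => noisyOracle ξ f ω (S ∪ H')).sum / (Hs.length : ℝ) - surrogate f H t S|
      ≤ 2 * (σ * R) := by
  have hle := Finset.single_le_sum (s := Z.powerset) (f := fun S =>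
    pot (σ / R) (Hs.length * (σ * R)) (sampleDev f H t S Hs)
    + pot (σ / (ν ^ 2 * R)) (Hs.length * (σ * R)) (noiseDev ξ f S Hs ω))
    (fun S _ => add_nonneg (pot_nonneg _ _ _) (pot_nonneg _ _ _)) (Finset.mem_powerset.2 hS)
  have hlt := lt_of_le_of_lt hle h
  have p1 := pot_nonneg (σ / R) (Hs.length * (σ * R)) (sampleDev f H t S Hs)
  have p2 := pot_nonneg (σ / (ν ^ 2 * R)) (Hs.length * (σ * R)) (noiseDev ξ f S Hs ω)
  have h1 := abs_lt_of_pot_lt_one (by positivity) (lt_of_le_of_lt (by linarith) hlt :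
    pot (σ / R) (Hs.length * (σ * R)) (sampleDev f H t S Hs) < 1)
  have h2 := abs_lt_of_pot_lt_one (by positivity) (lt_of_le_of_lt (by linarith) hlt :
    pot (σ / (ν ^ 2 * R)) (Hs.length * (σ * R)) (noiseDev ξ f S Hs ω) < 1)
  have hm' : (0 : ℝ) < Hs.length := by exact_mod_cast hm
  have hsplit : ∀ L : List (Finset (Fin n)), (L.map fun H' => noisyOracle ξ f ω (S ∪ H')).sum
      = noiseDev ξ f S L ω + sampleDev f H t S L + L.length * surrogate f H t S := by
    intro L
    induction L with
    | nil => simp [noiseDev, sampleDev]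
    | cons A L ih =>
      simp only [noiseDev, sampleDev, List.map_cons, List.sum_cons, List.length_cons,
        noisyOracle] at ih ⊢
      push_cast
      linarith
  have e : (Hs.map fun H' => noisyOracle ξ f ω (S ∪ H')).sum / (Hs.length : ℝ)
      - surrogate f H t S = (noiseDev ξ f S Hs ω + sampleDev f H t S Hs) / Hs.length := by
    rw [hsplit]
    field_simp
    ring
  rw [e, abs_div, abs_of_pos hm', div_le_iff₀ hm']
  have := abs_add_le (noiseDev ξ f S Hs ω) (sampleDev f H t S Hs)
  linarith

/-- The guarantee after the choice of `H`, in expectation over the sample: it is lost only to the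
failure potential. -/
lemma le_ev_bind_afterSampling (hν : 0 < ν) {σ R : ℝ} (hσ : 0 < σ) (hR : 0 < R)
    {H : Finset (Fin n)} {t m : ℕ} (hm0 : 0 < m) (hm : m ≤ H.card.choose t)
    (hf0 : ∀ S, 0 ≤ f S) {V : ℝ} (hV : 0 ≤ V) (ω : Ω)
    (hval : ∀ Hs, ValidSample H t Hs → Hs.length = m →
      (∀ S ⊆ activeSet M H, |(Hs.map fun H' => noisyOracle ξ f ω (S ∪ H')).sum / (Hs.length : ℝ)
        - surrogate f H t S| ≤ 2 * (σ * R)) →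
      V ≤ ev (noisyOracle ξ f ω) M f (afterSampling H t Hs)) {ψ : List (Finset (Fin n)) → ℝ}
    (hψ : ∀ Hs, ValidSample H t Hs → Hs.length = m →
      ψ Hs ≤ 1 - failure ξ f H (activeSet M H) t m σ R ν Hs ω) :
    V * ev 0 M ψ (sampleDistinct H t m)
      ≤ ev (noisyOracle ξ f ω) M f (sampleDistinct H t m >>= afterSampling H t) := by
  -- Drawing the sample makes no value query, so its law is the same for every ω and the oracle may
  -- be replaced by 0.
  rw [ev_bind, oblivious_sampleDistinct H t m (noisyOracle ξ f ω) 0, ← ev_const_mul]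
  refine ev_sampleDistinct_mono hm fun Hs hv hl => ?_
  have h0 : 0 ≤ ev (noisyOracle ξ f ω) M f (afterSampling H t Hs) := ev_nonneg hf0 _
  refine (mul_le_mul_of_nonneg_left (hψ Hs hv hl) hV).trans ?_
  -- On success the guarantee V applies and 1 - failure ≤ 1; otherwise V(1 - failure) ≤ 0, which is
  -- below any value of f.
  by_cases hfail : failure ξ f H (activeSet M H) t m σ R ν Hs ω < 1
  · have hB0 : 0 ≤ failure ξ f H (activeSet M H) t m σ R ν Hs ω :=
      Finset.sum_nonneg fun S _ => add_nonneg (pot_nonneg _ _ _) (pot_nonneg _ _ _)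
    subst hl
    have := hval Hs hv rfl fun S hS => abs_sub_surrogate_le_of_failure hσ hR hν hm0 hfail hS
    nlinarith
  · have : V * (1 - failure ξ f H (activeSet M H) t m σ R ν Hs ω) ≤ 0 :=
      mul_nonpos_of_nonneg_of_nonpos hV (by linarith)
    linarith

variable [MeasurableSpace Ω] {P : Measure Ω} {D : Measure ℝ}

/-- Allows a signed integrable minorant below the expected value of the algorithm, whose own
measurability in ω then plays no role. -/
lemma ofReal_integral_le_lintegral {h : Ω → ℝ} (hh : Integrable h P) :
    ENNReal.ofReal (∫ ω, h ω ∂P) ≤ ∫⁻ ω, ENNReal.ofReal (h ω) ∂P := by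
  rw [integral_eq_lintegral_pos_part_sub_lintegral_neg_part hh]
  refine (ENNReal.ofReal_le_ofReal (sub_le_self _ ENNReal.toReal_nonneg)).trans
    ENNReal.ofReal_toReal_le

/-- The expected value of the failure potential is small. -/
lemma exists_expected_success [IsProbabilityMeasure P] (hξ : IsNoise P ξ D ν α)
    (hν : 0 < ν) (hα : 0 ≤ α) (hf0 : ∀ S, 0 ≤ f S) {H Z : Finset (Fin n)} (hZ : Z ⊆ Hᶜ) {t m : ℕ}
    (hC : (m : ℝ) ^ 2 + m < (H.card.choose t : ℝ)) {σ R : ℝ} (hσ : 0 ≤ σ) (hR : 0 < R)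
    (hασ : α * σ ≤ ν ^ 2)
    (hf : ∀ S ⊆ Z, ∀ H' ∈ Finset.powersetCard t H, f (S ∪ H') ≤ R) :
    ∃ φ : Ω → List (Finset (Fin n)) → ℝ,
      (∀ ω Hs, ValidSample H t Hs → Hs.length = m →
        φ ω Hs = 1 - failure ξ f H Z t m σ R ν Hs ω) ∧
      Integrable (fun ω => ev 0 M (φ ω) (sampleDistinct H t m)) P ∧
      1 - 2 ^ n * (2 * Real.exp 1 * Real.exp (-(m * σ ^ 2 / 2))
          + 2 * Real.exp (-(m * σ ^ 2 / (2 * ν ^ 2))))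
        ≤ ∫ ω, ev 0 M (φ ω) (sampleDistinct H t m) ∂P := by
  classical
  have hmC : m ≤ H.card.choose t := by
    have : (m : ℝ) < (H.card.choose t : ℝ) := by nlinarith [sq_nonneg (m : ℝ)]
    exact_mod_cast this.le
  have hf' : ∀ S ⊆ Z, ∀ H' ∈ Finset.powersetCard t H, 0 ≤ f (S ∪ H') ∧ f (S ∪ H') ≤ R :=
    fun S hS H' hH' => ⟨hf0 _, hf S hS H' hH'⟩
  have hdisj : ∀ S ⊆ Z, Disjoint S H := fun S hS =>
    Finset.disjoint_left.2 fun a ha haH => Finset.mem_compl.1 (hZ (hS ha)) haH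
  -- The value 0 on other lists makes every φ(·, Hs) integrable; the noise bound covers only lists
  -- of distinct t-subsets of `H`.
  let φ : Ω → List (Finset (Fin n)) → ℝ := fun ω Hs =>
    if ValidSample H t Hs ∧ Hs.length = m then 1 - failure ξ f H Z t m σ R ν Hs ω else 0
  have hnoise : ∀ Hs, ValidSample H t Hs → Hs.length = m → ∀ S ∈ Z.powerset,
      Integrable (fun ω => pot (σ / (ν ^ 2 * R)) (m * (σ * R)) (noiseDev ξ f S Hs ω)) P ∧
      ∫ ω, pot (σ / (ν ^ 2 * R)) (m * (σ * R)) (noiseDev ξ f S Hs ω) ∂P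
        ≤ 2 * Real.exp (-(m * σ ^ 2 / (2 * ν ^ 2))) := by
    intro Hs hv hl S hS
    have := hξ.pot_noiseDev hν hα (hdisj S (Finset.mem_powerset.1 hS)) hv hR hσ hασ
      (hf' S (Finset.mem_powerset.1 hS))
    rwa [hl] at this
  have hInt : ∀ Hs, ValidSample H t Hs → Hs.length = m →
      Integrable (fun ω => failure ξ f H Z t m σ R ν Hs ω) P := by
    intro Hs hv hl
    exact integrable_finsetSum _ fun S hS =>
      (integrable_const _).add (hnoise Hs hv hl S hS).1
  have hφint : ∀ Hs, Integrable (fun ω => φ ω Hs) P := by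
    intro Hs
    by_cases h : ValidSample H t Hs ∧ Hs.length = m
    · simp only [φ, h, and_self, if_true]
      exact (integrable_const _).sub (hInt Hs h.1 h.2)
    · simp only [φ, h, if_false]
      exact integrable_zero _ _ _
  obtain ⟨hI, hE⟩ := integral_ev (g := 0) (M := M) hφint (sampleDistinct H t m)
  refine ⟨φ, fun ω Hs hv hl => if_pos ⟨hv, hl⟩, hI, ?_⟩
  rw [hE]
  set e2 := 2 * Real.exp (-(m * σ ^ 2 / (2 * ν ^ 2))) with he2
  have hcard : (Z.powerset.card : ℝ) ≤ 2 ^ n := by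
    rw [Finset.card_powerset]
    push_cast
    have := Finset.card_le_univ Z
    rw [Fintype.card_fin] at this
    exact pow_le_pow_right₀ (by norm_num) this
  -- The noise is integrated first, with the sample held fixed; only the sampling potentials remain
  -- under the expectation over samples.
  have hlow : ev 0 M (fun Hs => (1 - Z.powerset.card * e2)
      - ∑ S ∈ Z.powerset, pot (σ / R) (m * (σ * R)) (sampleDev f H t S Hs))
      (sampleDistinct H t m)
      ≤ ev 0 M (fun Hs => ∫ ω, φ ω Hs ∂P) (sampleDistinct H t m) := by
    refine ev_sampleDistinct_mono hmC fun Hs hv hl => ?_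
    have h1 : ∫ ω, φ ω Hs ∂P = 1 - ∫ ω, failure ξ f H Z t m σ R ν Hs ω ∂P := by
      simp only [φ, hv, hl, and_self, if_true]
      rw [integral_sub (integrable_const _) (hInt Hs hv hl)]
      simp
    rw [h1]
    have h2 : ∫ ω, failure ξ f H Z t m σ R ν Hs ω ∂P
        ≤ ∑ S ∈ Z.powerset, (pot (σ / R) (m * (σ * R)) (sampleDev f H t S Hs) + e2) := by
      simp only [failure]
      have hadd : ∀ S ∈ Z.powerset, Integrable (fun ω =>
          pot (σ / R) (m * (σ * R)) (sampleDev f H t S Hs)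
            + pot (σ / (ν ^ 2 * R)) (m * (σ * R)) (noiseDev ξ f S Hs ω)) P :=
        fun S hS => (integrable_const _).add (hnoise Hs hv hl S hS).1
      rw [integral_finsetSum _ hadd]
      refine Finset.sum_le_sum fun S hS => ?_
      rw [integral_add (integrable_const _) (hnoise Hs hv hl S hS).1]
      simp only [integral_const, probReal_univ, one_smul]
      exact add_le_add le_rfl (hnoise Hs hv hl S hS).2
    rw [Finset.sum_add_distrib, Finset.sum_const, nsmul_eq_mul] at h2
    linarith
  refine le_trans ?_ hlow
  rw [ev_sub, ev_const, ev_sum]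
  have h3 : ∑ S ∈ Z.powerset, ev 0 M (fun Hs => pot (σ / R) (m * (σ * R)) (sampleDev f H t S Hs))
      (sampleDistinct H t m)
      ≤ Z.powerset.card * (2 * Real.exp 1 * Real.exp (-(m * σ ^ 2 / 2))) := by
    refine (Finset.sum_le_card_nsmul _ _ _ fun S hS => ?_).trans (le_of_eq (nsmul_eq_mul _ _))
    exact ev_pot_sampleDev_le hC hR (hf' S (Finset.mem_powerset.1 hS))
  have h4 : (0 : ℝ) ≤ 2 * Real.exp 1 * Real.exp (-(m * σ ^ 2 / 2)) + e2 := by positivity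
  have h5 := mul_le_mul_of_nonneg_right hcard h4
  linarith

/-- Reduction of the guarantee to bounds for each choice of `H`. -/
lemma le_expectedValue_metaAlgorithm {B : Finset (Fin n)}
    (hB : ∀ (g φ : Finset (Fin n) → ℝ),
      ev g M φ (greedyIndep queryIndep (List.finRange n)) = φ B)
    (hf0 : ∀ S, 0 ≤ f S) {h t m : ℕ} (hh : h ≤ B.card) {W : Finset (Fin n) → Ω → ℝ}
    (hInt : ∀ H ∈ Finset.powersetCard h B, Integrable (W H) P)
    (hW : ∀ H ∈ Finset.powersetCard h B, ∀ ω, W H ω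
      ≤ ev (noisyOracle ξ f ω) M f (sampleDistinct H t m >>= afterSampling H t)) :
    ENNReal.ofReal ((B.card.choose h : ℝ)⁻¹
        * ∑ H ∈ Finset.powersetCard h B, ∫ ω, W H ω ∂P)
      ≤ expectedValue P ξ f M (metaAlgorithm measuredContinuousGreedy h t m) := by
  have hsum : (B.card.choose h : ℝ)⁻¹ * ∑ H ∈ Finset.powersetCard h B, ∫ ω, W H ω ∂P
      = ∫ ω, (B.card.choose h : ℝ)⁻¹ * ∑ H ∈ Finset.powersetCard h B, W H ω ∂P := by
    rw [integral_const_mul, integral_finsetSum _ hInt]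
  rw [hsum]
  refine (ofReal_integral_le_lintegral ((integrable_finsetSum _ hInt).const_mul _)).trans ?_
  unfold expectedValue
  refine lintegral_mono fun ω => ?_
  dsimp only
  rw [sum_run_mul_ofReal hf0]
  refine ENNReal.ofReal_le_ofReal ?_
  unfold metaAlgorithm
  simp only [ev_bind, hB, ev_charge]
  rw [ev_sampleSubset_elems _ B hh]
  refine mul_le_mul_of_nonneg_left (Finset.sum_le_sum fun H hH => ?_) (by positivity)
  have := hW H hH ω
  simpa only [afterSampling, ev_bind, ev_charge, ev_pure] using this

end Noise

end

section

open Alg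

variable {n : ℕ} {g : Finset (Fin n) → ℝ} {M : Matroid (Fin n)} {f : Finset (Fin n) → ℝ}

/-! ### The approximation guarantee for given parameters -/

lemma quarter_le_one_div_exp : 1 / 4 ≤ 1 / Real.exp 1 := by
  have := Real.exp_one_lt_d9
  exact one_div_le_one_div_of_le (Real.exp_pos 1) (by linarith)

/-- `le_ev_afterSampling` with explicit error terms. -/
lemma le_ev_afterSampling_of_close (hf : IsSubmodular f) (hf0 : ∀ S, 0 ≤ f S)
    {O : Finset (Fin n)} (hO : ∀ S : Finset (Fin n), M.Indep (S : Set (Fin n)) → f S ≤ f O)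
    (hOpos : 0 < f O) {H : Finset (Fin n)} (hH : M.Indep (H : Set (Fin n))) {t : ℕ} (ht : 2 ≤ t)
    (hcard : H.card = t ^ 2) {ε : ℝ} (hε0 : 0 < ε) (hε : ε ≤ 1 / 64) (hn : 1 / ε ≤ n)
    (hHn : (t : ℝ) ^ 2 ≤ ε * n) {Hs : List (Finset (Fin n))}
    (hclose : ∀ S ⊆ activeSet M H,
      |(Hs.map fun H' => g (S ∪ H')).sum / (Hs.length : ℝ) - surrogate f H t S|
        ≤ 2 * (ε / (n : ℝ) ^ 2 * (n * f O)))
    {T : Finset (Fin n)} (hT : Disjoint T H)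
    (hTH : M.Indep ((T ∪ H : Finset (Fin n)) : Set (Fin n))) :
    (1 / Real.exp 1 - ε) * ((1 - 1 / t) * f T) - 9 * ε * f O ≤ ev g M f (afterSampling H t Hs) := by
  have ht0 : (0 : ℝ) < t := by exact_mod_cast (by omega : 0 < t)
  have htH : t ≤ H.card := by rw [hcard]; nlinarith
  have hn64 : (64 : ℝ) ≤ n := by
    refine le_trans ?_ hn
    rw [le_div_iff₀ hε0]; linarith
  have hn0 : (0 : ℝ) < n := by linarith
  have hnε : 1 ≤ ε * n := by rwa [div_le_iff₀ hε0, mul_comm] at hn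
  have hkn : ((Hᶜ).card : ℝ) = n - (t : ℝ) ^ 2 := by
    have := Finset.card_add_card_compl H
    rw [Fintype.card_fin, hcard] at this
    have : ((t ^ 2 : ℕ) : ℝ) + ((Hᶜ).card : ℝ) = n := by exact_mod_cast this
    push_cast at this
    linarith
  set k : ℝ := ((Hᶜ).card : ℝ) with hk
  -- Removing `H` deletes t² ≤ εn ≤ n/2 elements, so powers of k and n are comparable.
  have hk2 : (n : ℝ) / 2 ≤ k := by
    rw [hkn]; nlinarith
  have hkle : k ≤ n := by rw [hkn]; nlinarith
  have hk0 : 0 < k := by linarith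
  have hkN : 2 ≤ (Hᶜ).card := by
    have : (2 : ℝ) ≤ ((Hᶜ).card : ℝ) := by linarith
    exact_mod_cast this
  have hη : 2 * (ε / (n : ℝ) ^ 2 * (n * f O)) = 2 * ε * f O / n := by
    field_simp
  have hsur : ∀ S ⊆ activeSet M H, surrogate f H t S ≤ n * f O := fun S hS =>
    surrogate_le htH fun H' hH' => le_of_subset_activeSet hf hf0
      (by exact_mod_cast (by linarith : (1 : ℝ) ≤ n)) hO hH hS (Finset.mem_powersetCard.1 hH').1
  have hbound : ∀ S ⊆ activeSet M H,
      |(Hs.map fun H' => g (S ∪ H')).sum / (Hs.length : ℝ)| ≤ 2 * (n * f O) := by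
    intro S hS
    have h1 := abs_le.1 (hclose S hS)
    have h2 := hsur S hS
    have h3 := surrogate_nonneg hf0 H t S
    have h4 : 2 * (ε / (n : ℝ) ^ 2 * (n * f O)) ≤ n * f O := by
      rw [hη, div_le_iff₀ hn0]
      nlinarith [mul_pos hOpos hn0, mul_pos hOpos hε0]
    exact abs_le.2 ⟨by linarith, by linarith⟩
  have hmain := le_ev_afterSampling hf hf0 hH htH hkN (by positivity) hbound hclose hT hTH
  refine le_trans ?_ hmain
  rw [← hk]
  have he : ε ≤ 1 / Real.exp 1 := hε.trans (le_trans (by norm_num) quarter_le_one_div_exp)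
  have hfac : 1 / Real.exp 1 - ε ≤ greedyFactor (Hᶜ).card := by
    refine le_trans ?_ (le_greedyFactor hkN)
    rw [← hk]
    have : 4 / k ^ 2 ≤ ε := by
      rw [div_le_iff₀ (by positivity)]
      have h1 : ((n : ℝ) / 2) ^ 2 ≤ k ^ 2 := pow_le_pow_left₀ (by positivity) hk2 2
      have h2 : 64 ≤ ε * (n : ℝ) ^ 2 := by nlinarith
      nlinarith
    linarith
  have hlow := le_surrogate hf hf0 htH T
  have htt : (t : ℝ) / (H.card : ℝ) = 1 / t := by
    rw [hcard]; push_cast; field_simp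
  rw [htt] at hlow
  have h0 := surrogate_nonneg hf0 H t T
  have hA : (1 / Real.exp 1 - ε) * ((1 - 1 / t) * f T)
      ≤ greedyFactor (Hᶜ).card * surrogate f H t T :=
    (mul_le_mul_of_nonneg_left hlow (by linarith)).trans (mul_le_mul_of_nonneg_right hfac h0)
  -- The marginal estimates cost 8n/k³ ≤ ε and the distance of the oracle from the surrogate costs
  -- 8εk/n ≤ 8ε, in units of f(O).
  have hE : 2 * (k * (2 * (2 * (n * f O)) * (1 / k ^ 4) + 2 * (2 * (ε / (n : ℝ) ^ 2 * (n * f O)))))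
      ≤ 9 * ε * f O := by
    rw [hη]
    have e1 : 2 * (k * (2 * (2 * (n * f O)) * (1 / k ^ 4) + 2 * (2 * ε * f O / n)))
        = (8 * n / k ^ 3 + 8 * ε * (k / n)) * f O := by
      field_simp
      ring
    rw [e1]
    refine mul_le_mul_of_nonneg_right ?_ hOpos.le
    have e2 : k / n ≤ 1 := (div_le_one hn0).2 hkle
    have e3 : 8 * n / k ^ 3 ≤ ε := by
      rw [div_le_iff₀ (by positivity)]
      have h1 : ((n : ℝ) / 2) ^ 3 ≤ k ^ 3 := pow_le_pow_left₀ (by positivity) hk2 3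
      have h2 : 64 ≤ ε * (n : ℝ) ^ 2 := by nlinarith
      calc 8 * (n : ℝ) ≤ ε * (n : ℝ) ^ 2 * n / 8 := by nlinarith
        _ = ε * ((n : ℝ) / 2) ^ 3 := by ring
        _ ≤ ε * k ^ 3 := mul_le_mul_of_nonneg_left h1 hε0.le
    have e4 := mul_le_mul_of_nonneg_left e2 (by positivity : 0 ≤ 8 * ε)
    linarith
  linarith

/-- The failure probability is at most `2 / n`. -/
lemma two_pow_mul_exp_le {n : ℕ} (hn : 1 ≤ n) {a b : ℝ} (ha : n + Real.log (4 * n) ≤ a)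
    (hb : n + Real.log (4 * n) ≤ b) :
    2 ^ n * (2 * Real.exp 1 * Real.exp (-a) + 2 * Real.exp (-b)) ≤ 2 / (n : ℝ) := by
  have hn0 : (0 : ℝ) < n := by exact_mod_cast hn
  -- The term n in the exponent absorbs the 2^n sets of the union bound, log(4n) supplies 1/(4n),
  -- and (2e + 2)/4 ≤ 2.
  have hx : Real.exp (-(n + Real.log (4 * n))) = (Real.exp 1 ^ n)⁻¹ * (4 * (n : ℝ))⁻¹ := by
    rw [neg_add, Real.exp_add, Real.exp_neg, Real.exp_neg, Real.exp_log (by positivity),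
      ← Real.exp_nat_mul, mul_one]
  have h1 : Real.exp (-a) ≤ Real.exp (-(n + Real.log (4 * n))) := Real.exp_le_exp.2 (by linarith)
  have h2 : Real.exp (-b) ≤ Real.exp (-(n + Real.log (4 * n))) := Real.exp_le_exp.2 (by linarith)
  have he := Real.exp_one_lt_d9
  have he' := Real.exp_one_gt_d9
  have h3 : (2 : ℝ) ^ n ≤ Real.exp 1 ^ n := pow_le_pow_left₀ (by norm_num) (by linarith) n
  set x := Real.exp (-(n + Real.log (4 * n))) with hxd
  have hx0 : 0 < x := Real.exp_pos _
  calc 2 ^ n * (2 * Real.exp 1 * Real.exp (-a) + 2 * Real.exp (-b))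
      ≤ Real.exp 1 ^ n * (2 * Real.exp 1 * x + 2 * x) := by gcongr
    _ = (2 * Real.exp 1 + 2) / 4 * (1 / n) := by
        rw [hx]
        have : Real.exp 1 ^ n ≠ 0 := by positivity
        field_simp
    _ ≤ 2 * (1 / n) := by gcongr; linarith
    _ = 2 / n := by ring

/-- The final bookkeeping with q = 1/e and s = 1/t: 2ε for failure, ε for discretisation, ε for
contraction and 9ε for estimation make up 13ε. -/
lemma le_of_error_terms {ε q s : ℝ} (hε0 : 0 ≤ ε) (hε : ε ≤ 1 / 2) (hs0 : 0 ≤ s) (hs : s ≤ 1)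
    (hqε : ε ≤ q) (hq : q ≤ 1) :
    q - s - 13 * ε ≤ (1 - 2 * ε) * ((q - ε) * ((1 - s) * (1 - ε)) - 9 * ε) := by
  have b1 : 1 - s - ε ≤ (1 - s) * (1 - ε) := by nlinarith
  have b2 := mul_le_mul_of_nonneg_left b1 (sub_nonneg.2 hqε)
  have b3 : (1 - s) * (1 - ε) ≤ 1 := by nlinarith
  have b0 : 0 ≤ (1 - s) * (1 - ε) := mul_nonneg (by linarith) (by linarith)
  have a1 : q - s - 2 * ε ≤ (q - ε) * ((1 - s) * (1 - ε)) := by nlinarith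
  have a2 : (q - ε) * ((1 - s) * (1 - ε)) ≤ 1 := by nlinarith
  nlinarith

section Noise

variable {Ω : Type*} [MeasurableSpace Ω] {P : Measure Ω} [IsProbabilityMeasure P]
  {ξ : Finset (Fin n) → Ω → ℝ} {D : Measure ℝ} {ν α : ℝ}

lemma le_expectedValue_of_parameters (hξ : IsNoise P ξ D ν α) (hν : 0 < ν) (hα : 0 ≤ α)
    (hM : M.E = Set.univ) (hf : IsSubmodular f) (hf0 : ∀ S, 0 ≤ f S) {O : Finset (Fin n)}
    (hOI : M.Indep (O : Set (Fin n)))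
    (hO : ∀ S : Finset (Fin n), M.Indep (S : Set (Fin n)) → f S ≤ f O)
    {ε : ℝ} (hε0 : 0 < ε) (hε : ε ≤ 1 / 64) (hn : 1 / ε ≤ n) (hαε : α * ε ≤ 2 * ν ^ 2)
    {t m : ℕ} (ht : 2 ≤ t) (hC : (m : ℝ) ^ 2 + m < ((t ^ 2).choose t : ℝ))
    (hm : max 2 (8 * ν ^ 2) * ((n : ℝ) ^ 4 / ε ^ 2) * ((n : ℝ) + Real.log (4 * (n : ℝ))) ≤ m)
    (hr : (t : ℝ) ^ 2 ≤ ε * M.eRank.toNat) :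
    ENNReal.ofReal ((1 / Real.exp 1 - 1 / t - 13 * ε) * f O)
      ≤ expectedValue P ξ f M (metaAlgorithm measuredContinuousGreedy (t ^ 2) t m) := by
  -- The deviation scale R = n f(O) must be positive; if f(O) = 0 there is nothing to prove.
  rcases (hf0 O).eq_or_lt with hO0 | hOpos
  · rw [← hO0]; simp
  obtain ⟨B, hB, hgreedy⟩ := exists_base_greedyIndep (M := M)
  have hrank : M.eRank.toNat = B.card := by
    rw [← hB.encard_eq_eRank]; simp
  rw [hrank] at hr
  have ht0 : (0 : ℝ) < t := by exact_mod_cast (by omega : 0 < t)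
  have ht2 : (2 : ℝ) ≤ t := by exact_mod_cast ht
  have hn64 : (64 : ℝ) ≤ n := by
    refine le_trans ?_ hn
    rw [le_div_iff₀ hε0]; linarith
  have hn0 : (0 : ℝ) < n := by linarith
  have hn1 : 1 ≤ n := by exact_mod_cast (by linarith : (1 : ℝ) ≤ n)
  have hnε : 1 ≤ ε * n := by rwa [div_le_iff₀ hε0, mul_comm] at hn
  have hBn : (B.card : ℝ) ≤ n := by
    have := Finset.card_le_univ B
    rw [Fintype.card_fin] at this
    exact_mod_cast this
  have hBpos : (0 : ℝ) < B.card := by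
    by_contra h
    have : (B.card : ℝ) = 0 := le_antisymm (not_lt.1 h) (by positivity)
    rw [this, mul_zero] at hr
    exact absurd (pow_pos ht0 2) (not_lt.2 hr)
  have htB : t ^ 2 ≤ B.card := by
    have : (t : ℝ) ^ 2 ≤ B.card := hr.trans (mul_le_of_le_one_left hBpos.le (by linarith))
    exact_mod_cast this
  have htn : (t : ℝ) ^ 2 ≤ ε * n := hr.trans (mul_le_mul_of_nonneg_left hBn hε0.le)
  obtain ⟨opt, hopt, hoptavg⟩ := exists_contracted_optimum hM hf hf0 hB hOI htB
  obtain ⟨R, hRdef⟩ : ∃ R : ℝ, R = n * f O := ⟨_, rfl⟩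
  have hR : 0 < R := by rw [hRdef]; positivity
  obtain ⟨σ, hσdef⟩ : ∃ σ : ℝ, σ = ε / (n : ℝ) ^ 2 := ⟨_, rfl⟩
  have hσ : 0 < σ := by rw [hσdef]; positivity
  have hlog : 0 ≤ Real.log (4 * (n : ℝ)) := Real.log_nonneg (by linarith)
  set l : ℝ := n + Real.log (4 * (n : ℝ)) with hl
  have hl0 : 0 < l := by linarith
  have hσ2 : σ ^ 2 * ((n : ℝ) ^ 4 / ε ^ 2) = 1 := by
    rw [hσdef]; field_simp
  -- The factor n⁴/ε² in m is 1/σ². The constants 2 and 8ν² then make both exponents, mσ²/2 and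
  -- mσ²/(2ν²), at least l.
  have hmσ : ∀ q : ℝ, q ≤ max 2 (8 * ν ^ 2) → q * l ≤ m * σ ^ 2 := by
    intro q hq
    calc q * l = q * ((n : ℝ) ^ 4 / ε ^ 2) * l * σ ^ 2 := by
          rw [show q * ((n : ℝ) ^ 4 / ε ^ 2) * l * σ ^ 2
            = q * l * (σ ^ 2 * ((n : ℝ) ^ 4 / ε ^ 2)) by ring, hσ2, mul_one]
      _ ≤ max 2 (8 * ν ^ 2) * ((n : ℝ) ^ 4 / ε ^ 2) * l * σ ^ 2 := by gcongr
      _ ≤ m * σ ^ 2 := by gcongr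
  have hm1 : l ≤ m * σ ^ 2 / 2 := by
    have := hmσ 2 (le_max_left _ _)
    linarith
  have hm2 : l ≤ m * σ ^ 2 / (2 * ν ^ 2) := by
    have := hmσ (8 * ν ^ 2) (le_max_right _ _)
    rw [le_div_iff₀ (by positivity)]
    have := mul_pos hl0 (pow_pos hν 2)
    linarith
  have hm0 : 0 < m := by
    rcases Nat.eq_zero_or_pos m with h | h
    · rw [h] at hm1; simp at hm1; linarith
    · exact h
  -- The assumption on ε against 2ν²/α is used here, to keep the exponential moments of the noise in
  -- their admissible range.
  have hασ : α * σ ≤ ν ^ 2 := by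
    have h1 : σ ≤ ε / 2 := by
      rw [hσdef]
      have h2 : (n : ℝ) ≤ (n : ℝ) ^ 2 := le_self_pow₀ (by linarith) two_ne_zero
      exact div_le_div_of_nonneg_left hε0.le (by norm_num) (by linarith)
    have := mul_le_mul_of_nonneg_left h1 hα
    linarith
  have hfail := two_pow_mul_exp_le hn1 hm1 hm2
  have h2n : 2 / (n : ℝ) ≤ 2 * ε := by
    rw [div_le_iff₀ hn0]; linarith
  have hmC : m ≤ (t ^ 2).choose t := by
    have : (m : ℝ) ≤ ((t ^ 2).choose t : ℝ) := by linarith [sq_nonneg (m : ℝ)]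
    exact_mod_cast this
  have hind : ∀ H ∈ Finset.powersetCard (t ^ 2) B, M.Indep (H : Set (Fin n)) := fun H hH =>
    hB.indep.subset (by exact_mod_cast (Finset.mem_powersetCard.1 hH).1)
  have hbd : ∀ H ∈ Finset.powersetCard (t ^ 2) B, ∀ S ⊆ activeSet M H,
      ∀ H' ∈ Finset.powersetCard t H, f (S ∪ H') ≤ R := fun H hH S hS H' hH' =>
    hRdef ▸ le_of_subset_activeSet hf hf0 hn1 hO (hind H hH) hS (Finset.mem_powersetCard.1 hH').1
  have hex : ∀ H : Finset (Fin n), ∃ φ : Ω → List (Finset (Fin n)) → ℝ,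
      H ∈ Finset.powersetCard (t ^ 2) B →
      (∀ ω Hs, ValidSample H t Hs → Hs.length = m →
        φ ω Hs = 1 - failure ξ f H (activeSet M H) t m σ R ν Hs ω) ∧
      Integrable (fun ω => ev 0 M (φ ω) (sampleDistinct H t m)) P ∧
      1 - 2 * ε ≤ ∫ ω, ev 0 M (φ ω) (sampleDistinct H t m) ∂P := by
    intro H
    by_cases hH : H ∈ Finset.powersetCard (t ^ 2) B
    · obtain ⟨φ, h1, h2, h3⟩ := exists_expected_success (M := M) hξ hν hα hf0
        (activeSet_subset M H) (t := t) (m := m)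
        (by rw [(Finset.mem_powersetCard.1 hH).2]; exact hC) hσ.le hR hασ (hbd H hH)
      exact ⟨φ, fun _ => ⟨h1, h2, by linarith⟩⟩
    · exact ⟨fun _ _ => 0, fun h => absurd h hH⟩
  choose φ hφ using hex
  obtain ⟨V, hV⟩ : ∃ V : Finset (Fin n) → ℝ, V = fun H =>
    (1 / Real.exp 1 - ε) * ((1 - 1 / t) * f (opt H)) - 9 * ε * f O := ⟨_, rfl⟩
  have hval : ∀ H ∈ Finset.powersetCard (t ^ 2) B, ∀ ω, ∀ Hs : List (Finset (Fin n)),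
      (∀ S ⊆ activeSet M H, |(Hs.map fun H' => noisyOracle ξ f ω (S ∪ H')).sum / (Hs.length : ℝ)
        - surrogate f H t S| ≤ 2 * (σ * R)) →
      V H ≤ ev (noisyOracle ξ f ω) M f (afterSampling H t Hs) := by
    intro H hH ω Hs hcl
    rw [hσdef, hRdef] at hcl
    rw [hV]
    exact le_ev_afterSampling_of_close hf hf0 hO hOpos (hind H hH) ht
      (Finset.mem_powersetCard.1 hH).2 hε0 hε hn htn hcl
      (hopt H (Finset.mem_powersetCard.1 hH).1).1 (hopt H (Finset.mem_powersetCard.1 hH).1).2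
  -- V(H) may be negative for an unlucky H. The expected value is nonnegative anyway, so the
  -- positive part is a valid guarantee and may be multiplied by the success term.
  have hred := le_expectedValue_metaAlgorithm (P := P) (ξ := ξ) (t := t) (m := m) hgreedy hf0 htB
    (W := fun H ω => max (V H) 0 * ev 0 M (φ H ω) (sampleDistinct H t m))
    (fun H hH => (hφ H hH).2.1.const_mul _)
    (fun H hH ω => le_ev_bind_afterSampling hν hσ hR hm0 
      ((Finset.mem_powersetCard.1 hH).2 ▸ hmC) hf0 (le_max_right _ _) ω
      (fun Hs _ _ hcl => max_le (hval H hH ω Hs hcl) (ev_nonneg hf0 _))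
      (fun Hs hv hlen => ((hφ H hH).1 ω Hs hv hlen).le))
  refine le_trans (ENNReal.ofReal_le_ofReal ?_) hred
  have hc : (0 : ℝ) < B.card.choose (t ^ 2) := by exact_mod_cast Nat.choose_pos htB
  have he := Real.exp_one_gt_d9
  have he' := Real.exp_one_lt_d9
  set q : ℝ := 1 / Real.exp 1 with hq
  have hq1 : q ≤ 1 := by rw [hq, div_le_one (Real.exp_pos 1)]; linarith
  have hqε : ε ≤ q := hε.trans (le_trans (by norm_num) quarter_le_one_div_exp)
  have hti : 1 / (t : ℝ) ≤ 1 := by rw [div_le_one ht0]; linarith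
  have hti0 : 0 < 1 / (t : ℝ) := by positivity
  have hterm : ∀ H ∈ Finset.powersetCard (t ^ 2) B,
      (1 - 2 * ε) * V H
        ≤ ∫ ω, max (V H) 0 * ev 0 M (φ H ω) (sampleDistinct H t m) ∂P := by
    intro H hH
    rw [integral_const_mul]
    have h1 := (hφ H hH).2.2
    calc (1 - 2 * ε) * V H ≤ (1 - 2 * ε) * max (V H) 0 :=
          mul_le_mul_of_nonneg_left (le_max_left _ _) (by linarith)
      _ ≤ _ := by
          rw [mul_comm]
          exact mul_le_mul_of_nonneg_left h1 (le_max_right _ _)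
  have havg : (1 - 2 * ε) * ((q - ε) * ((1 - 1 / t) * ((1 - ε) * f O)) - 9 * ε * f O)
      ≤ (B.card.choose (t ^ 2) : ℝ)⁻¹ * ∑ H ∈ Finset.powersetCard (t ^ 2) B,
        ∫ ω, max (V H) 0 * ev 0 M (φ H ω) (sampleDistinct H t m) ∂P := by
    refine le_trans ?_ (mul_le_mul_of_nonneg_left (Finset.sum_le_sum hterm) (by positivity))
    have hsum : (B.card.choose (t ^ 2) : ℝ)⁻¹ * ∑ H ∈ Finset.powersetCard (t ^ 2) B,
        (1 - 2 * ε) * V H = (1 - 2 * ε) * ((q - ε) * ((1 - 1 / t)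
          * ((B.card.choose (t ^ 2) : ℝ)⁻¹
            * ∑ H ∈ Finset.powersetCard (t ^ 2) B, f (opt H))) - 9 * ε * f O) := by
      simp only [hV]
      rw [← Finset.mul_sum, Finset.sum_sub_distrib, ← Finset.mul_sum, ← Finset.mul_sum,
        Finset.sum_const, Finset.card_powersetCard, nsmul_eq_mul]
      field_simp
    rw [hsum]
    have hfrac : (((t ^ 2 : ℕ) : ℝ)) / B.card ≤ ε := by
      rw [div_le_iff₀ hBpos]; push_cast; exact hr
    have h1 : (1 - ε) * f O ≤ (B.card.choose (t ^ 2) : ℝ)⁻¹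
            * ∑ H ∈ Finset.powersetCard (t ^ 2) B, f (opt H) :=
      (mul_le_mul_of_nonneg_right (by linarith) hOpos.le).trans hoptavg
    have h2 := mul_le_mul_of_nonneg_left h1 (by linarith : (0 : ℝ) ≤ 1 - 1 / t)
    have h3 := mul_le_mul_of_nonneg_left h2 (by linarith : (0 : ℝ) ≤ q - ε)
    exact mul_le_mul_of_nonneg_left (by linarith) (by linarith)
  refine le_trans ?_ havg
  have key := le_of_error_terms hε0.le (by linarith) hti0.le hti hqε hq1
  have := mul_le_mul_of_nonneg_right key hOpos.le
  linarith

end Noise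

end

section

/-! ### The parameters of the algorithm -/

/-- Absorption: C(q(k + 1), k + 1) = q C(q(k + 1) - 1, k) ≥ q C(qk, k). -/
lemma pow_le_choose_mul (q k : ℕ) (hq : 0 < q) : q ^ k ≤ (q * k).choose k := by
  induction k with
  | zero => simp
  | succ k ih =>
    obtain ⟨p, rfl⟩ : ∃ p, q = p + 1 := ⟨q - 1, by omega⟩
    have h1 : (p + 1) * (k + 1) = ((p + 1) * k + p) + 1 := by ring
    have h2 := Nat.add_one_mul_choose_eq ((p + 1) * k + p) k
    have h3 : ((p + 1) * k).choose k ≤ ((p + 1) * k + p).choose k :=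
      Nat.choose_le_choose k (by omega)
    rw [← h1] at h2
    have h4 : (p + 1) * ((p + 1) * k + p).choose k = ((p + 1) * (k + 1)).choose (k + 1) := by
      have : (k + 1) * ((p + 1) * ((p + 1) * k + p).choose k)
          = (k + 1) * ((p + 1) * (k + 1)).choose (k + 1) := by linarith
      exact Nat.eq_of_mul_eq_mul_left (by omega) this
    rw [← h4, pow_succ, mul_comm]
    exact Nat.mul_le_mul_left _ (ih.trans h3)

/-- The chain (4m)⁴ ≤ 16^t ≤ t^t ≤ C(t², t) is the reason for h = t²; t ≥ 16 enters in the middle.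
-/
lemma sq_add_lt_choose {m t : ℕ} (hm : 0 < m) (ht : 16 ≤ t) (hmt : 4 * m ≤ 2 ^ t) :
    m ^ 2 + m < (t ^ 2).choose t := by
  have h1 : (4 * m) ^ 4 ≤ (t ^ 2).choose t :=
    calc (4 * m) ^ 4 ≤ (2 ^ t) ^ 4 := Nat.pow_le_pow_left hmt 4
      _ = 16 ^ t := by rw [← pow_mul, mul_comm, pow_mul]; norm_num
      _ ≤ t ^ t := Nat.pow_le_pow_left ht t
      _ ≤ (t ^ 2).choose t := by rw [pow_two]; exact pow_le_choose_mul t t (by omega)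
  have h2 : m ≤ m ^ 2 := Nat.le_self_pow two_ne_zero m
  have h3 : m ^ 2 ≤ m ^ 4 := Nat.pow_le_pow_right hm (by norm_num)
  have h4 : (4 * m) ^ 4 = 256 * m ^ 4 := by ring
  have : 0 < m ^ 4 := by positivity
  omega

section

variable {n : ℕ} {ε ν : ℝ}

lemma le_sampleCount (n : ℕ) (ε ν : ℝ) :
    max 2 (8 * ν ^ 2) * ((n : ℝ) ^ 4 / ε ^ 2) * ((n : ℝ) + Real.log (4 * (n : ℝ)))
      ≤ sampleCount n ε ν := Nat.le_ceil _

lemma two_mul_le_sampleCount (hε : 0 < ε) (hn : 1 ≤ n) :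
    2 * ((n : ℝ) ^ 5 / ε ^ 2) ≤ sampleCount n ε ν := by
  refine le_trans ?_ (le_sampleCount n ε ν)
  have hn' : (1 : ℝ) ≤ n := by exact_mod_cast hn
  have hlog : 0 ≤ Real.log (4 * (n : ℝ)) := Real.log_nonneg (by linarith)
  calc 2 * ((n : ℝ) ^ 5 / ε ^ 2) = 2 * ((n : ℝ) ^ 4 / ε ^ 2) * n := by ring
    _ ≤ _ := by gcongr; exacts [le_max_left _ _, by linarith]

lemma sampleCount_le (hε : 0 < ε) (hn : 1 ≤ n) :
    (sampleCount n ε ν : ℝ) ≤ 5 * max 2 (8 * ν ^ 2) * ((n : ℝ) ^ 5 / ε ^ 2) + 1 := by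
  have hn' : (1 : ℝ) ≤ n := by exact_mod_cast hn
  have hlog : 0 ≤ Real.log (4 * (n : ℝ)) := Real.log_nonneg (by linarith)
  have hlog' : Real.log (4 * (n : ℝ)) ≤ 4 * n := Real.log_le_self (by positivity)
  have hmax : 0 < max 2 (8 * ν ^ 2) := lt_of_lt_of_le two_pos (le_max_left _ _)
  refine (Nat.ceil_lt_add_one (by positivity)).le.trans ?_
  have : max 2 (8 * ν ^ 2) * ((n : ℝ) ^ 4 / ε ^ 2) * ((n : ℝ) + Real.log (4 * (n : ℝ)))
      ≤ max 2 (8 * ν ^ 2) * ((n : ℝ) ^ 4 / ε ^ 2) * (5 * n) := by gcongr; linarith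
  calc _ ≤ max 2 (8 * ν ^ 2) * ((n : ℝ) ^ 4 / ε ^ 2) * (5 * n) + 1 := by linarith
    _ = _ := by ring

lemma four_mul_sampleCount_le (n : ℕ) (ε ν : ℝ) :
    4 * sampleCount n ε ν ≤ 2 ^ smoothingSize n ε ν :=
  Nat.le_pow_clog (by norm_num) _

/-- The requirements on the parameters hold as soon as `ε` is small. -/
lemma parameters_valid (hε0 : 0 < ε) (hε : ε ≤ 1 / 64) (hn : 1 / ε ≤ n) :
    16 ≤ smoothingSize n ε ν ∧
    ((sampleCount n ε ν : ℝ) ^ 2 + sampleCount n ε ν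
      < ((smoothingSize n ε ν ^ 2).choose (smoothingSize n ε ν) : ℝ)) ∧
    Real.log (n / ε) ≤ smoothingSize n ε ν := by
  have hn64 : (64 : ℝ) ≤ n := by
    refine le_trans ?_ hn
    rw [le_div_iff₀ hε0]; linarith
  have hn1 : 1 ≤ n := by exact_mod_cast (by linarith : (1 : ℝ) ≤ n)
  have hn0 : (0 : ℝ) < n := by linarith
  have hlow := two_mul_le_sampleCount (ν := ν) hε0 hn1
  have hx : (n : ℝ) / ε ≤ (n : ℝ) ^ 5 / ε ^ 2 := by
    apply div_le_div₀ (by positivity) (le_self_pow₀ (by linarith) (by norm_num)) (by positivity)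
    exact pow_le_of_le_one hε0.le (by linarith) two_ne_zero
  have hbig : (2 : ℝ) ^ 14 ≤ (n : ℝ) ^ 5 / ε ^ 2 := by
    have h1 : (64 : ℝ) ^ 5 ≤ (n : ℝ) ^ 5 := pow_le_pow_left₀ (by norm_num) hn64 5
    rw [le_div_iff₀ (by positivity)]
    have h2 : ε ^ 2 ≤ 1 := pow_le_one₀ hε0.le (by linarith)
    norm_num at h1 ⊢
    linarith
  set m := sampleCount n ε ν with hm
  set t := smoothingSize n ε ν with ht
  have h4m : 4 * m ≤ 2 ^ t := four_mul_sampleCount_le n ε ν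
  have hmbig : 2 ^ 14 ≤ m := by
    have : (2 : ℝ) ^ 14 ≤ m := by linarith
    exact_mod_cast this
  have ht16 : 16 ≤ t := by
    have : 2 ^ 15 < 2 ^ t := lt_of_lt_of_le (by norm_num at hmbig ⊢; omega) h4m
    have := (Nat.pow_lt_pow_iff_right (by norm_num : 1 < 2)).1 this
    omega
  refine ⟨ht16, by exact_mod_cast sq_add_lt_choose (by omega) ht16 h4m, ?_⟩
  rw [Real.log_le_iff_le_exp (by positivity)]
  have h1 : (n : ℝ) / ε ≤ 2 ^ t := by
    have : (4 * m : ℝ) ≤ 2 ^ t := by exact_mod_cast h4m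
    have h0 : (0 : ℝ) ≤ m := by positivity
    linarith
  refine h1.trans ?_
  rw [show (t : ℝ) = t * 1 by ring, Real.exp_nat_mul]
  have := Real.exp_one_gt_d9
  exact pow_le_pow_left₀ (by norm_num) (by linarith) t

/-- The sets added by the surrogate function have logarithmic size. -/
lemma smoothingSize_le (hε0 : 0 < ε) (hε : ε ≤ 1 / 64) (hn : 1 / ε ≤ n) :
    (smoothingSize n ε ν : ℝ)
      ≤ (11 + 2 * Real.log (24 * max 2 (8 * ν ^ 2))) * Real.log (n / ε) := by
  have hn64 : (64 : ℝ) ≤ n := by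
    refine le_trans ?_ hn
    rw [le_div_iff₀ hε0]; linarith
  have hn1 : 1 ≤ n := by exact_mod_cast (by linarith : (1 : ℝ) ≤ n)
  have hn0 : (0 : ℝ) < n := by linarith
  have hup := sampleCount_le (ν := ν) hε0 hn1
  have hlow := two_mul_le_sampleCount (ν := ν) hε0 hn1
  set A := max 2 (8 * ν ^ 2) with hA
  have hA2 : 2 ≤ A := le_max_left _ _
  set x : ℝ := n / ε with hx
  have hx64 : 64 ≤ x := by
    rw [hx, le_div_iff₀ hε0]; linarith
  have hx1 : 1 ≤ x := by linarith
  have hxp : (n : ℝ) ^ 5 / ε ^ 2 ≤ x ^ 5 := by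
    rw [hx, div_pow]
    refine div_le_div_of_nonneg_left (by positivity) (by positivity) ?_
    exact pow_le_pow_of_le_one hε0.le (by linarith) (by norm_num)
  have hx5 : 1 ≤ x ^ 5 := one_le_pow₀ hx1
  have hL : 1 ≤ Real.log x := by
    rw [Real.le_log_iff_exp_le (by linarith)]
    have := Real.exp_one_lt_d9
    linarith
  set m := sampleCount n ε ν with hm
  set t := smoothingSize n ε ν with ht
  have h4m : (4 * m : ℝ) ≤ 24 * A * x ^ 5 := by
    have h1 : 5 * A * ((n : ℝ) ^ 5 / ε ^ 2) ≤ 5 * A * x ^ 5 := by gcongr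
    have h2 : 1 ≤ A * x ^ 5 := one_le_mul_of_one_le_of_one_le (by linarith) hx5
    linarith
  have hmpos : (0 : ℝ) < m := lt_of_lt_of_le (by positivity) hlow
  have hmpos' : 0 < m := by exact_mod_cast hmpos
  -- Minimality of t gives 2^(t - 1) < 4m ≤ 24A x⁵ with x = n/ε. Taking logarithms and using log 2 ≥
  -- 1/2 yields t ≤ 1 + 2 log(24A) + 10 log x, and log x ≥ 1 absorbs the constants.
  have hpow : 2 ^ (t - 1) < 4 * m := Nat.pow_pred_clog_lt_self (by norm_num) (by omega)
  have hpow' : (2 : ℝ) ^ (t - 1) ≤ 24 * A * x ^ 5 :=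
    le_trans (by exact_mod_cast hpow.le) h4m
  have hlog := Real.log_le_log (by positivity) hpow'
  rw [Real.log_pow, Real.log_mul (by positivity) (by positivity), Real.log_pow] at hlog
  have hl2 := Real.log_two_gt_d9
  have htle : (t : ℝ) - 1 ≤ ((t - 1 : ℕ) : ℝ) := by
    have : t ≤ (t - 1) + 1 := by omega
    have : (t : ℝ) ≤ ((t - 1 : ℕ) : ℝ) + 1 := by exact_mod_cast this
    linarith
  have h5 : ((t - 1 : ℕ) : ℝ) * (1 / 2) ≤ ((t - 1 : ℕ) : ℝ) * Real.log 2 :=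
    mul_le_mul_of_nonneg_left (by linarith) (by positivity)
  have hlA : 0 ≤ Real.log (24 * A) := Real.log_nonneg (by linarith)
  have h6 : Real.log (24 * A) ≤ Real.log (24 * A) * Real.log x := le_mul_of_one_le_right hlA hL
  push_cast at hlog
  linarith

end

end

section

open Alg

variable {n : ℕ} {g : Finset (Fin n) → ℝ} {M : Matroid (Fin n)} {Y : ℕ}

/-! ### Running time

Every quantity that governs the running time is at most `Y`; the bounds are polynomials in `Y`. -/

lemma length_elems_le (S : Finset (Fin n)) : (elems S).length ≤ n := by
  rw [length_elems]
  simpa using Finset.card_le_univ S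

lemma time_greedyIndep_le {indep : Finset (Fin n) → Alg n Bool} (hY : n + 1 ≤ Y)
    (hT : ∀ S, time g M (indep S) ≤ 2 * Y) {L : List (Fin n)} (hL : L.length ≤ n) :
    time g M (greedyIndep indep L) ≤ 4 * Y ^ 2 := by
  refine (time_forList_le (T := Y + 2 * Y) L (fun I i _ => ?_) ∅).trans ?_
  · rw [time_charge_bind]
    have := time_bind_le_of_forall (hT (insert i I)) (T₂ := 0)
      (F := fun b => if b = true then (pure (insert i I) : Alg n (Finset (Fin n))) else pure I)
      (fun b => by cases b <;> simp)
    omega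
  · calc L.length * (Y + 2 * Y + 1) ≤ Y * (Y + 2 * Y + Y) := by gcongr <;> omega
      _ = 4 * Y ^ 2 := by ring

lemma time_sampleSubset_le_mul (L : List (Fin n)) (k : ℕ) {T : ℕ} (hT : n + L.length + 3 ≤ T) :
    time g M (sampleSubset L k) ≤ L.length * T := by
  induction L generalizing k with
  | nil => simp [sampleSubset]
  | cons x L ih =>
    simp only [List.length_cons] at hT
    simp only [sampleSubset, time_charge_bind, List.length_cons]
    refine (Nat.add_le_add_left (time_bind_le_of_forall (T₁ := 1) (T₂ := L.length * T) (by simp)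
      fun b => ?_) _).trans (by linarith)
    cases b with
    | true =>
      rw [if_pos rfl]
      exact time_bind_le_of_forall (T₂ := 0) (ih (k - 1) (by omega)) fun S => by simp
    | false => simpa using ih k (by omega)

lemma time_sampleSubset_le (hY : n + 1 ≤ Y) {L : List (Fin n)} (hL : L.length ≤ n) (k : ℕ) :
    time g M (sampleSubset L k) ≤ 3 * Y ^ 2 := by
  refine (time_sampleSubset_le_mul L k (T := 3 * Y) (by omega)).trans ?_
  calc L.length * (3 * Y) ≤ Y * (3 * Y) := by gcongr; omega
    _ = 3 * Y ^ 2 := by ring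

lemma time_sampleAvoiding_le_mul (L : List (Fin n)) (k : ℕ) (avoid : List (Finset (Fin n)))
    {T : ℕ} (hT : 2 * (L.length + 1) ^ 2 + (n + 1) * (avoid.length + 1) + 1 ≤ T) :
    time g M (sampleAvoiding L k avoid) ≤ L.length * T := by
  induction L generalizing k avoid with
  | nil => simp [sampleAvoiding]
  | cons x L ih =>
    simp only [List.length_cons] at hT
    simp only [sampleAvoiding, time_charge_bind, List.length_cons]
    have hstep : ∀ A : List (Finset (Fin n)), A.length ≤ avoid.length →
        2 * (L.length + 1) ^ 2 + (n + 1) * (A.length + 1) + 1 ≤ T := by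
      intro A hA
      refine le_trans ?_ hT
      gcongr
      omega
    refine (Nat.add_le_add_left (time_bind_le_of_forall (T₁ := 1) (T₂ := L.length * T) (by simp)
      fun b => ?_) _).trans (by linarith)
    cases b with
    | true =>
      rw [if_pos rfl]
      exact time_bind_le_of_forall (T₂ := 0)
        (ih (k - 1) _ (hstep _ (List.length_filter_le _ _))) fun S => by simp
    | false => simpa using ih k _ (hstep _ (List.length_filter_le _ _))

lemma time_sampleAvoiding_le (hY : n + 1 ≤ Y) {L : List (Fin n)} (hL : L.length ≤ n) (k : ℕ)
    {avoid : List (Finset (Fin n))} (ha : avoid.length + 1 ≤ Y) :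
    time g M (sampleAvoiding L k avoid) ≤ 4 * Y ^ 3 := by
  have hT : 2 * (L.length + 1) ^ 2 + (n + 1) * (avoid.length + 1) + 1 ≤ 4 * Y ^ 2 :=
    calc 2 * (L.length + 1) ^ 2 + (n + 1) * (avoid.length + 1) + 1
        ≤ 2 * Y ^ 2 + Y * Y + Y ^ 2 := by
          gcongr
          · omega
          · exact Nat.one_le_pow _ _ (by omega)
      _ = 4 * Y ^ 2 := by ring
  refine (time_sampleAvoiding_le_mul L k avoid hT).trans ?_
  calc L.length * (4 * Y ^ 2) ≤ Y * (4 * Y ^ 2) := by gcongr; omega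
    _ = 4 * Y ^ 3 := by ring

lemma sat_length_sampleDistinct (H : Finset (Fin n)) (t m : ℕ) :
    Sat g M (fun Hs => Hs.length = m) (sampleDistinct H t m) := by
  have := sat_loop (g := g) (M := M) (step := fun Hs => do
      charge (n + 1)
      let H' ← sampleAvoiding (elems H) t Hs
      pure (H' :: Hs)) (fun k Hs => Hs.length = k) (fun k Hs hk => by
      simp only [sat_bind, sat_charge, sat_pure, List.length_cons]
      exact sat_of_forall (fun _ => by rw [hk]) _) m 0 [] rfl
  simpa [sampleDistinct] using this

lemma time_sampleDistinct_le (hY : n + 1 ≤ Y) (H : Finset (Fin n)) (t : ℕ) {m : ℕ}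
    (hm : m ≤ Y) : time g M (sampleDistinct H t m) ≤ 6 * Y ^ 4 := by
  refine (time_loop_le (T := Y + 4 * Y ^ 3) (fun k Hs => Hs.length = k) m (fun k Hs hk => ?_)
    (fun k Hs hkm hk => ?_) m 0 [] rfl (by omega)).trans ?_
  · simp only [sat_bind, sat_charge, sat_pure, List.length_cons]
    exact sat_of_forall (fun _ => by rw [hk]) _
  · rw [time_charge_bind]
    have := time_bind_le_of_forall (g := g) (M := M) (T₂ := 0)
      (time_sampleAvoiding_le hY (length_elems_le H) t (avoid := Hs) (by omega))
      (F := fun H' => pure (H' :: Hs)) (fun _ => by simp)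
    omega
  · have h1 : Y ≤ Y ^ 3 := Nat.le_self_pow (by norm_num) Y
    have h2 : 1 ≤ Y ^ 3 := by omega
    calc m * (Y + 4 * Y ^ 3 + 1) ≤ Y * (Y ^ 3 + 4 * Y ^ 3 + Y ^ 3) := by gcongr
      _ = 6 * Y ^ 4 := by ring

lemma time_sampledSurrogate_le (hY : n + 1 ≤ Y) {Hs : List (Finset (Fin n))}
    (hm : Hs.length ≤ Y) (S : Finset (Fin n)) :
    time g M (sampledSurrogate Hs S) ≤ 4 * Y ^ 2 := by
  have h1 : time g M (forList (fun (s : ℝ) H' => do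
      charge (n + 1)
      let v ← queryValue (S ∪ H')
      pure (s + v)) Hs 0) ≤ Hs.length * (2 * Y + 1) := by
    refine time_forList_le Hs (fun s H' _ => ?_) 0
    rw [time_charge_bind]
    have := time_bind_le_of_forall (g := g) (M := M) (c := queryValue (S ∪ H')) (T₁ := n + 1)
      (T₂ := 0) (by simp) (F := fun v => pure (s + v)) (fun _ => by simp)
    omega
  refine (time_bind_le_of_forall (T₂ := 1) h1 fun s => by simp).trans ?_
  have h2 : 1 ≤ Y ^ 2 := Nat.one_le_pow _ _ (by omega)
  calc Hs.length * (2 * Y + 1) + 1 ≤ Y * (2 * Y + Y) + Y ^ 2 := by gcongr; omega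
    _ = 4 * Y ^ 2 := by ring

lemma time_sampleSet_le (hY : n + 1 ≤ Y) {E : List (Fin n)} (hE : E.length ≤ n)
    (x : Fin n → ℝ) : time g M (sampleSet E x) ≤ 3 * Y := by
  refine (time_forList_le (T := 2) E (fun R i _ => ?_) ∅).trans (by omega)
  exact time_bind_le_of_forall (T₁ := 1) (T₂ := 1) (by simp) fun b => by cases b <;> simp

section Greedy

variable {E : List (Fin n)} {fhat : Finset (Fin n) → Alg n ℝ}
  {indep : Finset (Fin n) → Alg n Bool} {K : ℕ}

lemma time_estimateMarginal_le (hY : n + 1 ≤ Y) (hE : E.length ≤ n)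
    (hf : ∀ S, time g M (fhat S) ≤ 4 * Y ^ 2) (hK : K ≤ Y) (x : Fin n → ℝ) (i : Fin n) :
    time g M (estimateMarginal E fhat K x i) ≤ 14 * Y ^ 3 := by
  have hstep : ∀ s : ℝ, time g M (do
      let R ← sampleSet E x
      charge (n + 1)
      let a ← fhat (insert i R)
      let b ← fhat R
      pure (s + (a - b))) ≤ 3 * Y + (Y + 8 * Y ^ 2) := by
    intro s
    refine time_bind_le_of_forall (time_sampleSet_le hY hE x) fun R => ?_
    rw [time_charge_bind]
    have := time_bind_le_of_forall (hf (insert i R)) (T₂ := 4 * Y ^ 2)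
      (F := fun a => do let b ← fhat R; pure (s + (a - b)))
      fun a => time_bind_le_of_forall (T₂ := 0) (hf R) fun b => by simp
    omega
  refine (time_bind_le_of_forall (T₂ := 1) (time_loop_le_of_forall hstep K 0)
    fun s => by simp).trans ?_
  have h1 : Y ≤ Y ^ 2 := Nat.le_self_pow (by norm_num) Y
  have h2 : 1 ≤ Y ^ 3 := Nat.one_le_pow _ _ (by omega)
  calc K * (3 * Y + (Y + 8 * Y ^ 2) + 1) + 1
      ≤ Y * (3 * Y ^ 2 + (Y ^ 2 + 8 * Y ^ 2) + Y ^ 2) + Y ^ 3 := by gcongr; omega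
    _ = 14 * Y ^ 3 := by ring

lemma time_maxWeightIndep_le (hY : n + 1 ≤ Y) (hE : E.length ≤ n)
    (hT : ∀ S, time g M (indep S) ≤ 2 * Y) (w : Fin n → ℝ) :
    time g M (maxWeightIndep E indep w) ≤ 5 * Y ^ 2 := by
  unfold maxWeightIndep
  rw [time_charge_bind]
  have h1 := time_greedyIndep_le (g := g) (M := M) hY hT
    (L := (E.filter fun i => 0 < w i).insertionSort fun i j => w j ≤ w i) (by
      rw [List.length_insertionSort]
      exact (List.length_filter_le _ _).trans hE)
  have h2 : (E.length + 1) ^ 2 ≤ Y ^ 2 := Nat.pow_le_pow_left (by omega) 2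
  omega

lemma time_greedyStep_le (hY : n + 1 ≤ Y) (hE : E.length ≤ n)
    (hf : ∀ S, time g M (fhat S) ≤ 4 * Y ^ 2) (hK : K ≤ Y)
    (hT : ∀ S, time g M (indep S) ≤ 2 * Y) (δ : ℝ) (s : GreedyState n) :
    time g M (greedyStep E fhat indep δ K s) ≤ 24 * Y ^ 4 := by
  have hw : time g M (forList (fun (w : Fin n → ℝ) i => do
      let a ← estimateMarginal E fhat K s.x i
      charge (n + 1)
      pure (Function.update w i a)) E (fun _ => 0)) ≤ E.length * (14 * Y ^ 3 + (n + 1) + 1) :=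
    time_forList_le E (fun w i _ => time_bind_le_of_forall
      (time_estimateMarginal_le hY hE hf hK s.x i) fun a => by simp) _
  refine (time_bind_le_of_forall (T₂ := 5 * Y ^ 2 + 3 * (n + 1) ^ 2) hw fun w =>
    time_bind_le_of_forall (time_maxWeightIndep_le hY hE hT w) fun I => by simp).trans ?_
  have h1 : Y ≤ Y ^ 3 := Nat.le_self_pow (by norm_num) Y
  have h2 : 1 ≤ Y ^ 3 := by omega
  have h3 : Y ^ 2 ≤ Y ^ 4 := Nat.pow_le_pow_right (by omega) (by norm_num)
  have h4 : (n + 1) ^ 2 ≤ Y ^ 4 := (Nat.pow_le_pow_left hY 2).trans h3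
  calc E.length * (14 * Y ^ 3 + (n + 1) + 1) + (5 * Y ^ 2 + 3 * (n + 1) ^ 2)
      ≤ Y * (14 * Y ^ 3 + Y ^ 3 + Y ^ 3) + (5 * Y ^ 4 + 3 * Y ^ 4) := by gcongr <;> omega
    _ = 24 * Y ^ 4 := by ring

/-- A chain of prefixes has at most n + 1 members. Over at most n⁴ steps this limits the number of
sets to be merged in the rounding. -/
lemma sat_length_parts_greedyStep (δ : ℝ) (s : GreedyState n) :
    Sat g M (fun s' => s'.parts.length ≤ s.parts.length + (n + 1))
      (greedyStep E fhat indep δ K s) := by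
  unfold greedyStep
  simp only [sat_bind, sat_charge, sat_pure]
  refine sat_of_forall (fun w => sat_of_forall (fun I => ?_) _) _
  rw [List.length_append, List.length_map, length_prefixChain, List.length_insertionSort]
  have := length_elems_le I
  omega

lemma time_exchangeStep_le (hY : n + 1 ≤ Y) (hT : ∀ S, time g M (indep S) ≤ 2 * Y) (a b : ℝ)
    (IJ : Finset (Fin n) × Finset (Fin n)) :
    time g M (exchangeStep indep a b IJ) ≤ 15 * Y ^ 2 := by
  obtain ⟨I, J⟩ := IJ
  have hlen : ∀ S : Finset (Fin n), (elems S).length * (8 * Y + 1) ≤ 9 * Y ^ 2 := fun S =>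
    calc (elems S).length * (8 * Y + 1) ≤ Y * (8 * Y + Y) := by
          have := length_elems_le S
          gcongr <;> omega
      _ = 9 * Y ^ 2 := by ring
  have hfind : ∀ (test : Fin n → Alg n Bool) (S : Finset (Fin n))
      (F : Option (Fin n) → Alg n (Finset (Fin n) × Finset (Fin n))),
      (∀ e, time g M (test e) ≤ 8 * Y) → (∀ r, time g M (F r) ≤ 1) →
      time g M (findFirst test (elems S) >>= F) ≤ 9 * Y ^ 2 + 1 := fun test S F h1 h2 =>
    time_bind_le_of_forall ((time_findFirst_le _ h1).trans (hlen S)) h2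
  have hins : ∀ A : Finset (Fin n), ∀ e,
      time g M (do charge (n + 1); indep (insert e A)) ≤ 8 * Y := by
    intro A e
    rw [time_charge_bind]
    have := hT (insert e A)
    omega
  have htoss : ∀ (p : ℝ) (A B : Finset (Fin n) × Finset (Fin n)),
      time g M (do let c ← toss p; if c then pure A else pure B) ≤ 1 := fun p A B =>
    time_bind_le_of_forall (T₁ := 1) (T₂ := 0) (by simp) fun c => by cases c <;> simp
  have hY2 : Y ≤ Y ^ 2 := Nat.le_self_pow (by norm_num) Y
  unfold exchangeStep
  rw [time_charge_bind]
  have key : ∀ c : Alg n (Finset (Fin n) × Finset (Fin n)), time g M c ≤ 9 * Y ^ 2 + 1 →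
      5 * (n + 1) + time g M c ≤ 15 * Y ^ 2 := fun c hc => by omega
  apply key
  dsimp only
  split_ifs with h1 h2
  · refine hfind _ _ _ (hins I) fun r => ?_
    cases r with
    | none => simp
    | some e => exact htoss _ _ _
  · refine hfind _ _ _ (hins J) fun r => ?_
    cases r with
    | none => simp
    | some e => exact htoss _ _ _
  · cases elems (I \ J) with
    | nil => simp
    | cons e L =>
      refine hfind _ _ _ (fun e' => ?_) fun r => ?_
      · rw [time_charge_bind]
        have := time_bind_le_of_forall (hT (insert e' (I.erase e))) (T₂ := 2 * Y)
          (F := fun p => do let q ← indep (insert e (J.erase e')); pure (p && q))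
          fun p => time_bind_le_of_forall (T₂ := 0) (hT _) fun q => by simp
        omega
      · cases r with
        | none => simp
        | some e' => exact htoss _ _ _

lemma time_roundParts_le (hY : n + 1 ≤ Y) (hT : ∀ S, time g M (indep S) ≤ 2 * Y)
    {parts : List (ℝ × Finset (Fin n))} (hp : parts.length ≤ Y ^ 5) :
    time g M (roundParts indep parts) ≤ 19 * Y ^ 8 := by
  have h1 : time g M (forList (fun (s : ℝ × Finset (Fin n)) q => do
      let IJ ← loop (exchangeStep indep s.1 q.1) n (s.2, q.2)
      charge (n + 2)
      pure (s.1 + q.1, IJ.1)) parts (0, ∅))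
      ≤ parts.length * (n * (15 * Y ^ 2 + 1) + (n + 2) + 1) :=
    time_forList_le parts (fun s q _ => time_bind_le_of_forall
      (time_loop_le_of_forall (time_exchangeStep_le hY hT s.1 q.1) n _) fun IJ => by simp) _
  refine (time_bind_le_of_forall (T₂ := 0) h1 fun s => by simp).trans ?_
  have h2 : Y ≤ Y ^ 3 := Nat.le_self_pow (by norm_num) Y
  have h3 : 1 ≤ Y ^ 2 := Nat.one_le_pow _ _ (by omega)
  calc parts.length * (n * (15 * Y ^ 2 + 1) + (n + 2) + 1) + 0
      ≤ Y ^ 5 * (Y * (15 * Y ^ 2 + Y ^ 2) + 2 * Y ^ 3 + Y ^ 3) := by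
        rw [add_zero]
        gcongr <;> omega
    _ = 19 * Y ^ 8 := by ring

lemma time_measuredContinuousGreedy_le (hY : n + 1 ≤ Y) (hE : E.length ≤ n)
    (hf : ∀ S, time g M (fhat S) ≤ 4 * Y ^ 2) (hT : ∀ S, time g M (indep S) ≤ 2 * Y)
    (hK : 20 * n ^ 9 + 1 ≤ Y) :
    time g M (measuredContinuousGreedy E fhat indep) ≤ 45 * Y ^ 8 := by
  unfold measuredContinuousGreedy
  obtain ⟨δ, hδ⟩ : ∃ δ : ℝ, δ = 1 / (E.length : ℝ) ^ 4 := ⟨_, rfl⟩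
  -- With N the length of `E`, 10/δ² = 10N⁸ and log(2N) ≤ 2N; this is the origin of 20n⁹ + 1.
  have hKY : ⌈10 / δ ^ 2 * Real.log (2 * (E.length : ℝ))⌉₊ ≤ Y := by
    refine le_trans ?_ hK
    rw [Nat.ceil_le]
    push_cast
    have hEn : (E.length : ℝ) ≤ n := by exact_mod_cast hE
    have h1 : 10 / δ ^ 2 = 10 * (E.length : ℝ) ^ 8 := by
      rw [hδ, div_pow, one_pow, ← pow_mul, div_div_eq_mul_div, div_one]
    rw [h1]
    have h2 : Real.log (2 * (E.length : ℝ)) ≤ 2 * E.length := Real.log_le_self (by positivity)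
    calc 10 * (E.length : ℝ) ^ 8 * Real.log (2 * (E.length : ℝ))
        ≤ 10 * (E.length : ℝ) ^ 8 * (2 * E.length) := by gcongr
      _ = 20 * (E.length : ℝ) ^ 9 := by ring
      _ ≤ 20 * (n : ℝ) ^ 9 := by gcongr
      _ ≤ 20 * (n : ℝ) ^ 9 + 1 := by linarith
  rw [← hδ]
  dsimp only
  obtain ⟨K, hKdef⟩ : ∃ K : ℕ, K = ⌈10 / δ ^ 2 * Real.log (2 * (E.length : ℝ))⌉₊ := ⟨_, rfl⟩
  rw [← hKdef] at hKY ⊢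
  rw [time_charge_bind]
  have hN : E.length ^ 4 ≤ Y ^ 4 := Nat.pow_le_pow_left (by omega) 4
  have hlen := sat_loop (g := g) (M := M) (step := greedyStep E fhat indep δ K)
    (fun k s => s.parts.length ≤ k * (n + 1))
    (fun k s hs => (sat_length_parts_greedyStep δ s).mono fun s' hs' => by
      rw [add_mul, one_mul]; omega) (E.length ^ 4) 0 { x := fun _ => 0, parts := [] } (by simp)
  have := time_bind_le (time_loop_le_of_forall (time_greedyStep_le hY hE hf hKY hT δ)
      (E.length ^ 4) { x := fun _ => 0, parts := [] })
    (F := fun s => roundParts indep s.parts) (T₂ := 19 * Y ^ 8)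
    (hlen.mono fun s hs => time_roundParts_le hY hT (hs.trans (by
      calc (0 + E.length ^ 4) * (n + 1) ≤ Y ^ 4 * Y := by rw [zero_add]; gcongr
        _ = Y ^ 5 := by ring)))
  have h3 : 1 ≤ Y ^ 4 := Nat.one_le_pow _ _ (by omega)
  have h4 : Y ≤ Y ^ 8 := Nat.le_self_pow (by norm_num) Y
  have h5 : E.length ^ 4 * (24 * Y ^ 4 + 1) ≤ 25 * Y ^ 8 :=
    calc E.length ^ 4 * (24 * Y ^ 4 + 1) ≤ Y ^ 4 * (24 * Y ^ 4 + Y ^ 4) := by gcongr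
      _ = 25 * Y ^ 8 := by ring
  omega

end Greedy

lemma time_metaAlgorithm_le (hY : n + 1 ≤ Y) (hK : 20 * n ^ 9 + 1 ≤ Y) {m : ℕ} (hm : m ≤ Y)
    (h t : ℕ) :
    time g M (metaAlgorithm measuredContinuousGreedy h t m) ≤ 66 * Y ^ 8 := by
  have h2 : Y ^ 2 ≤ Y ^ 8 := Nat.pow_le_pow_right (by omega) (by norm_num)
  have h4 : Y ^ 4 ≤ Y ^ 8 := Nat.pow_le_pow_right (by omega) (by norm_num)
  have h1 : Y ≤ Y ^ 8 := Nat.le_self_pow (by norm_num) Y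
  have hafter : ∀ H Hs, Hs.length ≤ Y →
      time g M (afterSampling H t Hs) ≤ 2 * (n + 1) + (45 * Y ^ 8 + (3 * Y ^ 2 + (n + 1))) := by
    intro H Hs hHs
    unfold afterSampling
    rw [time_charge_bind]
    refine Nat.add_le_add_left (time_bind_le_of_forall
      (time_measuredContinuousGreedy_le hY (length_elems_le _) (time_sampledSurrogate_le hY hHs)
        (fun S => ?_) hK)
      fun S => time_bind_le_of_forall (time_sampleSubset_le hY (length_elems_le H) t)
        fun H' => by simp) _
    rw [time_charge_bind, time_queryIndep]
    omega
  have htail : ∀ H, time g M (sampleDistinct H t m >>= afterSampling H t)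
      ≤ 6 * Y ^ 4 + (2 * (n + 1) + (45 * Y ^ 8 + (3 * Y ^ 2 + (n + 1)))) := fun H =>
    time_bind_le (time_sampleDistinct_le hY H t hm)
      ((sat_length_sampleDistinct H t m).mono fun Hs hHs => hafter H Hs (by omega))
  have htotal : time g M (metaAlgorithm measuredContinuousGreedy h t m)
      ≤ 4 * Y ^ 2 + (2 * (n + 1) + (3 * Y ^ 2
        + (6 * Y ^ 4 + (2 * (n + 1) + (45 * Y ^ 8 + (3 * Y ^ 2 + (n + 1))))))) := by
    refine time_bind_le_of_forall (time_greedyIndep_le hY (fun S => ?_) (by simp)) fun B => ?_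
    · rw [time_queryIndep]; omega
    · rw [time_charge_bind]
      exact Nat.add_le_add_left (time_bind_le_of_forall
        (time_sampleSubset_le hY (length_elems_le B) h) fun H => htail H) _
  omega

/-- The running time is polynomial in `n`, `1 / ε` and `ν`. -/
lemma time_noisyContinuousGreedy_le {ε ν : ℝ} (hε : 0 < ε) (hν : 0 < ν) :
    (time g M (noisyContinuousGreedy n ε ν) : ℝ)
      ≤ 66 * 3 ^ 120 * (1 + (n : ℝ) + 1 / ε + ν) ^ 120 := by
  set X : ℝ := 1 + (n : ℝ) + 1 / ε + ν with hX
  have hn0 : (0 : ℝ) ≤ n := by positivity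
  have hε1 : 0 < 1 / ε := by positivity
  have hX1 : 1 ≤ X := by linarith
  obtain ⟨Z, hZ⟩ : ∃ Z : ℕ, Z = ⌈X⌉₊ + 1 := ⟨_, rfl⟩
  have hXZ : X ≤ Z := by
    rw [hZ]; push_cast
    exact (Nat.le_ceil X).trans (by linarith)
  have hZX : (Z : ℝ) ≤ 3 * X := by
    rw [hZ]; push_cast
    have := Nat.ceil_lt_add_one (by linarith : 0 ≤ X)
    linarith
  have hceil : 1 ≤ ⌈X⌉₊ := Nat.one_le_ceil_iff.2 (by linarith)
  have hZ2 : 2 ≤ Z := by omega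
  have hZ2' : (2 : ℝ) ≤ Z := by exact_mod_cast hZ2
  have hnZ : n + 1 ≤ Z := by
    have : (n : ℝ) + 1 ≤ Z := by linarith
    exact_mod_cast this
  -- Since Z ≥ 2, numerical constants are absorbed into powers of Z. Then Y = Z¹⁵ dominates all the
  -- quantities, and Y⁸ gives the exponent 120.
  have hpow : ∀ a b c : ℕ, c ≤ 2 ^ a → c * Z ^ b ≤ Z ^ (a + b) := fun a b c hc => by
    rw [pow_add]
    exact Nat.mul_le_mul_right _ (hc.trans (Nat.pow_le_pow_left hZ2 a))
  have hY : n + 1 ≤ Z ^ 15 := hnZ.trans (Nat.le_self_pow (by norm_num) Z)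
  have hK : 20 * n ^ 9 + 1 ≤ Z ^ 15 :=
    calc 20 * n ^ 9 + 1 ≤ 20 * Z ^ 9 + Z ^ 9 := by
          gcongr
          · omega
          · exact Nat.one_le_pow _ _ (by omega)
      _ = 21 * Z ^ 9 := by ring
      _ ≤ Z ^ 15 := hpow 6 9 21 (by norm_num)
  have hm : sampleCount n ε ν ≤ Z ^ 15 := by
    rcases Nat.eq_zero_or_pos n with h0 | hn1
    · subst h0
      simp [sampleCount]
    · refine le_trans ?_ (hpow 6 9 41 (by norm_num))
      have h1 := sampleCount_le (ν := ν) hε hn1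
      have h2 : max 2 (8 * ν ^ 2) ≤ 8 * (Z : ℝ) ^ 2 := by
        refine max_le (by nlinarith) ?_
        have : ν ≤ Z := by linarith
        gcongr
      have h3 : (n : ℝ) ^ 5 / ε ^ 2 ≤ (Z : ℝ) ^ 5 * (Z : ℝ) ^ 2 := by
        rw [div_eq_mul_one_div, ← one_div_pow]
        have h4 : (n : ℝ) ≤ Z := by linarith
        have h5 : 1 / ε ≤ Z := by linarith
        gcongr
      have h6 : (1 : ℝ) ≤ (Z : ℝ) ^ 9 := one_le_pow₀ (by linarith)
      have h7 : (sampleCount n ε ν : ℝ) ≤ 41 * (Z : ℝ) ^ 9 :=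
        calc (sampleCount n ε ν : ℝ)
            ≤ 5 * max 2 (8 * ν ^ 2) * ((n : ℝ) ^ 5 / ε ^ 2) + 1 := h1
          _ ≤ 5 * (8 * (Z : ℝ) ^ 2) * ((Z : ℝ) ^ 5 * (Z : ℝ) ^ 2) + (Z : ℝ) ^ 9 := by gcongr
          _ = 41 * (Z : ℝ) ^ 9 := by ring
      exact_mod_cast h7
  have htime := time_metaAlgorithm_le (g := g) (M := M) hY hK hm
    (smoothingSize n ε ν ^ 2) (smoothingSize n ε ν)
  calc (time g M (noisyContinuousGreedy n ε ν) : ℝ) ≤ ((66 * (Z ^ 15) ^ 8 : ℕ) : ℝ) := by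
        exact_mod_cast htime
    _ = 66 * (Z : ℝ) ^ 120 := by push_cast; rw [← pow_mul]
    _ ≤ 66 * (3 * X) ^ 120 := by gcongr
    _ = 66 * 3 ^ 120 * X ^ 120 := by rw [mul_pow, mul_assoc]

end

end NoisySubmodular

end

/-! ### The main theorem -/

open NoisySubmodular in
theorem theorem4p3 :
    -- the algorithm always returns an independent set,
    (∀ (n : ℕ) (ε ν : ℝ) (M : Matroid (Fin n)) (g : Finset (Fin n) → ℝ), M.E = Set.univ →
      ∀ S ∈ ((noisyContinuousGreedy n ε ν).run g M).support, M.Indep (S : Set (Fin n))) ∧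
    -- it runs in polynomial time,
    (∃ (K : ℝ) (d : ℕ), ∀ (n : ℕ) (ε ν : ℝ) (M : Matroid (Fin n)) (g : Finset (Fin n) → ℝ),
      0 < ε → 0 < ν → M.E = Set.univ →
      ((noisyContinuousGreedy n ε ν).time g M : ℝ) ≤ K * (1 + (n : ℝ) + 1 / ε + ν) ^ d) ∧
    -- and it has the approximation ratio `1 / e - 1 / Θ(log (n / ε)) - O(ε)`
    ∃ c C : ℝ, 0 < c ∧ 0 < C ∧ ∀ ν : ℝ, 0 < ν → ∃ C₀ : ℝ, 0 < C₀ ∧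
      ∀ (α ε : ℝ) (n : ℕ) (M : Matroid (Fin n)) (f : Finset (Fin n) → ℝ) (O : Finset (Fin n))
        (Ω : Type*) [MeasurableSpace Ω] (P : MeasureTheory.Measure Ω)
        [MeasureTheory.IsProbabilityMeasure P]
        (ξ : Finset (Fin n) → Ω → ℝ) (D : MeasureTheory.Measure ℝ),
        0 ≤ α → 0 < ε → α * ε < 2 * ν ^ 2 → ε < (n : ℝ) → 1 / ε ≤ (n : ℝ) →
        M.E = Set.univ → C₀ * (1 / ε * Real.log ((n : ℝ) / ε) ^ 2) ≤ (M.eRank.toNat : ℝ) →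
        (∀ S, 0 ≤ f S) → IsSubmodular f →
        IsNoise P ξ D ν α →
        M.Indep (O : Set (Fin n)) → (∀ S : Finset (Fin n), M.Indep (S : Set (Fin n)) → f S ≤ f O) →
        ENNReal.ofReal ((1 / Real.exp 1 - 1 / (c * Real.log ((n : ℝ) / ε)) - C * ε) * f O)
          ≤ expectedValue P ξ f M (noisyContinuousGreedy n ε ν) := by
  refine ⟨fun n ε ν M g _ S hS => Alg.sat_of_mem_support
      (Q := fun S : Finset (Fin n) => M.Indep (S : Set (Fin n))) (sat_metaAlgorithm _ _ _) hS,
    ⟨66 * 3 ^ 120, 120, fun n ε ν M g hε hν _ => time_noisyContinuousGreedy_le hε hν⟩,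
    1, 64, one_pos, by norm_num, fun ν hν => ?_⟩
  have hlogA : 0 ≤ Real.log (24 * max 2 (8 * ν ^ 2)) :=
    Real.log_nonneg (by linarith [le_max_left 2 (8 * ν ^ 2)])
  -- The square of the constant in `smoothingSize_le`, so that the rank condition becomes t² ≤ ε r.
  refine ⟨(11 + 2 * Real.log (24 * max 2 (8 * ν ^ 2))) ^ 2, by positivity, ?_⟩
  intro α ε n M f O Ω _ P _ ξ D hα hε0 hαε hεn hn hM hr hf0 hf hξ hOI hO
  have hlog : 0 < Real.log ((n : ℝ) / ε) := Real.log_pos ((one_lt_div hε0).2 hεn)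
  have he : 1 / Real.exp 1 ≤ 1 := by
    rw [div_le_one (Real.exp_pos 1)]
    linarith [Real.exp_one_gt_d9]
  rw [one_mul]
  by_cases hε : ε ≤ 1 / 64
  · obtain ⟨ht, hC, hL⟩ := parameters_valid (ν := ν) hε0 hε hn
    have ht' := smoothingSize_le (ν := ν) hε0 hε hn
    have hrank : (smoothingSize n ε ν : ℝ) ^ 2 ≤ ε * M.eRank.toNat := by
      have h1 := pow_le_pow_left₀ (by positivity) ht' 2
      have h2 := mul_le_mul_of_nonneg_left hr hε0.le
      refine h1.trans (le_trans (le_of_eq ?_) h2)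
      field_simp
    refine le_trans (ENNReal.ofReal_le_ofReal (mul_le_mul_of_nonneg_right ?_ (hf0 O)))
      (le_expectedValue_of_parameters hξ hν hα hM hf hf0 hOI hO hε0 hε hn hαε.le (by omega) hC
        (le_sampleCount n ε ν) hrank)
    have := one_div_le_one_div_of_le hlog hL
    linarith
  -- For ε > 1/64 one has 64ε > 1 ≥ 1/e, so the claimed ratio is negative.
  · have h1 : 0 < 1 / Real.log ((n : ℝ) / ε) := by positivity
    rw [ENNReal.ofReal_of_nonpos (mul_nonpos_of_nonpos_of_nonneg (by linarith) (hf0 O))]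
    exact zero_le
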